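/- **Lemma (Staggered-like doping).** *Model.* Let $N$ be even and consider a ring of $N$ qubits with sites $j\in\mathbb Z/N$ and a set of doped sites. Let $u=\mathrm{iSWAP}\,(H\otimes H)$ with $\mathrm{iSWAP}=\exp[i\tfrac{\pi}{4}(X\otimes X+Y\otimes Y)]$ and $H$ the Hadamard gate. One Floquet period consists of the unitary $U=V^{(2)}U_{\mathrm{even}}V^{(1)}U_{\mathrm{odd}}$, where $U_{\mathrm{odd}}$ (resp. $U_{\mathrm{even}}$) applies $u$ to all bonds $(j,j+1)$ with $j$ odd (resp. even) and $V^{(1)},V^{(2)}$ apply independent Haar-random single-qubit unitaries to the doped sites, followed by the depolarizing layer $\mathcal N_\gamma$ with $\mathcal N_\gamma(S)=e^{-\gamma w(S)}S$ on every Pauli string $S$ of weight $w(S)$ (the number of non-identity factors). With $\mathcal U(\rho)=U\rho U^\dagger$, the Floquet channel is $\Phi_F=\mathcal N_\gamma\circ\mathcal U$. Its Liouvillian gap is $\Delta_N(\gamma)=-\log\max|\mu|$, the maximum being over the eigenvalues $\mu\ne1$ of $\Phi_F$. Let $\Pi_3$ be the projector onto the span of the Pauli strings of weight at most $3$, and let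 $\Delta^{(3)}_N(\gamma)\in(-\infty,\infty]$ be defined in the same way from the weight-3 truncated propagator $\Pi_3\,\mathcal N_{\gamma/2}\,\mathcal U\,\mathcal N_{\gamma/2}\,\Pi_3$ (it is $+\infty$ if all eigenvalues other than $1$ vanish). A doping pattern is *staggered-like* if there is an undoped site and, going round the ring, each undoped site is separated from the next undoped site by one or two doped sites. *Statement.* Let $N_0<N_1<\dots$ be even system sizes. For each $k$ let a staggered-like pattern on $N_k$ sites be given, with Haar-random rotations that are independent within each circuit (the joint law of the circuits of different sizes is arbitrary). Then: 1. Almost surely, for every $\gamma\ge 1$, $$\limsup_{k\to\infty}\Delta^{(3)}_{N_k}(\gamma)\le 3\gamma+3 ,$$ and, for every real $\delta$, if weight-3 truncation is justified at $\gamma$ up to the error $\delta$, that is, if $\Delta_{N_k}(\gamma)\le\Delta^{(3)}_{N_k}(\gamma)+\delta$ for all large $k$, then $$\limsup_{k\to\infty}\Delta_{N_k}(\gamma)\le 3\gamma+3+\delta .$$ 2. Almost surely, for every $k$ there is a $\Gamma$ (depending on the circuit) such that $\Delta_{N_k}(\gamma)\le 3\gamma+3$ for all $\gamma\ge\Gamma$.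 -/

import Mathlib

open MeasureTheory ProbabilityTheory Filter
open scoped Kronecker

noncomputable section

namespace HaarFloquet

/-! ### Pauli strings on a periodic chain of `N` qubits -/

/-- Computational basis labels of a periodic chain of `N` qubits (sites are `ZMod N`). -/
abbrev Config (N : ℕ) : Type := ZMod N → Fin 2

/-- Operators on the Hilbert space of `N` qubits. -/
abbrev Op (N : ℕ) : Type := Matrix (Config N) (Config N) ℂ

/-- The Pauli matrices `I, X, Y, Z`. -/
def pauli : Fin 4 → Matrix (Fin 2) (Fin 2) ℂ :=
  ![1, !![0, 1; 1, 0], !![0, -Complex.I; Complex.I, 0], !![1, 0; 0, -1]]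

/-- A Pauli string: one of the labels `0, 1, 2, 3` (for `I, X, Y, Z`) at every site. -/
abbrev PauliString (N : ℕ) : Type := ZMod N → Fin 4

/-- The tensor product of single-site matrices over the chain. -/
def siteTensor {N : ℕ} [NeZero N] (A : ZMod N → Matrix (Fin 2) (Fin 2) ℂ) : Op N :=
  Matrix.of fun x y => ∏ j, A j (x j) (y j)

/-- The operator of a Pauli string. -/
def pauliOp {N : ℕ} [NeZero N] (S : PauliString N) : Op N :=
  siteTensor fun j => pauli (S j)

/-- The Pauli weight: the number of sites carrying a non-identity Pauli matrix. -/
def weight {N : ℕ} [NeZero N] (S : PauliString N) : ℕ :=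
  (Finset.univ.filter fun j => S j ≠ 0).card

/-- The superoperator that is diagonal in the Pauli basis, `S ↦ f S • S`, written through the
Pauli expansion `ρ = ∑ S, 2⁻ᴺ Tr(S ρ) S`. -/
def pauliDiag {N : ℕ} [NeZero N] (f : PauliString N → ℂ) : Op N →ₗ[ℂ] Op N where
  toFun ρ := ∑ S, (f S * ((2 : ℂ) ^ N)⁻¹ * (pauliOp S * ρ).trace) • pauliOp S
  map_add' ρ σ := by
    simp only [mul_add, Matrix.trace_add, add_smul, Finset.sum_add_distrib]
  map_smul' c ρ := by
    simp only [Matrix.mul_smul, Matrix.trace_smul, smul_eq_mul, RingHom.id_apply,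
      Finset.smul_sum, smul_smul]
    refine Finset.sum_congr rfl fun S _ => ?_
    congr 1
    ring

/-- The on-site depolarizing layer of strength `γ`: `S ↦ e^{-γ w(S)} S`. -/
def depolarizing (N : ℕ) [NeZero N] (γ : ℝ) : Op N →ₗ[ℂ] Op N :=
  pauliDiag fun S => ((Real.exp (-γ * (weight S : ℝ)) : ℝ) : ℂ)

/-- The projector onto the span of the Pauli strings of weight at most `w`. -/
def weightProj (N : ℕ) [NeZero N] (w : ℕ) : Op N →ₗ[ℂ] Op N :=
  pauliDiag fun S => if weight S ≤ w then 1 else 0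

/-! ### The unitary circuit -/

/-- The Hadamard gate. -/
def hadamard : Matrix (Fin 2) (Fin 2) ℂ :=
  ((Real.sqrt 2 : ℝ) : ℂ)⁻¹ • !![1, 1; 1, -1]

/-- The gate `iSWAP = exp[i π/4 (X ⊗ X + Y ⊗ Y)]`: it fixes `|00⟩` and `|11⟩` and exchanges
`|01⟩` and `|10⟩` with a factor `i`. -/
def iSWAP : Matrix (Fin 2 × Fin 2) (Fin 2 × Fin 2) ℂ :=
  Matrix.of fun a b =>
    if a.1 = a.2 then (if b = a then 1 else 0) else (if b = a.swap then Complex.I else 0)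

/-- The fixed two-qubit Clifford gate `u = iSWAP (H ⊗ H)`. -/
def cliffordGate : Matrix (Fin 2 × Fin 2) (Fin 2 × Fin 2) ℂ :=
  iSWAP * (hadamard ⊗ₖ hadamard)

/-- One brickwork layer: the gate `u` on all bonds `(j, j + 1)` with `j` odd (`p = 1`) or
`j` even (`p = 0`); for even `N` these bonds partition the ring. -/
def cliffordLayer (N : ℕ) [NeZero N] (p : ℕ) : Op N :=
  Matrix.of fun x y => ∏ j ∈ Finset.univ.filter (fun j : ZMod N => j.val % 2 = p),
    cliffordGate (x j, x (j + 1)) (y j, y (j + 1))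

/-- Single-qubit gates. -/
abbrev Gate : Type := Matrix.unitaryGroup (Fin 2) ℂ

/-- The layer of single-qubit rotations `V j` on the doped sites `j ∈ D`. -/
def dopingLayer {N : ℕ} [NeZero N] (D : Finset (ZMod N)) (V : ZMod N → Gate) : Op N :=
  siteTensor fun j => if j ∈ D then (V j : Matrix (Fin 2) (Fin 2) ℂ) else 1

/-- The unitary of one Floquet period: the odd bonds, the first rotations on the doped sites, the
even bonds, the second rotations on the doped sites. -/
def floquetUnitary {N : ℕ} [NeZero N] (D : Finset (ZMod N)) (V : Fin 2 → ZMod N → Gate) : Op N :=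
  dopingLayer D (V 1) * cliffordLayer N 0 * dopingLayer D (V 0) * cliffordLayer N 1

/-- The channel `ρ ↦ U ρ U†`. -/
def conjChannel {N : ℕ} [NeZero N] (U : Op N) : Op N →ₗ[ℂ] Op N :=
  LinearMap.mulLeftRight ℂ (U, U.conjTranspose)

/-! ### The Floquet channel, its weight truncation and the Liouvillian gap -/

/-- The one-period Floquet channel: the unitary stage followed by dissipation. -/
def floquetChannel {N : ℕ} [NeZero N] (γ : ℝ) (D : Finset (ZMod N))
    (V : Fin 2 → ZMod N → Gate) : Op N →ₗ[ℂ] Op N :=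
  depolarizing N γ ∘ₗ conjChannel (floquetUnitary D V)

/-- The symmetrized Floquet channel, similar to `floquetChannel`. -/
def symFloquetChannel {N : ℕ} [NeZero N] (γ : ℝ) (D : Finset (ZMod N))
    (V : Fin 2 → ZMod N → Gate) : Op N →ₗ[ℂ] Op N :=
  depolarizing N (γ / 2) ∘ₗ conjChannel (floquetUnitary D V) ∘ₗ depolarizing N (γ / 2)

/-- The symmetrized Floquet channel truncated to Pauli strings of weight at most `w`. -/
def truncatedChannel {N : ℕ} [NeZero N] (w : ℕ) (γ : ℝ) (D : Finset (ZMod N))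
    (V : Fin 2 → ZMod N → Gate) : Op N →ₗ[ℂ] Op N :=
  weightProj N w ∘ₗ symFloquetChannel γ D V ∘ₗ weightProj N w

/-- The gap of a one-period propagator: `-log` of the largest modulus of an eigenvalue other than
the eigenvalue `1` of the steady state. It is `⊤` if all those eigenvalues vanish. -/
def gap {N : ℕ} (Φ : Op N →ₗ[ℂ] Op N) : EReal :=
  -ENNReal.log (⨆ μ ∈ {μ : ℂ | Module.End.HasEigenvalue Φ μ ∧ μ ≠ 1}, ‖μ‖ₑ)

/-- The Liouvillian gap of the dissipative Haar-doped Floquet circuit. -/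
def liouvillianGap {N : ℕ} [NeZero N] (γ : ℝ) (D : Finset (ZMod N))
    (V : Fin 2 → ZMod N → Gate) : EReal :=
  gap (floquetChannel γ D V)

/-- The Liouvillian gap of the dynamics truncated to Pauli weight at most `w`. -/
def truncatedGap {N : ℕ} [NeZero N] (w : ℕ) (γ : ℝ) (D : Finset (ZMod N))
    (V : Fin 2 → ZMod N → Gate) : EReal :=
  gap (truncatedChannel w γ D V)

/-! ### Staggered-like doping -/

/-- There is an undoped site and, going round the ring, each undoped site is separated from the
next undoped one by one or two doped sites. -/
def StaggeredLike {N : ℕ} (D : Finset (ZMod N)) : Prop :=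
  (∃ i, i ∉ D) ∧
    ∀ i, i ∉ D → i + 1 ∈ D ∧ (i + 2 ∉ D ∨ (i + 2 ∈ D ∧ i + 3 ∉ D))

/-! ### Haar-random rotations -/

instance : MeasurableSpace Gate := borel Gate

instance : BorelSpace Gate := ⟨rfl⟩

instance : CompactSpace Gate := by
  suffices h : IsCompact ((Matrix.unitaryGroup (Fin 2) ℂ :
      Submonoid (Matrix (Fin 2) (Fin 2) ℂ)) : Set (Matrix (Fin 2) (Fin 2) ℂ)) from
    isCompact_iff_compactSpace.mp h
  have hbox : IsCompact
      (Set.univ.pi fun _ : Fin 2 => Set.univ.pi fun _ : Fin 2 => Metric.closedBall (0 : ℂ) 1) :=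
    isCompact_univ_pi fun _ => isCompact_univ_pi fun _ => isCompact_closedBall _ _
  refine hbox.of_isClosed_subset ?_ fun A hA i _ j _ => ?_
  · have h : ((Matrix.unitaryGroup (Fin 2) ℂ : Submonoid (Matrix (Fin 2) (Fin 2) ℂ)) :
        Set (Matrix (Fin 2) (Fin 2) ℂ)) = {A | A * star A = 1} := by
      ext A
      exact Matrix.mem_unitaryGroup_iff
    rw [h]
    exact isClosed_eq (by fun_prop) continuous_const
  · rw [mem_closedBall_zero_iff]
    exact entry_norm_bound_of_unitary hA i j

/-- The Haar probability measure on `U(2)`. -/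
def haarGate : Measure Gate := Measure.haarMeasure ⊤

/-- Independent Haar-random rotations, one for every site in each of the two layers. -/
def haarCircuit (N : ℕ) [NeZero N] : Measure (Fin 2 → ZMod N → Gate) :=
  Measure.pi fun _ => Measure.pi fun _ => haarGate

end HaarFloquet

end

noncomputable section

namespace HaarFloquet

/-! ### Tensor products over sites -/

section SiteTensor

variable {N : ℕ} [NeZero N]

/-! In the Pauli basis the gate `u` permutes pairs of labels up to sign (`gateL`, `gateR`), and a
rotation mixes X, Y, Z at a doped site but never changes the support. Damping and truncation depend
on the support alone, hence commute with the rotations, and the dynamics becomes a combinatorics of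
supports decorated with amplitudes.

Truncated dynamics. There is a right-moving soliton: a superposition of strings on sites `a, a + 1,
a + 2` with `a` odd, of weight 2 if `a + 1` is undoped and of weight 3 otherwise. In one period it
moves to `a + 2` with an explicit amplitude `amp` (`coreMatrix_mulVec_solVec`). Everything else that
it emits is lost: such a string spreads, both ends moving outwards by two sites per period. It could
keep weight at most 3 only if in every period one of its ends crosses two neighbouring doped sites,
and the pattern does not allow this three times in a row (`Spread.not_light`). So, up to a part that
the sixth power annihilates, the propagator `cutMatrix` shifts the solitons round the ring. After `N
/ 2` periods the soliton is back, and the propagator has an eigenvalue `μ` whose power `μ ^ (N / 2)`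
is the product of the damped amplitudes (`exists_hasEigenvalue_truncatedChannel`).

Size of that eigenvalue. A Bloch matrix element of a Haar rotation is uniform on [-1, 1]
(`map_rotated`), and `-log |x|` then has mean 1. Counting such factors, a step of a soliton of
weight `w` costs on average at most `6 - w` in the amplitude, up to terms that cancel round the
ring, and `γ w` in the damping (`negMoment_amp`, `sum_ampCost_add`). With the mean weight at most 3
and `γ ≥ 1`, the rate is at most `6 + 3 (γ - 1) = 3 γ + 3`. Amplitudes three steps apart are
independent, so a Chernoff bound with negative moments makes larger deviations exponentially rare in
`N`; Borel–Cantelli then needs no assumption on the joint law of the circuits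
(`ae_eventually_prod_amp`).

Full dynamics. Put `x = exp (-γ)`. On the non-identity strings the trace of the `m`-th power of the
channel is a polynomial in `x`. If a coefficient of degree below `3 m` does not vanish, then for
small `x` the trace dominates `x ^ (3 m)`, and some eigenvalue has modulus at least `x ^ 3`
(`exists_eigenvalue_of_tracePoly`). The coefficient is analytic in the gates, so it is almost surely
nonzero once it is nonzero for one choice of gates (`ae_ne_zero_of_analytic`). For suitable Clifford
rotations the period permutes Pauli strings and has an orbit of weight at most 3 that is somewhere
at most 2 (`StaggeredLike.exists_orbit`). Over an even number of turns its signs cancel, and it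
contributes a positive coefficient of low enough degree. -/

theorem siteTensor_mul (A B : ZMod N → Matrix (Fin 2) (Fin 2) ℂ) :
    siteTensor A * siteTensor B = siteTensor fun j => A j * B j := by
  ext x y
  simp only [siteTensor, Matrix.mul_apply, Matrix.of_apply, ← Finset.prod_mul_distrib]
  rw [Finset.prod_univ_sum, Fintype.piFinset_univ]

theorem trace_siteTensor (A : ZMod N → Matrix (Fin 2) (Fin 2) ℂ) :
    (siteTensor A).trace = ∏ j, (A j).trace := by
  simp only [siteTensor, Matrix.trace, Matrix.diag_apply, Matrix.of_apply]
  rw [Finset.prod_univ_sum, Fintype.piFinset_univ]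

theorem conjTranspose_siteTensor (A : ZMod N → Matrix (Fin 2) (Fin 2) ℂ) :
    (siteTensor A).conjTranspose = siteTensor fun j => (A j).conjTranspose := by
  ext x y
  simp [siteTensor, Matrix.conjTranspose_apply]

theorem siteTensor_sum (c : ZMod N → Fin 4 → ℂ) :
    (siteTensor fun j => ∑ p, c j p • pauli p) =
      ∑ S : PauliString N, (∏ j, c j (S j)) • pauliOp S := by
  ext x y
  simp only [siteTensor, pauliOp, Matrix.of_apply, Matrix.sum_apply, Matrix.smul_apply,
    smul_eq_mul, ← Finset.prod_mul_distrib]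
  rw [Finset.prod_univ_sum, Fintype.piFinset_univ]

theorem trace_pauli_mul_pauli (p q : Fin 4) :
    (pauli p * pauli q).trace = if p = q then 2 else 0 := by
  fin_cases p <;> fin_cases q <;>
    simp [pauli, Matrix.trace, Fin.sum_univ_two] <;> norm_num

theorem trace_pauliOp_mul_pauliOp (S T : PauliString N) :
    (pauliOp S * pauliOp T).trace = if S = T then (2 : ℂ) ^ N else 0 := by
  rw [pauliOp, pauliOp, siteTensor_mul, trace_siteTensor]
  simp only [trace_pauli_mul_pauli]
  split_ifs with h
  · subst h; simp [ZMod.card]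
  · obtain ⟨j, hj⟩ := Function.ne_iff.mp h
    exact Finset.prod_eq_zero (Finset.mem_univ j) (if_neg hj)

theorem pauliDiag_pauliOp (f : PauliString N → ℂ) (S : PauliString N) :
    pauliDiag f (pauliOp S) = f S • pauliOp S := by
  change ∑ T, (f T * ((2 : ℂ) ^ N)⁻¹ * (pauliOp T * pauliOp S).trace) • pauliOp T = _
  rw [Finset.sum_eq_single S]
  · simp [trace_pauliOp_mul_pauliOp]
  · intro T _ hT
    simp [trace_pauliOp_mul_pauliOp, hT]
  · simp

/-- The operator with given Pauli coefficients. -/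
def ofCoeff : (PauliString N → ℂ) →ₗ[ℂ] Op N where
  toFun c := ∑ S, c S • pauliOp S
  map_add' c d := by simp [add_smul, Finset.sum_add_distrib]
  map_smul' a c := by simp [Finset.smul_sum, smul_smul]

theorem ofCoeff_apply (c : PauliString N → ℂ) : ofCoeff c = ∑ S, c S • pauliOp S := rfl

/-- Trace orthogonality of the Pauli strings. Independence is all that is needed, because
eigenvectors are transported from coefficients to operators and never back. -/
theorem ofCoeff_injective : Function.Injective (ofCoeff (N := N)) := by
  rw [← LinearMap.ker_eq_bot, LinearMap.ker_eq_bot']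
  intro c hc
  funext T
  have h := congrArg (fun ρ => (pauliOp T * ρ).trace) hc
  simp only [ofCoeff_apply, Finset.mul_sum, Matrix.mul_smul, Matrix.trace_sum, Matrix.trace_smul,
    trace_pauliOp_mul_pauliOp, mul_zero, Matrix.trace_zero] at h
  simpa using h

/-- A superoperator acts on Pauli coefficients as the given matrix. -/
def HasPauliMatrix (Φ : Op N →ₗ[ℂ] Op N) (M : Matrix (PauliString N) (PauliString N) ℂ) : Prop :=
  ∀ T, Φ (pauliOp T) = ∑ S, M S T • pauliOp S

theorem HasPauliMatrix.apply {Φ : Op N →ₗ[ℂ] Op N}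
    {M : Matrix (PauliString N) (PauliString N) ℂ} (h : HasPauliMatrix Φ M)
    (c : PauliString N → ℂ) : Φ (ofCoeff c) = ofCoeff (M.mulVec c) := by
  rw [ofCoeff_apply, ofCoeff_apply, map_sum]
  simp only [map_smul, h _, Matrix.mulVec, dotProduct, Finset.sum_smul, Finset.smul_sum, smul_smul]
  rw [Finset.sum_comm]
  exact Finset.sum_congr rfl fun S _ => Finset.sum_congr rfl fun T _ => by rw [mul_comm]

theorem HasPauliMatrix.comp {Φ Ψ : Op N →ₗ[ℂ] Op N}
    {M M' : Matrix (PauliString N) (PauliString N) ℂ} (h : HasPauliMatrix Φ M)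
    (h' : HasPauliMatrix Ψ M') : HasPauliMatrix (Φ ∘ₗ Ψ) (M * M') := by
  intro T
  have := h.apply fun S => M' S T
  rw [LinearMap.comp_apply, h' T]
  exact this

theorem hasPauliMatrix_pauliDiag (f : PauliString N → ℂ) :
    HasPauliMatrix (pauliDiag f) (Matrix.diagonal f) := by
  intro T
  rw [pauliDiag_pauliOp, Finset.sum_eq_single T]
  · simp
  · intro S _ hS; simp [hS]
  · simp

theorem HasPauliMatrix.hasEigenvalue {Φ : Op N →ₗ[ℂ] Op N}
    {M : Matrix (PauliString N) (PauliString N) ℂ} (h : HasPauliMatrix Φ M) {μ : ℂ}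
    {c : PauliString N → ℂ} (hc : c ≠ 0) (hM : M.mulVec c = μ • c) :
    Module.End.HasEigenvalue Φ μ := by
  refine Module.End.hasEigenvalue_of_hasEigenvector (x := ofCoeff c) ⟨?_, ?_⟩
  · rw [Module.End.mem_eigenspace_iff, h.apply, hM, map_smul]
  · rw [← map_zero (ofCoeff (N := N))]
    exact fun e => hc (ofCoeff_injective e)

end SiteTensor

/-! ### Single-qubit rotations on Pauli labels -/

/-- The Pauli transfer matrix of a single-qubit operator. -/
def transfer (V : Matrix (Fin 2) (Fin 2) ℂ) (p q : Fin 4) : ℂ :=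
  (pauli p * V * pauli q * V.conjTranspose).trace / 2

theorem pauli_expansion (M : Matrix (Fin 2) (Fin 2) ℂ) :
    ∑ p, ((pauli p * M).trace / 2) • pauli p = M := by
  ext i j
  fin_cases i <;> fin_cases j <;>
    simp [pauli, Fin.sum_univ_four, Matrix.trace, Matrix.mul_apply, Fin.sum_univ_two] <;>
    ring_nf <;> simp <;> ring

theorem conj_pauli_eq_sum_transfer (V : Matrix (Fin 2) (Fin 2) ℂ) (q : Fin 4) :
    V * pauli q * V.conjTranspose = ∑ p, transfer V p q • pauli p := by
  rw [← pauli_expansion (V * pauli q * V.conjTranspose)]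
  simp only [transfer, Matrix.mul_assoc]

theorem transfer_one (p q : Fin 4) : transfer 1 p q = if p = q then 1 else 0 := by
  simp [transfer, trace_pauli_mul_pauli]
  split_ifs <;> simp

theorem transfer_zero_right (V : Gate) (p : Fin 4) :
    transfer V p 0 = if p = 0 then 1 else 0 := by
  have h : (V : Matrix (Fin 2) (Fin 2) ℂ) * (V : Matrix (Fin 2) (Fin 2) ℂ).conjTranspose = 1 :=
    Matrix.mem_unitaryGroup_iff.mp V.2
  have h0 : pauli 0 = 1 := rfl
  have := trace_pauli_mul_pauli p 0
  rw [h0, mul_one] at this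
  rw [transfer, h0, mul_one, Matrix.mul_assoc, h, mul_one, this]
  split_ifs <;> simp

/-- Trace preservation. With unitality (`transfer_zero_right`) it makes the transfer matrix block
diagonal, so a rotation neither creates nor destroys support. -/
theorem transfer_zero_left (V : Gate) (q : Fin 4) :
    transfer V 0 q = if q = 0 then 1 else 0 := by
  have h : (V : Matrix (Fin 2) (Fin 2) ℂ).conjTranspose * (V : Matrix (Fin 2) (Fin 2) ℂ) = 1 :=
    Matrix.mem_unitaryGroup_iff'.mp V.2
  have h0 : pauli 0 = 1 := rfl
  have := trace_pauli_mul_pauli q 0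
  rw [h0, mul_one] at this
  rw [transfer, h0, one_mul, Matrix.mul_assoc, Matrix.trace_mul_comm, Matrix.mul_assoc, h, mul_one,
    this]
  split_ifs <;> simp

section Rotation

variable {N : ℕ} [NeZero N]

/-- The gate applied at a site: the rotation if the site is doped. -/
def siteGate (D : Finset (ZMod N)) (V : ZMod N → Gate) (j : ZMod N) : Gate :=
  if j ∈ D then V j else 1

/-- The action of a layer of rotations on Pauli coefficients. -/
def rotMatrix (D : Finset (ZMod N)) (V : ZMod N → Gate) :
    Matrix (PauliString N) (PauliString N) ℂ :=
  Matrix.of fun S T => ∏ j, transfer (siteGate D V j) (S j) (T j)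

theorem dopingLayer_eq (D : Finset (ZMod N)) (V : ZMod N → Gate) :
    dopingLayer D V = siteTensor fun j => (siteGate D V j : Matrix (Fin 2) (Fin 2) ℂ) := by
  rw [dopingLayer]
  congr 1
  funext j
  rw [siteGate]
  split_ifs <;> rfl

theorem conjChannel_mul (U W : Op N) :
    conjChannel (U * W) = conjChannel U ∘ₗ conjChannel W := by
  refine LinearMap.ext fun ρ => ?_
  simp [conjChannel, Matrix.conjTranspose_mul, Matrix.mul_assoc]

theorem hasPauliMatrix_dopingLayer (D : Finset (ZMod N)) (V : ZMod N → Gate) :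
    HasPauliMatrix (conjChannel (dopingLayer D V)) (rotMatrix D V) := by
  intro T
  have h : conjChannel (dopingLayer D V) (pauliOp T) =
      dopingLayer D V * pauliOp T * (dopingLayer D V).conjTranspose := by
    simp [conjChannel]
  rw [h, dopingLayer_eq, conjTranspose_siteTensor, pauliOp, siteTensor_mul, siteTensor_mul]
  simp only [conj_pauli_eq_sum_transfer]
  rw [siteTensor_sum]
  rfl

end Rotation

/-! ### The Clifford gate on Pauli labels -/

/-- The left output label of the Clifford gate. -/
def gateL : Fin 4 → Fin 4 → Fin 4 :=
  ![![0, 3, 1, 2], ![0, 3, 1, 2], ![3, 0, 2, 1], ![3, 0, 2, 1]]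

/-- The right output label of the Clifford gate. -/
def gateR : Fin 4 → Fin 4 → Fin 4 :=
  ![![0, 0, 3, 3], ![3, 3, 0, 0], ![1, 1, 2, 2], ![2, 2, 1, 1]]

/-- The sign of the action of the Clifford gate on a pair of Pauli matrices. -/
def gateSign (s t : Fin 4) : ℂ := if (s = 2 ∧ t = 3) ∨ (s = 3 ∧ t = 2) then -1 else 1

theorem gate_injective {s t s' t' : Fin 4} (hl : gateL s t = gateL s' t')
    (hr : gateR s t = gateR s' t') : s = s' ∧ t = t' := by
  revert s t s' t'; decide

/-- The unnormalized Clifford gate. -/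
def rawGate : Matrix (Fin 2 × Fin 2) (Fin 2 × Fin 2) ℂ :=
  iSWAP * (!![1, 1; 1, -1] ⊗ₖ !![1, 1; 1, -1])

/-- The two factors `1/√2` combine to `1/2`, so the entries of `rawGate` are Gaussian integers and
the Clifford relations reduce to finite checks. -/
theorem cliffordGate_eq : cliffordGate = (2 : ℂ)⁻¹ • rawGate := by
  rw [cliffordGate, rawGate, hadamard, Matrix.smul_kronecker, Matrix.kronecker_smul, smul_smul,
    Matrix.mul_smul, ← mul_inv, ← Complex.ofReal_mul, Real.mul_self_sqrt (by norm_num)]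
  norm_num

theorem iSWAP_mul_apply (M : Matrix (Fin 2 × Fin 2) (Fin 2 × Fin 2) ℂ) (a b : Fin 2 × Fin 2) :
    (iSWAP * M) a b = if a.1 = a.2 then M a b else Complex.I * M a.swap b := by
  rw [Matrix.mul_apply]
  by_cases h : a.1 = a.2
  · rw [Finset.sum_eq_single a] <;> simp +contextual [iSWAP, h]
  · rw [Finset.sum_eq_single a.swap] <;> simp +contextual [iSWAP, h]

theorem mul_iSWAP_apply (M : Matrix (Fin 2 × Fin 2) (Fin 2 × Fin 2) ℂ) (a b : Fin 2 × Fin 2) :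
    (M * iSWAP) a b = if b.1 = b.2 then M a b else M a b.swap * Complex.I := by
  have hb (c : Fin 2 × Fin 2) : iSWAP c b =
      if b.1 = b.2 then (if c = b then 1 else 0) else (if c = b.swap then Complex.I else 0) := by
    obtain ⟨c1, c2⟩ := c
    obtain ⟨b1, b2⟩ := b
    fin_cases c1 <;> fin_cases c2 <;> fin_cases b1 <;> fin_cases b2 <;> simp [iSWAP]
  rw [Matrix.mul_apply]
  simp only [hb]
  by_cases h : b.1 = b.2
  · rw [Finset.sum_eq_single b] <;> simp +contextual [h]
  · rw [Finset.sum_eq_single b.swap] <;> simp +contextual [h]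

/-- The image of a Pauli label under the Hadamard gate. -/
def hadLabel : Fin 4 → Fin 4 := ![0, 3, 2, 1]

/-- The sign of the image of a Pauli matrix under the Hadamard gate. -/
def hadSign : Fin 4 → ℂ := ![1, 1, -1, 1]

theorem rawHadamard_mul_pauli (s : Fin 4) :
    (!![1, 1; 1, -1] : Matrix (Fin 2) (Fin 2) ℂ) * pauli s =
      hadSign s • (pauli (hadLabel s) * !![1, 1; 1, -1]) := by
  ext a c
  fin_cases s <;> fin_cases a <;> fin_cases c <;>
    simp [pauli, hadLabel, hadSign, Matrix.mul_apply, Fin.sum_univ_two]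

/-- The tables describe conjugation by `u = iSWAP (H ⊗ H)`; conjugation by iSWAP alone is read off
from them at the Hadamard images of the labels, with the Hadamard signs divided out. -/
theorem iSWAP_mul_pauli (s t : Fin 4) :
    iSWAP * (pauli s ⊗ₖ pauli t) =
      (gateSign (hadLabel s) (hadLabel t) * hadSign s * hadSign t) •
        ((pauli (gateL (hadLabel s) (hadLabel t)) ⊗ₖ pauli (gateR (hadLabel s) (hadLabel t))) *
          iSWAP) := by
  ext ⟨a, b⟩ ⟨c, d⟩
  rw [Matrix.smul_apply, iSWAP_mul_apply, mul_iSWAP_apply]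
  simp only [Matrix.kroneckerMap_apply, Prod.swap_prod_mk]
  revert a b c d
  fin_cases s <;> fin_cases t <;>
    simp [Fin.forall_fin_two, pauli, gateL, gateR, gateSign, hadLabel, hadSign]

theorem hadLabel_hadLabel (s : Fin 4) : hadLabel (hadLabel s) = s := by
  revert s; decide

theorem hadSign_mul (s : Fin 4) : hadSign s * hadSign (hadLabel s) = 1 := by
  fin_cases s <;> simp [hadSign, hadLabel]

theorem rawGate_mul_pauli (s t : Fin 4) :
    rawGate * (pauli s ⊗ₖ pauli t) =
      gateSign s t • ((pauli (gateL s t) ⊗ₖ pauli (gateR s t)) * rawGate) := by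
  rw [rawGate, Matrix.mul_assoc, ← Matrix.mul_kronecker_mul, rawHadamard_mul_pauli,
    rawHadamard_mul_pauli, Matrix.smul_kronecker, Matrix.kronecker_smul, smul_smul,
    Matrix.mul_smul, Matrix.mul_kronecker_mul, ← Matrix.mul_assoc, iSWAP_mul_pauli,
    Matrix.smul_mul, smul_smul, hadLabel_hadLabel, hadLabel_hadLabel, Matrix.mul_assoc]
  congr 1
  linear_combination (gateSign s t * hadSign t * hadSign (hadLabel t)) * hadSign_mul s +
    gateSign s t * hadSign_mul t

theorem rawGate_mul_conjTranspose : rawGate * rawGate.conjTranspose = (4 : ℂ) • 1 := by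
  have hi : iSWAP * iSWAP.conjTranspose = 1 := by
    ext ⟨a, b⟩ ⟨c, d⟩
    rw [iSWAP_mul_apply]
    fin_cases a <;> fin_cases b <;> fin_cases c <;> fin_cases d <;>
      simp [iSWAP, Matrix.conjTranspose_apply]
  have hh : (!![1, 1; 1, -1] : Matrix (Fin 2) (Fin 2) ℂ) * (!![1, 1; 1, -1]).conjTranspose =
      (2 : ℂ) • 1 := by
    ext a b
    fin_cases a <;> fin_cases b <;>
      simp [Matrix.mul_apply, Fin.sum_univ_two, Matrix.conjTranspose_apply] <;> norm_num
  rw [rawGate, Matrix.conjTranspose_mul, Matrix.conjTranspose_kronecker, Matrix.mul_assoc,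
    ← Matrix.mul_assoc (_ ⊗ₖ _) (_ ⊗ₖ _), ← Matrix.mul_kronecker_mul, hh, Matrix.smul_kronecker,
    Matrix.kronecker_smul, smul_smul, Matrix.one_kronecker_one, Matrix.smul_mul, Matrix.one_mul,
    Matrix.mul_smul, hi]
  norm_num

theorem cliffordGate_conj_pauli (s t : Fin 4) :
    cliffordGate * (pauli s ⊗ₖ pauli t) * cliffordGate.conjTranspose =
      gateSign s t • (pauli (gateL s t) ⊗ₖ pauli (gateR s t)) := by
  rw [cliffordGate_eq, Matrix.conjTranspose_smul, Matrix.smul_mul, Matrix.smul_mul, Matrix.mul_smul,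
    rawGate_mul_pauli, Matrix.smul_mul, Matrix.mul_assoc, rawGate_mul_conjTranspose,
    Matrix.mul_smul, Matrix.mul_one, smul_smul, smul_smul, smul_smul]
  congr 1
  simp
  ring

/-! ### Tensor products over bonds -/

section Bonds

variable {N : ℕ} [NeZero N]

/-- Parity survives the wrap-around only because `N` is even; this makes the two brickwork layers
well defined on the ring. -/
theorem val_add_one_mod_two (hN : Even N) (j : ZMod N) : (j + 1).val % 2 = (j.val + 1) % 2 := by
  have h2 : 2 ∣ N := hN.two_dvd
  rw [ZMod.val_add, Nat.mod_mod_of_dvd _ h2, Nat.add_mod, ZMod.val_one_eq_one_mod,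
    Nat.mod_mod_of_dvd _ h2, ← Nat.add_mod]

theorem val_sub_one_mod_two (hN : Even N) (j : ZMod N) : (j - 1).val % 2 = (j.val + 1) % 2 := by
  have := val_add_one_mod_two hN (j - 1)
  rw [sub_add_cancel] at this
  omega

/-- Configurations of a ring as configurations of the bonds of one brickwork layer. -/
def bondEquiv (hN : Even N) {p : ℕ} (hp : p < 2) (α : Type*) :
    (ZMod N → α) ≃ ({j : ZMod N // j.val % 2 = p} → α × α) where
  toFun x j := (x j, x (j + 1))
  invFun f k := if h : k.val % 2 = p then (f ⟨k, h⟩).1 else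
    (f ⟨k - 1, by have := val_sub_one_mod_two hN k; omega⟩).2
  left_inv x := by
    funext k
    by_cases h : k.val % 2 = p <;> simp [h]
  right_inv f := by
    funext ⟨j, hj⟩
    have h1 := val_add_one_mod_two hN j
    have h2 : ¬ (j + 1).val % 2 = p := by omega
    simp [hj, h2]

/-- The bonds of a brickwork layer, labelled by their left site. -/
def bonds (N : ℕ) [NeZero N] (p : ℕ) : Finset (ZMod N) :=
  Finset.univ.filter fun j : ZMod N => j.val % 2 = p

/-- The tensor product of two-site matrices over the bonds of a brickwork layer. -/
def bondTensor (p : ℕ) (A : ZMod N → Matrix (Fin 2 × Fin 2) (Fin 2 × Fin 2) ℂ) : Op N :=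
  Matrix.of fun x y => ∏ j ∈ bonds N p, A j (x j, x (j + 1)) (y j, y (j + 1))

theorem cliffordLayer_eq (p : ℕ) : cliffordLayer N p = bondTensor p fun _ => cliffordGate := rfl

theorem prod_bonds_eq {p : ℕ} (f : ZMod N → ℂ) :
    ∏ j ∈ bonds N p, f j = ∏ j : {j : ZMod N // j.val % 2 = p}, f j :=
  Finset.prod_subtype _ (by simp [bonds]) _

theorem bondTensor_mul (hN : Even N) {p : ℕ} (hp : p < 2)
    (A B : ZMod N → Matrix (Fin 2 × Fin 2) (Fin 2 × Fin 2) ℂ) :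
    bondTensor p A * bondTensor p B = bondTensor p fun j => A j * B j := by
  ext x y
  simp only [bondTensor, Matrix.mul_apply, Matrix.of_apply, ← Finset.prod_mul_distrib,
    prod_bonds_eq]
  rw [Finset.prod_univ_sum, Fintype.piFinset_univ, ← (bondEquiv hN hp (Fin 2)).sum_comp]
  rfl

theorem conjTranspose_bondTensor (p : ℕ)
    (A : ZMod N → Matrix (Fin 2 × Fin 2) (Fin 2 × Fin 2) ℂ) :
    (bondTensor p A).conjTranspose = bondTensor p fun j => (A j).conjTranspose := by
  ext x y
  simp [bondTensor, Matrix.conjTranspose_apply]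

theorem prod_sites_eq (hN : Even N) {p : ℕ} (hp : p < 2) (f : ZMod N → ℂ) :
    ∏ j, f j = ∏ j ∈ bonds N p, f j * f (j + 1) := by
  rw [Finset.prod_mul_distrib, ← Finset.prod_filter_mul_prod_filter_not Finset.univ
    fun j : ZMod N => j.val % 2 = p]
  congr 1
  refine Finset.prod_bij' (fun j _ => j - 1) (fun j _ => j + 1) ?_ ?_ ?_ ?_ ?_
  · intro j hj
    have := val_sub_one_mod_two hN j
    simp only [bonds, Finset.mem_filter, Finset.mem_univ, true_and] at hj ⊢
    omega
  · intro j hj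
    have := val_add_one_mod_two hN j
    simp only [bonds, Finset.mem_filter, Finset.mem_univ, true_and] at hj ⊢
    omega
  · simp
  · simp
  · simp

theorem pauliOp_eq_bondTensor (hN : Even N) {p : ℕ} (hp : p < 2) (S : PauliString N) :
    pauliOp S = bondTensor p fun j => pauli (S j) ⊗ₖ pauli (S (j + 1)) := by
  ext x y
  simp only [pauliOp, siteTensor, bondTensor, Matrix.of_apply, Matrix.kroneckerMap_apply]
  exact prod_sites_eq hN hp _

/-- The image of a Pauli string under a brickwork layer, up to a sign. -/
def layerMap (p : ℕ) (S : PauliString N) : PauliString N := fun j =>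
  if j.val % 2 = p then gateL (S j) (S (j + 1)) else gateR (S (j - 1)) (S j)

/-- The sign of the image of a Pauli string under a brickwork layer. -/
def layerSign (p : ℕ) (S : PauliString N) : ℂ := ∏ j ∈ bonds N p, gateSign (S j) (S (j + 1))

theorem layerMap_left {p : ℕ} (S : PauliString N) {j : ZMod N} (hj : j.val % 2 = p) :
    layerMap p S j = gateL (S j) (S (j + 1)) := if_pos hj

theorem layerMap_right (hN : Even N) {p : ℕ} (S : PauliString N) {j : ZMod N}
    (hj : j.val % 2 = p) : layerMap p S (j + 1) = gateR (S j) (S (j + 1)) := by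
  have := val_add_one_mod_two hN j
  rw [layerMap, if_neg (by omega), add_sub_cancel_right]

theorem conjChannel_cliffordLayer (hN : Even N) {p : ℕ} (hp : p < 2) (S : PauliString N) :
    conjChannel (cliffordLayer N p) (pauliOp S) = layerSign p S • pauliOp (layerMap p S) := by
  have h : conjChannel (cliffordLayer N p) (pauliOp S) =
      cliffordLayer N p * pauliOp S * (cliffordLayer N p).conjTranspose := by
    simp [conjChannel]
  rw [h, cliffordLayer_eq, conjTranspose_bondTensor, pauliOp_eq_bondTensor hN hp,
    pauliOp_eq_bondTensor hN hp, bondTensor_mul hN hp, bondTensor_mul hN hp]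
  ext x y
  simp only [cliffordGate_conj_pauli, bondTensor, Matrix.of_apply, Matrix.smul_apply, smul_eq_mul,
    Finset.prod_mul_distrib, layerSign]
  congr 1
  refine Finset.prod_congr rfl fun j hj => ?_
  have hj' : j.val % 2 = p := by simpa [bonds] using hj
  rw [layerMap_left S hj', layerMap_right hN S hj']

/-- The action of a brickwork layer on Pauli coefficients. -/
def layerMatrix (N p : ℕ) [NeZero N] : Matrix (PauliString N) (PauliString N) ℂ :=
  Matrix.of fun S T => if S = layerMap p T then layerSign p T else 0

theorem hasPauliMatrix_cliffordLayer (hN : Even N) {p : ℕ} (hp : p < 2) :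
    HasPauliMatrix (conjChannel (cliffordLayer N p)) (layerMatrix N p) := by
  intro T
  rw [conjChannel_cliffordLayer hN hp]
  simp [layerMatrix]

theorem layerMap_injective (hN : Even N) {p : ℕ} (hp : p < 2) :
    Function.Injective (layerMap (N := N) p) := by
  intro S T h
  have key (j : ZMod N) (hj : j.val % 2 = p) : S j = T j ∧ S (j + 1) = T (j + 1) := by
    apply gate_injective
    · rw [← layerMap_left S hj, ← layerMap_left T hj, h]
    · rw [← layerMap_right hN S hj, ← layerMap_right hN T hj, h]
  funext j
  by_cases hj : j.val % 2 = p
  · exact (key j hj).1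
  · have h1 := val_sub_one_mod_two hN j
    have := (key (j - 1) (by omega)).2
    rwa [sub_add_cancel] at this

/-- The action of the Floquet unitary on Pauli coefficients. -/
def floquetMatrix (D : Finset (ZMod N)) (V : Fin 2 → ZMod N → Gate) :
    Matrix (PauliString N) (PauliString N) ℂ :=
  rotMatrix D (V 1) * layerMatrix N 0 * rotMatrix D (V 0) * layerMatrix N 1

theorem hasPauliMatrix_floquetUnitary (hN : Even N) (D : Finset (ZMod N))
    (V : Fin 2 → ZMod N → Gate) :
    HasPauliMatrix (conjChannel (floquetUnitary D V)) (floquetMatrix D V) := by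
  rw [floquetUnitary, conjChannel_mul, conjChannel_mul, conjChannel_mul]
  exact (((hasPauliMatrix_dopingLayer D _).comp (hasPauliMatrix_cliffordLayer hN (by norm_num))).comp
    (hasPauliMatrix_dopingLayer D _)).comp (hasPauliMatrix_cliffordLayer hN (by norm_num))

/-- Two Pauli strings have the same support and the same labels on the undoped sites. -/
def SameClass (D : Finset (ZMod N)) (S T : PauliString N) : Prop :=
  ∀ j, (S j = 0 ↔ T j = 0) ∧ (j ∉ D → S j = T j)

theorem SameClass.weight_eq {D : Finset (ZMod N)} {S T : PauliString N} (h : SameClass D S T) :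
    weight S = weight T := by
  simp only [weight, ne_eq, (h _).1]

/-- Each factor of the product is nonzero: a doped site keeps the identity label apart from X, Y, Z,
and an undoped site carries the identity matrix. -/
theorem sameClass_of_rotMatrix_ne_zero {D : Finset (ZMod N)} {V : ZMod N → Gate}
    {S T : PauliString N} (h : rotMatrix D V S T ≠ 0) : SameClass D S T := by
  intro j
  have hj : transfer (siteGate D V j) (S j) (T j) ≠ 0 :=
    Finset.prod_ne_zero_iff.mp h j (Finset.mem_univ j)
  refine ⟨⟨fun h0 => ?_, fun h0 => ?_⟩, fun hD => ?_⟩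
  · by_contra hc; rw [h0, transfer_zero_left, if_neg hc] at hj; exact hj rfl
  · by_contra hc; rw [h0, transfer_zero_right, if_neg hc] at hj; exact hj rfl
  · by_contra hc
    rw [siteGate, if_neg hD] at hj
    exact hj ((transfer_one _ _).trans (if_neg hc))

/-- The weight is constant on the blocks of a rotation layer. This allows the period to be cut
before the second rotations instead of after them. -/
theorem diagonal_mul_rotMatrix (D : Finset (ZMod N)) (V : ZMod N → Gate) (f : ℕ → ℂ) :
    Matrix.diagonal (fun S => f (weight S)) * rotMatrix D V =
      rotMatrix D V * Matrix.diagonal fun S => f (weight S) := by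
  ext S T
  rw [Matrix.diagonal_mul, Matrix.mul_diagonal, mul_comm]
  by_cases h : rotMatrix D V S T = 0
  · simp [h]
  · rw [(sameClass_of_rotMatrix_ne_zero h).weight_eq]

end Bonds

/-! ### One period as a local relation between label sequences on the line -/

/-- Two label sequences have the same support and agree on the undoped sites. -/
def LineClass (U : ℤ → Prop) (s t : ℤ → Fin 4) : Prop :=
  ∀ i, (s i = 0 ↔ t i = 0) ∧ (U i → s i = t i)

/-- The label sequence `t` arises from `s` by the gate on all bonds of parity `p`. -/
def LineLayer (p : ℤ) (s t : ℤ → Fin 4) : Prop :=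
  ∀ i, i % 2 = p → t i = gateL (s i) (s (i + 1)) ∧ t (i + 1) = gateR (s i) (s (i + 1))

/-- The label sequence `s'` can arise from `s` in one period: rotations, odd bonds, rotations,
even bonds. -/
def LineStep (U : ℤ → Prop) (s s' : ℤ → Fin 4) : Prop :=
  ∃ p p' q, LineClass U p s ∧ LineLayer 1 p p' ∧ LineClass U q p' ∧ LineLayer 0 q s'

/-- No two neighbouring sites are undoped and no three consecutive sites are doped. -/
def LinePattern (U : ℤ → Prop) : Prop :=
  ∀ i, (U i → ¬ U (i + 1)) ∧ (U i ∨ U (i + 1) ∨ U (i + 2))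

theorem gateL_zero_left_eq_zero {t : Fin 4} : gateL 0 t = 0 ↔ t = 0 := by revert t; decide

theorem gateR_zero_right_eq_zero {t : Fin 4} : gateR t 0 = 0 ↔ t = 0 := by revert t; decide

theorem gate_zero_zero : gateL 0 0 = 0 ∧ gateR 0 0 = 0 := by decide

theorem gate_eq_zero {s t : Fin 4} (hl : gateL s t = 0) (hr : gateR s t = 0) : s = 0 ∧ t = 0 := by
  revert s t; decide

/-- The support of the label sequence lies in `[ℓ, r]` modulo `n`, the ends `ℓ` even and `r` odd
are occupied: both ends move outwards under the dynamics. -/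
def Spread (n : ℤ) (ℓ r : ℤ) (s : ℤ → Fin 4) : Prop :=
  ℓ % 2 = 0 ∧ r % 2 = 1 ∧ s ℓ ≠ 0 ∧ s r ≠ 0 ∧ ∀ i, r < i → i < ℓ + n → s i = 0

section Line

variable {U : ℤ → Prop} {s s' : ℤ → Fin 4} {n : ℤ}

theorem LineClass.ne_zero {s t : ℤ → Fin 4} (h : LineClass U s t) {i : ℤ} (hi : t i ≠ 0) :
    s i ≠ 0 := fun h0 => hi ((h i).1.mp h0)

theorem LineClass.eq_zero {s t : ℤ → Fin 4} (h : LineClass U s t) {i : ℤ} (hi : t i = 0) :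
    s i = 0 := (h i).1.mpr hi

theorem LineLayer.at_left {p : ℤ} {s t : ℤ → Fin 4} (h : LineLayer p s t) {i j : ℤ}
    (hi : i % 2 = p) (hj : j = i + 1) : t i = gateL (s i) (s j) := by
  subst hj; exact (h i hi).1

theorem LineLayer.at_right {p : ℤ} {s t : ℤ → Fin 4} (h : LineLayer p s t) {i j : ℤ}
    (hi : i % 2 = p) (hj : j = i + 1) : t j = gateR (s i) (s j) := by
  subst hj; exact (h i hi).2

theorem LineLayer.zero_of {p : ℤ} (hp : p = 0 ∨ p = 1) {s t : ℤ → Fin 4} (h : LineLayer p s t)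
    {i : ℤ} (h0 : s i = 0) (h1 : i % 2 = p → s (i + 1) = 0) (h2 : i % 2 ≠ p → s (i - 1) = 0) :
    t i = 0 := by
  by_cases hi : i % 2 = p
  · rw [h.at_left hi rfl, h0, h1 hi]; rfl
  · rw [h.at_right (i := i - 1) (by omega) (by omega), h2 hi, h0]; rfl

/-- Under one period, the right end `r` odd moves to `r + 2`. -/
theorem LineStep.right_end (h : LineStep U s s') {r : ℤ} (hr : r % 2 = 1) (h0 : s r ≠ 0)
    (h1 : s (r + 1) = 0) (h2 : s (r + 2) = 0) (h3 : s (r + 3) = 0) : s' (r + 2) ≠ 0 := by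
  obtain ⟨p, p', q, hp, hp', hq, hs⟩ := h
  have e1 : p' (r + 1) ≠ 0 := by
    rw [hp'.at_right hr rfl, hp.eq_zero h1]
    exact fun h => hp.ne_zero h0 (gateR_zero_right_eq_zero.mp h)
  have e2 : p' (r + 2) = 0 := by
    rw [hp'.at_left (j := r + 3) (by omega) (by ring), hp.eq_zero h2, hp.eq_zero h3]; rfl
  rw [hs.at_right (i := r + 1) (by omega) (by ring), hq.eq_zero e2]
  exact fun h => hq.ne_zero e1 (gateR_zero_right_eq_zero.mp h)

/-- Under one period, the left end `ℓ` even moves to `ℓ - 2`. -/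
theorem LineStep.left_end (h : LineStep U s s') {ℓ : ℤ} (hℓ : ℓ % 2 = 0) (h0 : s ℓ ≠ 0)
    (h1 : s (ℓ - 1) = 0) (h2 : s (ℓ - 2) = 0) (h3 : s (ℓ - 3) = 0) : s' (ℓ - 2) ≠ 0 := by
  obtain ⟨p, p', q, hp, hp', hq, hs⟩ := h
  have e1 : p' (ℓ - 1) ≠ 0 := by
    rw [hp'.at_left (j := ℓ) (by omega) (by ring), hp.eq_zero h1]
    exact fun h => hp.ne_zero h0 (gateL_zero_left_eq_zero.mp h)
  have e2 : p' (ℓ - 2) = 0 := by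
    rw [hp'.at_right (i := ℓ - 3) (by omega) (by ring), hp.eq_zero h2, hp.eq_zero h3]; rfl
  rw [hs.at_left (j := ℓ - 1) (by omega) (by ring), hq.eq_zero e2]
  exact fun h => hq.ne_zero e1 (gateL_zero_left_eq_zero.mp h)

/-- Light cone: each of the two layers eats at most one site from either end of an empty interval.
-/
theorem LineStep.zero_of (h : LineStep U s s') {a b : ℤ} (ha : a % 2 = 1) (hb : b % 2 = 0)
    (h0 : ∀ i, a < i → i < b → s i = 0) : ∀ i, a + 2 < i → i < b - 2 → s' i = 0 := by
  obtain ⟨p, p', q, hp, hp', hq, hs⟩ := h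
  have e1 : ∀ i, a + 1 < i → i < b - 1 → p' i = 0 := fun i hi hi' =>
    hp'.zero_of (.inr rfl) (hp.eq_zero (h0 i (by omega) (by omega)))
      (fun _ => hp.eq_zero (h0 _ (by omega) (by omega)))
      (fun _ => hp.eq_zero (h0 _ (by omega) (by omega)))
  exact fun i hi hi' =>
    hs.zero_of (.inl rfl) (hq.eq_zero (e1 i (by omega) (by omega)))
      (fun _ => hq.eq_zero (e1 _ (by omega) (by omega)))
      (fun _ => hq.eq_zero (e1 _ (by omega) (by omega)))

/-- The empty arc has at least five sites, so each end sees only empty sites ahead and the two ends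
do not meet behind the ring. A label meeting an empty site always sends something across. -/
theorem Spread.step {ℓ r : ℤ} (h : Spread n ℓ r s) (hst : LineStep U s s') (hn : n % 2 = 0)
    (hper : ∀ i, s (i + n) = s i) (hper' : ∀ i, s' (i + n) = s' i) (hlen : r - ℓ + 6 ≤ n) :
    Spread n (ℓ - 2) (r + 2) s' := by
  obtain ⟨h1, h2, h3, h4, h5⟩ := h
  refine ⟨by omega, by omega, ?_, ?_, ?_⟩
  · have := hst.left_end (ℓ := ℓ + n) (by omega) (by rwa [hper]) (h5 _ (by omega) (by omega))
      (h5 _ (by omega) (by omega)) (h5 _ (by omega) (by omega))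
    rwa [← hper', show ℓ - 2 + n = ℓ + n - 2 by ring]
  · exact hst.right_end h2 h4 (h5 _ (by omega) (by omega)) (h5 _ (by omega) (by omega))
      (h5 _ (by omega) (by omega))
  · have := hst.zero_of (a := r) (b := ℓ + n) h2 (by omega) h5
    exact fun i hi hi' => this i hi (by omega)

/-- A label that meets an empty site leaves something behind, unless it is X, which moves on
entirely and becomes Z. -/
theorem gate_right_cases {t : Fin 4} (ht : t ≠ 0) :
    gateL t 0 ≠ 0 ∨ (t = 1 ∧ gateR t 0 = 3) := by revert t; decide

theorem gate_left_cases {t : Fin 4} (ht : t ≠ 0) :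
    gateR 0 t ≠ 0 ∨ (t = 1 ∧ gateL 0 t = 3) := by revert t; decide

/-- After one period the right end is accompanied by a second occupied site, or it is a lone `Z`
on an undoped site, or it has just crossed a pair of doped sites. -/
theorem LineStep.right_cases (h : LineStep U s s') {r : ℤ} (hr : r % 2 = 1) (h0 : s r ≠ 0)
    (h1 : s (r + 1) = 0) (h2 : s (r + 2) = 0) (h3 : s (r + 3) = 0) :
    (∃ i, r - 2 < i ∧ i < r + 2 ∧ s' i ≠ 0) ∨ (s' (r + 2) = 3 ∧ U (r + 2)) ∨
      (¬ U (r + 1) ∧ ¬ U (r + 2)) := by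
  obtain ⟨p, p', q, hp, hp', hq, hs⟩ := h
  have l0 : p' r = gateL (p r) 0 := by rw [hp'.at_left hr rfl, hp.eq_zero h1]
  have l1 : p' (r + 1) = gateR (p r) 0 := by rw [hp'.at_right hr rfl, hp.eq_zero h1]
  have l2 : q (r + 2) = 0 := by
    apply hq.eq_zero
    rw [hp'.at_left (j := r + 3) (by omega) (by ring), hp.eq_zero h2, hp.eq_zero h3]; rfl
  have m1 : s' (r + 1) = gateL (q (r + 1)) 0 := by
    rw [hs.at_left (j := r + 2) (by omega) (by ring), l2]
  have m2 : s' (r + 2) = gateR (q (r + 1)) 0 := by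
    rw [hs.at_right (i := r + 1) (by omega) (by ring), l2]
  rcases gate_right_cases (hp.ne_zero h0) with hc | ⟨-, hc⟩
  · left
    have hqr : q r ≠ 0 := hq.ne_zero (by rwa [l0])
    by_contra hcon
    have hz : ∀ i, r - 2 < i → i < r + 2 → s' i = 0 := fun i hi hi' => by
      by_contra hne; exact hcon ⟨i, hi, hi', hne⟩
    have a1 := hs.at_left (i := r - 1) (j := r) (by omega) (by ring)
    have a2 := hs.at_right (i := r - 1) (j := r) (by omega) (by ring)
    rw [hz _ (by omega) (by omega)] at a1 a2
    exact hqr (gate_eq_zero a1.symm a2.symm).2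
  · rw [hc] at l1
    rcases gate_right_cases (hq.ne_zero (i := r + 1) (by rw [l1]; decide)) with hd | ⟨hd, hd'⟩
    · exact .inl ⟨r + 1, by omega, by omega, by rwa [m1]⟩
    · by_cases hU1 : U (r + 1)
      · have := (hq (r + 1)).2 hU1
        rw [hd, l1] at this
        exact absurd this (by decide)
      · by_cases hU2 : U (r + 2)
        · exact .inr (.inl ⟨by rw [m2, hd'], hU2⟩)
        · exact .inr (.inr ⟨hU1, hU2⟩)

/-- Mirror image of `LineStep.right_cases` under `i ↦ 1 - i`: the gate is symmetric under exchange
of its two sites, and this reflection keeps the parity of the bonds. -/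
theorem LineStep.left_cases (h : LineStep U s s') {ℓ : ℤ} (hℓ : ℓ % 2 = 0) (h0 : s ℓ ≠ 0)
    (h1 : s (ℓ - 1) = 0) (h2 : s (ℓ - 2) = 0) (h3 : s (ℓ - 3) = 0) :
    (∃ i, ℓ - 2 < i ∧ i < ℓ + 2 ∧ s' i ≠ 0) ∨ (s' (ℓ - 2) = 3 ∧ U (ℓ - 2)) ∨
      (¬ U (ℓ - 1) ∧ ¬ U (ℓ - 2)) := by
  obtain ⟨p, p', q, hp, hp', hq, hs⟩ := h
  have l0 : p' ℓ = gateR 0 (p ℓ) := by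
    rw [hp'.at_right (i := ℓ - 1) (by omega) (by ring), hp.eq_zero h1]
  have l1 : p' (ℓ - 1) = gateL 0 (p ℓ) := by
    rw [hp'.at_left (j := ℓ) (by omega) (by ring), hp.eq_zero h1]
  have l2 : q (ℓ - 2) = 0 := by
    apply hq.eq_zero
    rw [hp'.at_right (i := ℓ - 3) (by omega) (by ring), hp.eq_zero h2, hp.eq_zero h3]; rfl
  have m1 : s' (ℓ - 1) = gateR 0 (q (ℓ - 1)) := by
    rw [hs.at_right (i := ℓ - 2) (by omega) (by ring), l2]
  have m2 : s' (ℓ - 2) = gateL 0 (q (ℓ - 1)) := by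
    rw [hs.at_left (j := ℓ - 1) (by omega) (by ring), l2]
  rcases gate_left_cases (hp.ne_zero h0) with hc | ⟨-, hc⟩
  · left
    have hqr : q ℓ ≠ 0 := hq.ne_zero (by rwa [l0])
    by_contra hcon
    have hz : ∀ i, ℓ - 2 < i → i < ℓ + 2 → s' i = 0 := fun i hi hi' => by
      by_contra hne; exact hcon ⟨i, hi, hi', hne⟩
    have a1 := hs.at_left (i := ℓ) (j := ℓ + 1) (by omega) (by ring)
    have a2 := hs.at_right (i := ℓ) (j := ℓ + 1) (by omega) (by ring)
    rw [hz _ (by omega) (by omega)] at a1 a2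
    exact hqr (gate_eq_zero a1.symm a2.symm).1
  · rw [hc] at l1
    rcases gate_left_cases (hq.ne_zero (i := ℓ - 1) (by rw [l1]; decide)) with hd | ⟨hd, hd'⟩
    · exact .inl ⟨ℓ - 1, by omega, by omega, by rwa [m1]⟩
    · by_cases hU1 : U (ℓ - 1)
      · have := (hq (ℓ - 1)).2 hU1
        rw [hd, l1] at this
        exact absurd this (by decide)
      · by_cases hU2 : U (ℓ - 2)
        · exact .inr (.inl ⟨by rw [m2, hd'], hU2⟩)
        · exact .inr (.inr ⟨hU1, hU2⟩)

/-- A lone `Z` on an undoped right end emits two further labels. -/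
theorem LineStep.right_lone (h : LineStep U s s') {r : ℤ} (hr : r % 2 = 1) (h0 : s r = 3)
    (hU : U r) (h1 : s (r + 1) = 0) (h2 : s (r - 1) = 0) (h3 : s (r - 2) = 0) :
    s' (r - 1) ≠ 0 ∧ s' r ≠ 0 := by
  obtain ⟨p, p', q, hp, hp', hq, hs⟩ := h
  have l0 : q r = 3 := by
    rw [(hq r).2 hU, hp'.at_left hr rfl, hp.eq_zero h1, (hp r).2 hU, h0]; rfl
  have l1 : q (r - 1) = 0 := by
    apply hq.eq_zero
    rw [hp'.at_right (i := r - 2) (by omega) (by ring), hp.eq_zero h2, hp.eq_zero h3]; rfl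
  have m1 := hs.at_left (i := r - 1) (j := r) (by omega) (by ring)
  have m2 := hs.at_right (i := r - 1) (j := r) (by omega) (by ring)
  rw [l0, l1] at m1 m2
  rw [m1, m2]
  decide

theorem LineStep.left_lone (h : LineStep U s s') {ℓ : ℤ} (hℓ : ℓ % 2 = 0) (h0 : s ℓ = 3)
    (hU : U ℓ) (h1 : s (ℓ - 1) = 0) (h2 : s (ℓ + 1) = 0) (h3 : s (ℓ + 2) = 0) :
    s' ℓ ≠ 0 ∧ s' (ℓ + 1) ≠ 0 := by
  obtain ⟨p, p', q, hp, hp', hq, hs⟩ := h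
  have l0 : q ℓ = 3 := by
    rw [(hq ℓ).2 hU, hp'.at_right (i := ℓ - 1) (by omega) (by ring), hp.eq_zero h1, (hp ℓ).2 hU,
      h0]; rfl
  have l1 : q (ℓ + 1) = 0 := by
    apply hq.eq_zero
    rw [hp'.at_left (j := ℓ + 2) (by omega) (by ring), hp.eq_zero h2, hp.eq_zero h3]; rfl
  have m1 := hs.at_left (i := ℓ) (j := ℓ + 1) (by omega) (by ring)
  have m2 := hs.at_right (i := ℓ) (j := ℓ + 1) (by omega) (by ring)
  rw [l0, l1] at m1 m2
  rw [m1, m2]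
  decide

/-- At most three sites per period are occupied. -/
def Light (n : ℤ) (s : ℤ → Fin 4) : Prop :=
  ∀ i j k l, i < j → j < k → k < l → l < i + n → ¬ (s i ≠ 0 ∧ s j ≠ 0 ∧ s k ≠ 0 ∧ s l ≠ 0)

/-- A light spreading sequence with light successors has just crossed a doped pair. -/
theorem Spread.crossing {s₂ : ℤ → Fin 4} {ℓ r : ℤ} (h : Spread n ℓ r s) (h₁ : LineStep U s s')
    (h₂ : LineStep U s' s₂) (hn : n % 2 = 0) (hper : ∀ i, s (i + n) = s i)
    (hper' : ∀ i, s' (i + n) = s' i) (hper₂ : ∀ i, s₂ (i + n) = s₂ i)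
    (hlen : r - ℓ + 10 ≤ n) (hlen' : 3 ≤ r - ℓ) (hl' : Light n s') (hl₂ : Light n s₂) :
    (¬ U (r + 1) ∧ ¬ U (r + 2)) ∨ (¬ U (ℓ - 1) ∧ ¬ U (ℓ - 2)) := by
  have S1 := h.step h₁ hn hper hper' (by omega)
  have S2 := S1.step h₂ hn hper' hper₂ (by omega)
  obtain ⟨p1, p2, p3, p4, p5⟩ := h
  have hleft : ∀ i, r - n < i → i < ℓ → s i = 0 := fun i hi hi' => by
    rw [← hper]; exact p5 _ (by omega) (by omega)
  obtain ⟨o1, o2, o3, o4, o5⟩ := S1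
  have hleft' : ∀ i, r + 2 - n < i → i < ℓ - 2 → s' i = 0 := fun i hi hi' => by
    rw [← hper']; exact o5 _ (by omega) (by omega)
  obtain ⟨-, -, t3, t4, -⟩ := S2
  have R := h₁.right_cases p2 p4 (p5 _ (by omega) (by omega)) (p5 _ (by omega) (by omega))
    (p5 _ (by omega) (by omega))
  have L := h₁.left_cases p1 p3 (hleft _ (by omega) (by omega)) (hleft _ (by omega) (by omega))
    (hleft _ (by omega) (by omega))
  -- An end that crosses no doped pair has a companion now, or is a lone Z on an undoped site that
  -- emits two labels in the next period. Companions at both ends make four occupied sites (they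
  -- differ since `3 ≤ r - ℓ`), and so does one lone Z a period later.
  rcases R with ⟨i, hi, hi', hsi⟩ | R | R
  · rcases L with ⟨j, hj, hj', hsj⟩ | L | L
    · exact absurd ⟨o3, hsj, hsi, o4⟩
        (hl' (ℓ - 2) j i (r + 2) (by omega) (by omega) (by omega) (by omega))
    · by_cases hb : s' (ℓ - 2 + 1) = 0 ∧ s' (ℓ - 2 + 2) = 0
      · have := h₂.left_lone o1 L.1 L.2 (hleft' _ (by omega) (by omega)) hb.1 hb.2
        exact absurd ⟨t3, this.1, this.2, t4⟩
          (hl₂ _ _ _ _ (by omega) (by omega) (by omega) (by omega))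
      · rw [not_and_or] at hb
        rcases hb with hb | hb
        · exact absurd ⟨o3, hb, hsi, o4⟩
            (hl' _ _ _ _ (by omega) (by omega) (by omega) (by omega))
        · rcases lt_or_ge (ℓ - 2 + 2) i with hlt | hge
          · exact absurd ⟨o3, hb, hsi, o4⟩ (hl' _ _ _ _ (by omega) hlt (by omega) (by omega))
          · omega
    · exact .inr L
  · by_cases hb : s' (r + 2 - 1) = 0 ∧ s' (r + 2 - 2) = 0
    · have := h₂.right_lone o2 R.1 R.2 (o5 _ (by omega) (by omega)) hb.1 hb.2
      exact absurd ⟨t3, this.1, this.2, t4⟩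
        (hl₂ _ _ _ _ (by omega) (by omega) (by omega) (by omega))
    · obtain ⟨i, hi, hi', hsi⟩ : ∃ i, r - 1 < i ∧ i < r + 2 ∧ s' i ≠ 0 := by
        rw [not_and_or] at hb
        rcases hb with hb | hb
        · exact ⟨_, by omega, by omega, hb⟩
        · exact ⟨_, by omega, by omega, hb⟩
      rcases L with ⟨j, hj, hj', hsj⟩ | L | L
      · exact absurd ⟨o3, hsj, hsi, o4⟩
          (hl' (ℓ - 2) j i (r + 2) (by omega) (by omega) (by omega) (by omega))
      · by_cases hb : s' (ℓ - 2 + 1) = 0 ∧ s' (ℓ - 2 + 2) = 0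
        · have := h₂.left_lone o1 L.1 L.2 (hleft' _ (by omega) (by omega)) hb.1 hb.2
          exact absurd ⟨t3, this.1, this.2, t4⟩
            (hl₂ _ _ _ _ (by omega) (by omega) (by omega) (by omega))
        · rw [not_and_or] at hb
          rcases hb with hb | hb
          · exact absurd ⟨o3, hb, hsi, o4⟩
              (hl' _ _ _ _ (by omega) (by omega) (by omega) (by omega))
          · exact absurd ⟨o3, hb, hsi, o4⟩
              (hl' _ _ _ _ (by omega) (by omega) (by omega) (by omega))
      · exact .inr L
  · exact .inl R

/-- A spreading sequence does not stay light for five periods. -/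
theorem Spread.not_light (hU : LinePattern U) (hn : n % 2 = 0) {ℓ r : ℤ} {c : ℕ → ℤ → Fin 4}
    (h : Spread n ℓ r (c 0)) (hst : ∀ k < 5, LineStep U (c k) (c (k + 1)))
    (hper : ∀ k ≤ 5, ∀ i, c k (i + n) = c k i) (hl : ∀ k ≤ 5, Light n (c k)) (hℓr : ℓ < r)
    (hlen : r - ℓ + 24 ≤ n) : False := by
  have S1 := h.step (hst 0 (by norm_num)) hn (hper 0 (by norm_num)) (hper 1 (by norm_num))
    (by omega)
  have S2 := S1.step (hst 1 (by norm_num)) hn (hper 1 (by norm_num)) (hper 2 (by norm_num))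
    (by omega)
  have S3 := S2.step (hst 2 (by norm_num)) hn (hper 2 (by norm_num)) (hper 3 (by norm_num))
    (by omega)
  -- Crossings are counted from the second period on, because `ℓ < r` alone does not give the length
  -- that `Spread.crossing` requires.
  have c1 := S1.crossing (hst 1 (by norm_num)) (hst 2 (by norm_num)) hn (hper 1 (by norm_num))
    (hper 2 (by norm_num)) (hper 3 (by norm_num)) (by omega) (by omega) (hl 2 (by norm_num))
    (hl 3 (by norm_num))
  have c2 := S2.crossing (hst 2 (by norm_num)) (hst 3 (by norm_num)) hn (hper 2 (by norm_num))
    (hper 3 (by norm_num)) (hper 4 (by norm_num)) (by omega) (by omega) (hl 3 (by norm_num))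
    (hl 4 (by norm_num))
  have c3 := S3.crossing (hst 3 (by norm_num)) (hst 4 (by norm_num)) hn (hper 3 (by norm_num))
    (hper 4 (by norm_num)) (hper 5 (by norm_num)) (by omega) (by omega) (hl 4 (by norm_num))
    (hl 5 (by norm_num))
  have d3 (i j k : ℤ) (hj : j = i + 1) (hk : k = i + 2) : U i ∨ U j ∨ U k := by
    subst hj hk; exact (hU i).2
  have d2 (i j : ℤ) (hj : j = i + 1) : U i → ¬ U j := by subst hj; exact (hU i).1
  have r1 := d3 (r + 2 + 1) (r + 2 + 2) (r + 2 + 2 + 1) (by ring) (by ring)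
  have r2 := d3 (r + 2 + 2 + 1) (r + 2 + 2 + 2) (r + 2 + 2 + 2 + 1) (by ring) (by ring)
  have r3 := d3 (r + 2 + 2 + 2) (r + 2 + 2 + 2 + 1) (r + 2 + 2 + 2 + 2) (by ring) (by ring)
  have r4 := d2 (r + 2 + 2 + 1) (r + 2 + 2 + 2) (by ring)
  have l1 := d3 (ℓ - 2 - 2 - 1) (ℓ - 2 - 2) (ℓ - 2 - 1) (by ring) (by ring)
  have l2 := d3 (ℓ - 2 - 2 - 2 - 1) (ℓ - 2 - 2 - 2) (ℓ - 2 - 2 - 1) (by ring) (by ring)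
  have l3 := d3 (ℓ - 2 - 2 - 2 - 2) (ℓ - 2 - 2 - 2 - 1) (ℓ - 2 - 2 - 2) (by ring) (by ring)
  have l4 := d2 (ℓ - 2 - 2 - 2) (ℓ - 2 - 2 - 1) (by ring)
  clear S1 S2 S3 h hst hper hl d3 d2 hU
  -- Three crossings at two ends. Two consecutive crossings at one end give four doped sites in a
  -- row. If the ends alternate, the first and third crossing enclose two sites that must both be
  -- undoped, though they are neighbours.
  rcases c1 with c1 | c1 <;> rcases c2 with c2 | c2 <;> rcases c3 with c3 | c3
  · exact r1.elim c1.1 fun h => h.elim c1.2 c2.1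
  · exact r1.elim c1.1 fun h => h.elim c1.2 c2.1
  · exact r1.elim c1.1 fun h => h.elim c1.2 fun h => r3.elim (r4 h) fun h => h.elim c3.1 c3.2
  · exact l2.elim c3.1 fun h => h.elim c2.2 c2.1
  · exact r2.elim c2.1 fun h => h.elim c2.2 c3.1
  · exact l1.elim (fun h => l3.elim c3.2 fun h' => h'.elim c3.1 fun h'' => l4 h'' h)
      fun h => h.elim c1.2 c1.1
  · exact l1.elim c2.1 fun h => h.elim c1.2 c1.1
  · exact l1.elim c2.1 fun h => h.elim c1.2 c1.1

end Line

/-! ### Compact label sequences -/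

/-- The support of the label sequence lies in `[a, a + 2]` modulo `n`, both ends are occupied, and
the two right labels are as left behind by a gate whose right input was trivial. -/
def Compact (n a : ℤ) (s : ℤ → Fin 4) : Prop :=
  a % 2 = 1 ∧ s a ≠ 0 ∧ s (a + 2) ≠ 0 ∧ (∀ i, a + 2 < i → i < a + n → s i = 0) ∧
    ((s (a + 1) = 0 ∧ s (a + 2) = 3) ∨ (s (a + 1) = 3 ∧ (s (a + 2) = 1 ∨ s (a + 2) = 2)))

/-- A necessary condition on a compact sequence to have a compact successor. -/
def Passing (U : ℤ → Prop) (a : ℤ) (s : ℤ → Fin 4) : Prop :=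
  (U (a + 1) → s (a + 1) = 0 ∧ s (a + 2) = 3) ∧ (U (a + 2) → s (a + 1) = 3 ∧ s (a + 2) = 1) ∧
    (¬ U (a + 1) → ¬ U (a + 2) → s (a + 1) = 3 ∨ s a = 1)

/-- The labels of the right-moving soliton with left end `a`. -/
def MainLabels (U : ℤ → Prop) (a : ℤ) (s : ℤ → Fin 4) : Prop :=
  (U (a + 1) → (s a = 1 ∨ s a = 2) ∧ s (a + 1) = 0 ∧ s (a + 2) = 3) ∧
  (¬ U (a + 1) → ¬ U a → s a = 2 ∧ s (a + 1) = 3 ∧ s (a + 2) = 1) ∧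
  (U a → U (a + 2) → s a = 3 ∧ s (a + 1) = 3 ∧ s (a + 2) = 1) ∧
  (U a → ¬ U (a + 2) → s a = 3 ∧ s (a + 1) = 3 ∧ (s (a + 2) = 1 ∨ s (a + 2) = 2))

theorem gate_zero_right_cases {t : Fin 4} (ht : t ≠ 0) :
    (t = 1 ∧ gateL t 0 = 0 ∧ gateR t 0 = 3) ∨ (t = 2 ∧ gateL t 0 = 3 ∧ gateR t 0 = 1) ∨
      (t = 3 ∧ gateL t 0 = 3 ∧ gateR t 0 = 2) := by
  revert t; decide

theorem gateL_eq_zero_cases {s t : Fin 4} (h : gateL s t = 0) (h' : gateR s t ≠ 0) :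
    (s = 1 ∧ t = 0 ∧ gateR s t = 3) ∨ (s = 2 ∧ t = 1 ∧ gateR s t = 1) ∨
      (s = 3 ∧ t = 1 ∧ gateR s t = 2) := by
  revert s t; decide

section Line

variable {U : ℤ → Prop} {s s' : ℤ → Fin 4} {n a : ℤ}

/-- The intermediate labels in one period of a compact sequence. -/
theorem Compact.intermediate (h : Compact n a s) (hst : LineStep U s s') (hn : n % 2 = 0)
    (hn' : 10 ≤ n) (hper : ∀ i, s (i + n) = s i) (hper' : ∀ i, s' (i + n) = s' i) :
    ∃ p p' q, LineClass U p s ∧ LineClass U q p' ∧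
      p' a = gateL (p a) (p (a + 1)) ∧ p' (a + 1) = gateR (p a) (p (a + 1)) ∧
      p' (a + 2) = gateL (p (a + 2)) 0 ∧ p' (a + 3) = gateR (p (a + 2)) 0 ∧
      s' (a - 1) = gateL 0 (q a) ∧ s' a = gateR 0 (q a) ∧
      s' (a + 1) = gateL (q (a + 1)) (q (a + 2)) ∧ s' (a + 2) = gateR (q (a + 1)) (q (a + 2)) ∧
      s' (a + 3) = gateL (q (a + 3)) 0 ∧ s' (a + 4) = gateR (q (a + 3)) 0 ∧
      (∀ i, a + 4 < i → i < a - 1 + n → s' i = 0) := by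
  obtain ⟨ha, h0, h2, hz, -⟩ := h
  obtain ⟨p, p', q, hp, hp', hq, hs⟩ := hst
  have e0 : p (a - 1) = 0 := hp.eq_zero (by rw [← hper]; exact hz _ (by omega) (by omega))
  have e0' : p (a - 2) = 0 := hp.eq_zero (by rw [← hper]; exact hz _ (by omega) (by omega))
  have e1 : ∀ i, a + 3 < i → i < a + n → p' i = 0 := fun i hi hi' =>
    hp'.zero_of (.inr rfl) (hp.eq_zero (hz i (by omega) (by omega)))
      (fun _ => hp.eq_zero (hz _ (by omega) (by omega)))
      (fun _ => hp.eq_zero (hz _ (by omega) (by omega)))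
  have e2 : q (a - 1) = 0 := by
    apply hq.eq_zero
    rw [hp'.at_right (i := a - 2) (by omega) (by ring), e0, e0']; rfl
  have e3 : q (a + 4) = 0 := hq.eq_zero (e1 _ (by omega) (by omega))
  have e4 : p (a + 3) = 0 := hp.eq_zero (hz _ (by omega) (by omega))
  refine ⟨p, p', q, hp, hq, hp'.at_left ha rfl, hp'.at_right ha rfl, ?_, ?_, ?_, ?_,
    hs.at_left (by omega) (by ring), hs.at_right (by omega) (by ring), ?_, ?_, ?_⟩
  · rw [hp'.at_left (j := a + 3) (by omega) (by ring), e4]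
  · rw [hp'.at_right (i := a + 2) (by omega) (by ring), e4]
  · rw [hs.at_left (j := a) (by omega) (by ring), e2]
  · rw [hs.at_right (i := a - 1) (by omega) (by ring), e2]
  · rw [hs.at_left (j := a + 4) (by omega) (by ring), e3]
  · rw [hs.at_right (i := a + 3) (by omega) (by ring), e3]
  · exact fun i hi hi' => hs.zero_of (.inl rfl) (hq.eq_zero (e1 i (by omega) (by omega)))
      (fun _ => hq.eq_zero (e1 _ (by omega) (by omega)))
      (fun _ => hq.eq_zero (e1 _ (by omega) (by omega)))

/-- A successor of a compact sequence is compact or spreading. -/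
theorem Compact.step (h : Compact n a s) (hst : LineStep U s s') (hn : n % 2 = 0)
    (hn' : 10 ≤ n) (hper : ∀ i, s (i + n) = s i) (hper' : ∀ i, s' (i + n) = s' i) :
    Compact n (a + 2) s' ∨ Spread n (a - 1) (a + 4) s' ∨ Spread n (a + 1) (a + 4) s' := by
  obtain ⟨p, p', q, hp, hq, A0, A1, A2, A3, B0, B0', B1, B2, B3, B4, hfar⟩ :=
    h.intermediate hst hn hn' hper hper'
  obtain ⟨ha, h0, h2, hz, -⟩ := h
  have hp0 := hp.ne_zero h0
  have hp2 := hp.ne_zero h2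
  have hq3 : q (a + 3) ≠ 0 :=
    hq.ne_zero (by rw [A3]; exact fun h => hp2 (gateR_zero_right_eq_zero.mp h))
  have hr := gate_zero_right_cases hq3
  rw [← B3, ← B4] at hr
  have hs4 : s' (a + 4) ≠ 0 := by
    rw [B4]; exact fun h => hq3 (gateR_zero_right_eq_zero.mp h)
  -- What is left at `a` after the odd bonds is carried to `a - 1` by the even bond and becomes a
  -- left-moving end. Otherwise the bond `(a + 1, a + 2)` decides: it either leaves a left end at `a
  -- + 1` or passes everything on to `a + 2`.
  by_cases hq0 : q a = 0
  · rw [hq0] at B0 B0'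
    have hz1 : s' (a - 1) = 0 := B0
    have hz0 : s' a = 0 := B0'
    have hp'1 : p' (a + 1) ≠ 0 := fun h => hp0 (gate_eq_zero (s := p a) (t := p (a + 1))
      (by rw [← A0]; exact (hq a).1.mp hq0) (by rw [← A1, h])).1
    by_cases hs1 : s' (a + 1) = 0
    · left
      have hs2 : s' (a + 2) ≠ 0 := fun h => hq.ne_zero hp'1 (gate_eq_zero
        (s := q (a + 1)) (t := q (a + 2)) (by rw [← B1, hs1]) (by rw [← B2, h])).1
      refine ⟨by omega, hs2, by rwa [show a + 2 + 2 = a + 4 by ring], fun i hi hi' => ?_, ?_⟩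
      · rcases lt_or_ge i (a - 1 + n) with hlt | hge
        · exact hfar i (by omega) hlt
        · have : i - n = a - 1 ∨ i - n = a ∨ i - n = a + 1 := by omega
          rw [show i = i - n + n by ring, hper']
          rcases this with h | h | h <;> rw [h] <;> assumption
      · rw [show a + 2 + 2 = a + 4 by ring, show a + 2 + 1 = a + 3 by ring]
        rcases hr with ⟨-, h3, h4⟩ | ⟨-, h3, h4⟩ | ⟨-, h3, h4⟩
        · exact .inl ⟨h3, h4⟩
        · exact .inr ⟨h3, .inl h4⟩
        · exact .inr ⟨h3, .inr h4⟩
    · right; right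
      refine ⟨by omega, by omega, hs1, hs4, fun i hi hi' => ?_⟩
      rcases lt_or_ge i (a - 1 + n) with hlt | hge
      · exact hfar i (by omega) hlt
      · have : i - n = a - 1 ∨ i - n = a := by omega
        rw [show i = i - n + n by ring, hper']
        rcases this with h | h <;> rw [h] <;> assumption
  · right; left
    refine ⟨by omega, by omega, ?_, hs4, fun i hi hi' => hfar i hi hi'⟩
    rw [B0]; exact fun h => hq0 (gateL_zero_left_eq_zero.mp h)

/-- If a compact sequence has a compact successor, the rear of the sequence has moved on. -/
theorem Compact.rear (h : Compact n a s) (hst : LineStep U s s') (hn : n % 2 = 0)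
    (hn' : 10 ≤ n) (hper : ∀ i, s (i + n) = s i) (hper' : ∀ i, s' (i + n) = s' i)
    (hc : Compact n (a + 2) s') :
    ∃ p p' q, LineClass U p s ∧ LineClass U q p' ∧
      ((p a = 1 ∧ p (a + 1) = 0 ∧ p' (a + 1) = 3) ∨ (p a = 2 ∧ p (a + 1) = 1 ∧ p' (a + 1) = 1) ∨
        (p a = 3 ∧ p (a + 1) = 1 ∧ p' (a + 1) = 2)) ∧
      ((q (a + 1) = 1 ∧ q (a + 2) = 0 ∧ s' (a + 2) = 3) ∨
        (q (a + 1) = 2 ∧ q (a + 2) = 1 ∧ s' (a + 2) = 1) ∨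
        (q (a + 1) = 3 ∧ q (a + 2) = 1 ∧ s' (a + 2) = 2)) ∧
      ((p (a + 2) = 1 ∧ p' (a + 2) = 0 ∧ p' (a + 3) = 3) ∨
        (p (a + 2) = 2 ∧ p' (a + 2) = 3 ∧ p' (a + 3) = 1) ∨
        (p (a + 2) = 3 ∧ p' (a + 2) = 3 ∧ p' (a + 3) = 2)) ∧
      ((q (a + 3) = 1 ∧ s' (a + 3) = 0 ∧ s' (a + 4) = 3) ∨
        (q (a + 3) = 2 ∧ s' (a + 3) = 3 ∧ s' (a + 4) = 1) ∨
        (q (a + 3) = 3 ∧ s' (a + 3) = 3 ∧ s' (a + 4) = 2)) := by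
  obtain ⟨p, p', q, hp, hq, A0, A1, A2, A3, B0, B0', B1, B2, B3, B4, hfar⟩ :=
    h.intermediate hst hn hn' hper hper'
  obtain ⟨ha, h0, h2, hz, -⟩ := h
  obtain ⟨-, c0, c2, cz, -⟩ := hc
  have hp0 := hp.ne_zero h0
  have hp2 := hp.ne_zero h2
  have hq3 : q (a + 3) ≠ 0 :=
    hq.ne_zero (by rw [A3]; exact fun h => hp2 (gateR_zero_right_eq_zero.mp h))
  have z : ∀ i, a - 2 < i → i < a + 2 → s' i = 0 := fun i hi hi' => by
    rw [← hper']; exact cz _ (by omega) (by omega)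
  have hq0 : q a = 0 := gateL_zero_left_eq_zero.mp (by rw [← B0]; exact z _ (by omega) (by omega))
  have hp'0 : p' a = 0 := (hq a).1.mp hq0
  have hp'1 : p' (a + 1) ≠ 0 := fun h => hp0 (gate_eq_zero (s := p a) (t := p (a + 1))
    (by rw [← A0]; exact hp'0) (by rw [← A1, h])).1
  refine ⟨p, p', q, hp, hq, ?_, ?_, ?_, ?_⟩
  · have := gateL_eq_zero_cases (by rw [← A0]; exact hp'0) (by rw [← A1]; exact hp'1)
    rwa [← A1] at this
  · have := gateL_eq_zero_cases (by rw [← B1]; exact z _ (by omega) (by omega))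
      (by rw [← B2]; exact c0)
    rwa [← B2] at this
  · have := gate_zero_right_cases hp2
    rwa [← A2, ← A3] at this
  · have := gate_zero_right_cases hq3
    rwa [← B3, ← B4] at this

/-- `Compact.rear` lists the label triples that a compact successor allows. At an undoped site the
rotated label is the given one, so there the list restricts the string itself. -/
theorem Compact.passing (hU : LinePattern U) (h : Compact n a s) (hst : LineStep U s s')
    (hn : n % 2 = 0) (hn' : 10 ≤ n) (hper : ∀ i, s (i + n) = s i)
    (hper' : ∀ i, s' (i + n) = s' i) (hc : Compact n (a + 2) s') : Passing U a s := by
  obtain ⟨p, p', q, hp, hq, C1, C2, C3, C4⟩ := h.rear hst hn hn' hper hper' hc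
  obtain ⟨-, -, -, -, hm⟩ := h
  have h1 : U (a + 1) → s (a + 1) = 0 ∧ s (a + 2) = 3 := fun hu => by
    have e := (hp (a + 1)).2 hu
    rw [e] at C1
    have : s (a + 1) ≠ 3 := by
      intro h3; rw [h3] at C1; revert C1; simp
    simpa [this] using hm
  have h2 : U (a + 2) → s (a + 1) = 3 ∧ s (a + 2) = 1 := fun hu => by
    have e := (hp (a + 2)).2 hu
    have e' := (hq (a + 2)).2 hu
    rw [e] at C3
    rw [e'] at C2
    have h21 : s (a + 2) = 1 := by
      rcases C3 with ⟨h, -, -⟩ | ⟨-, h, -⟩ | ⟨-, h, -⟩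
      · exact h
      all_goals rw [h] at C2; revert C2; simp
    simpa [h21] using hm
  refine ⟨h1, h2, fun hu1 hu2 => ?_⟩
  rcases hm with ⟨hm, -⟩ | ⟨hm, -⟩
  · right
    have hua : U a := (hU a).2.resolve_right (not_or.mpr ⟨hu1, hu2⟩)
    rw [← (hp a).2 hua]
    rcases C1 with ⟨h, -, -⟩ | ⟨-, h, -⟩ | ⟨-, h, -⟩
    · exact h
    all_goals exact absurd ((hp (a + 1)).1.mpr hm) (by rw [h]; decide)
  · exact .inl hm

/-- The front and middle labels are fixed by `Passing`, the rear label by what the undoped sites of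
the old string transmit unchanged. Hence a compact successor that can go on once more is already on
the soliton. -/
theorem MainLabels.next (hU : LinePattern U) (h : Compact n a s) (hm : MainLabels U a s)
    (hst : LineStep U s s') (hn : n % 2 = 0) (hn' : 10 ≤ n) (hper : ∀ i, s (i + n) = s i)
    (hper' : ∀ i, s' (i + n) = s' i) (hc : Compact n (a + 2) s') (hp' : Passing U (a + 2) s') :
    MainLabels U (a + 2) s' := by
  obtain ⟨p, p', q, hp, hq, C1, C2, C3, C4⟩ := h.rear hst hn hn' hper hper' hc
  obtain ⟨c1, c2, c3⟩ := hp'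
  have e1 : a + 2 + 1 = a + 3 := by ring
  have e2 : a + 2 + 2 = a + 4 := by ring
  have hU1 := hU (a + 1)
  have hU2 := hU (a + 2)
  rw [show a + 1 + 1 = a + 2 by ring, show a + 1 + 2 = a + 3 by ring] at hU1
  rw [e1, e2] at hU2
  simp only [MainLabels, e1, e2] at hm c1 c2 c3 ⊢
  have left2 : U (a + 2) → s' (a + 2) = 3 := fun hu => by
    have hs : s (a + 2) = 1 := by
      by_cases hua : U a
      · exact (hm.2.2.1 hua hu).2.2
      · exact (hm.2.1 (fun h => hU1.1 h hu) hua).2.2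
    have e := (hp (a + 2)).2 hu
    have e' := (hq (a + 2)).2 hu
    rw [e, hs] at C3
    have : q (a + 2) = 0 := by rw [e']; revert C3; simp +contextual
    rw [this] at C2
    revert C2; simp
  refine ⟨fun hu => ⟨?_, c1 hu⟩, fun hu hu2 => ⟨?_, c2 ?_⟩, fun hu hu4 => ⟨left2 hu, c2 hu4⟩,
    fun hu hu4 => ?_⟩
  · rcases C2 with ⟨-, h, -⟩ | ⟨-, -, h⟩ | ⟨-, -, h⟩
    · have e := (hq (a + 3)).2 hu
      have h' := (hq (a + 2)).1.mp h
      rw [h'] at C3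
      have h3 : p' (a + 3) = 3 := by revert C3; simp +contextual
      rw [e, h3, (c1 hu).1] at C4
      revert C4; simp
    · exact .inl h
    · exact .inr h
  · have hu1 : U (a + 1) := hU1.2.resolve_right (not_or.mpr ⟨hu2, hu⟩)
    have h0 := (hp (a + 1)).1.mpr (hm.1 hu1).2.1
    rw [h0] at C1
    have h3 : p' (a + 1) = 3 := by revert C1; simp
    rw [(hq (a + 1)).2 hu1, h3] at C2
    revert C2; simp
  · exact (hU2.2.resolve_left hu2).resolve_left hu
  · refine ⟨left2 hu, ?_⟩
    have h3 : s' (a + 3) = 3 := (c3 (hU2.1 hu) hu4).resolve_right (by rw [left2 hu]; decide)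
    refine ⟨h3, ?_⟩
    rw [h3] at C4
    rcases C4 with ⟨-, h, -⟩ | ⟨-, -, h⟩ | ⟨-, -, h⟩
    · exact absurd h (by decide)
    · exact .inl h
    · exact .inr h

end Line

/-! ### Label sequences of strings on the ring -/

section Lift

variable {N : ℕ} [NeZero N]

/-- The periodic label sequence of a Pauli string on the ring. -/
def lift (S : PauliString N) : ℤ → Fin 4 := fun i => S (i : ZMod N)

/-- The undoped positions on the line. -/
def Undoped (D : Finset (ZMod N)) (i : ℤ) : Prop := (i : ZMod N) ∉ D

theorem lift_add_period (S : PauliString N) (i : ℤ) : lift S (i + N) = lift S i := by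
  simp [lift]

theorem val_intCast_mod_two (hN : Even N) (i : ℤ) : (((i : ZMod N).val % 2 : ℕ) : ℤ) = i % 2 := by
  have h2 : (2 : ℤ) ∣ N := by exact_mod_cast hN.two_dvd
  rw [Int.natCast_mod, ZMod.val_intCast]
  exact Int.emod_emod_of_dvd _ h2

theorem lineLayer_lift (hN : Even N) {p : ℕ} (S : PauliString N) :
    LineLayer p (lift S) (lift (layerMap p S)) := by
  intro i hi
  have h := val_intCast_mod_two hN i
  have hp : (i : ZMod N).val % 2 = p := by omega
  simp only [lift, Int.cast_add, Int.cast_one]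
  exact ⟨layerMap_left S hp, layerMap_right hN S hp⟩

theorem SameClass.lineClass {D : Finset (ZMod N)} {S T : PauliString N} (h : SameClass D S T) :
    LineClass (Undoped D) (lift S) (lift T) := fun i => h i

/-- Induction round the ring from an undoped site; the invariant is that one of three consecutive
sites is undoped. -/
theorem StaggeredLike.linePattern {D : Finset (ZMod N)} (hD : StaggeredLike D) :
    LinePattern (Undoped D) := by
  obtain ⟨⟨i₀, hi₀⟩, h⟩ := hD
  have key (k : ℕ) : i₀ + k ∉ D ∨ i₀ + k + 1 ∉ D ∨ i₀ + k + 2 ∉ D := by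
    induction k with
    | zero => left; simpa using hi₀
    | succ k ih =>
      have e1 : i₀ + ((k + 1 : ℕ) : ZMod N) = i₀ + k + 1 := by push_cast; ring
      rw [e1, show i₀ + (k : ZMod N) + 1 + 1 = i₀ + k + 2 by ring,
        show i₀ + (k : ZMod N) + 1 + 2 = i₀ + k + 3 by ring]
      rcases ih with ih | ih | ih
      · rcases (h _ ih).2 with h' | h'
        · exact .inr (.inl h')
        · exact .inr (.inr h'.2)
      · exact .inl ih
      · exact .inr (.inl ih)
  intro i
  constructor
  · intro hi
    simpa [Undoped] using (h _ hi).1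
  · have := key ((i : ZMod N) - i₀).val
    rw [ZMod.natCast_zmod_val, add_sub_cancel] at this
    simpa [Undoped] using this

theorem light_lift {S : PauliString N} (hS : weight S ≤ 3) : Light N (lift S) := by
  rintro i j k l hij hjk hkl hli ⟨hi, hj, hk, hl⟩
  have inj {x y : ℤ} (hx : x < y) (hy : y < x + N) : (x : ZMod N) ≠ y := by
    intro h
    rw [ZMod.intCast_eq_intCast_iff_dvd_sub] at h
    obtain ⟨c, hc⟩ := h
    have : 0 < c := by
      by_contra hneg
      nlinarith
    nlinarith
  have hsub : ({(i : ZMod N), (j : ZMod N), (k : ZMod N), (l : ZMod N)} : Finset (ZMod N)) ⊆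
      Finset.univ.filter fun j => S j ≠ 0 := by
    intro x hx
    simp only [Finset.mem_insert, Finset.mem_singleton] at hx
    simp only [Finset.mem_filter, Finset.mem_univ, true_and]
    rcases hx with rfl | rfl | rfl | rfl <;> assumption
  have hcard : ({(i : ZMod N), (j : ZMod N), (k : ZMod N), (l : ZMod N)} :
      Finset (ZMod N)).card = 4 := by
    rw [Finset.card_insert_of_notMem, Finset.card_insert_of_notMem, Finset.card_pair]
    · exact inj hkl (by omega)
    · simp only [Finset.mem_insert, Finset.mem_singleton, not_or]
      exact ⟨inj hjk (by omega), inj (by omega) (by omega)⟩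
    · simp only [Finset.mem_insert, Finset.mem_singleton, not_or]
      exact ⟨inj hij (by omega), inj (by omega) (by omega), inj (by omega) (by omega)⟩
  have := Finset.card_le_card hsub
  rw [hcard] at this
  exact absurd (this.trans hS) (by norm_num)

/-! ### The core of the Floquet period -/

theorem layerMatrix_mulVec (hN : Even N) {p : ℕ} (hp : p < 2) (c : PauliString N → ℂ)
    (T : PauliString N) : (layerMatrix N p).mulVec c (layerMap p T) = layerSign p T * c T := by
  rw [Matrix.mulVec, dotProduct, Finset.sum_eq_single T]
  · simp [layerMatrix]
  · intro S _ hS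
    have : layerMap p T ≠ layerMap p S := fun h => hS (layerMap_injective hN hp h).symm
    simp [layerMatrix, this]
  · simp

/-- The undamped Floquet period, cut before the second layer of rotations. -/
def coreMatrix (D : Finset (ZMod N)) (V : Fin 2 → ZMod N → Gate) :
    Matrix (PauliString N) (PauliString N) ℂ :=
  layerMatrix N 0 * rotMatrix D (V 0) * layerMatrix N 1 * rotMatrix D (V 1)

/-- The matrix element is a sum over paths of strings; a path with nonzero contribution supplies the
intermediate label sequences. -/
theorem lineStep_of_coreMatrix_ne_zero (hN : Even N) {D : Finset (ZMod N)}
    {V : Fin 2 → ZMod N → Gate} {S' S : PauliString N} (h : coreMatrix D V S' S ≠ 0) :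
    LineStep (Undoped D) (lift S) (lift S') := by
  rw [coreMatrix, Matrix.mul_apply] at h
  obtain ⟨P, -, hP⟩ := Finset.exists_ne_zero_of_sum_ne_zero h
  have hP1 := right_ne_zero_of_mul hP
  have hP2 := left_ne_zero_of_mul hP
  rw [Matrix.mul_apply] at hP2
  obtain ⟨P', -, hP'⟩ := Finset.exists_ne_zero_of_sum_ne_zero hP2
  have hP3 := right_ne_zero_of_mul hP'
  have hP4 := left_ne_zero_of_mul hP'
  rw [Matrix.mul_apply] at hP4
  obtain ⟨Q, -, hQ⟩ := Finset.exists_ne_zero_of_sum_ne_zero hP4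
  have hQ1 := right_ne_zero_of_mul hQ
  have hQ2 := left_ne_zero_of_mul hQ
  have e1 : P' = layerMap 1 P := by
    by_contra hne; exact hP3 (by simp [layerMatrix, hne])
  have e2 : S' = layerMap 0 Q := by
    by_contra hne; exact hQ2 (by simp [layerMatrix, hne])
  subst e1 e2
  exact ⟨lift P, lift (layerMap 1 P), lift Q, (sameClass_of_rotMatrix_ne_zero hP1).lineClass,
    lineLayer_lift hN P, (sameClass_of_rotMatrix_ne_zero hQ1).lineClass, lineLayer_lift hN Q⟩

/-- The amplitude of half a period of damping followed by truncation to weight at most `w`. -/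
def damping (w : ℕ) (γ : ℝ) (m : ℕ) : ℂ :=
  if m ≤ w then ((Real.exp (-(γ / 2) * (m : ℝ)) : ℝ) : ℂ) else 0

/-- The truncated Floquet period, cut before the second layer of rotations. -/
def cutMatrix (w : ℕ) (γ : ℝ) (D : Finset (ZMod N)) (V : Fin 2 → ZMod N → Gate) :
    Matrix (PauliString N) (PauliString N) ℂ :=
  Matrix.diagonal (fun S => damping w γ (weight S)) * coreMatrix D V *
    Matrix.diagonal fun S => damping w γ (weight S)

theorem hasPauliMatrix_truncatedChannel (hN : Even N) (w : ℕ) (γ : ℝ) (D : Finset (ZMod N))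
    (V : Fin 2 → ZMod N → Gate) :
    HasPauliMatrix (truncatedChannel w γ D V)
      (Matrix.diagonal (fun S => damping w γ (weight S)) * floquetMatrix D V *
        Matrix.diagonal fun S => damping w γ (weight S)) := by
  have hM : Matrix.diagonal (fun S => damping w γ (weight S)) * floquetMatrix D V *
      Matrix.diagonal (fun S => damping w γ (weight S)) =
      Matrix.diagonal (fun S : PauliString N => if weight S ≤ w then 1 else 0) *
        (Matrix.diagonal (fun S => ((Real.exp (-(γ / 2) * (weight S : ℝ)) : ℝ) : ℂ)) *
          (floquetMatrix D V *
            Matrix.diagonal fun S => ((Real.exp (-(γ / 2) * (weight S : ℝ)) : ℝ) : ℂ)) *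
          Matrix.diagonal (fun S : PauliString N => if weight S ≤ w then 1 else 0)) := by
    ext S T
    simp only [Matrix.diagonal_mul, Matrix.mul_diagonal, damping]
    split_ifs <;> simp <;> ring
  rw [hM]
  exact (hasPauliMatrix_pauliDiag _).comp (((hasPauliMatrix_pauliDiag _).comp
    ((hasPauliMatrix_floquetUnitary hN D V).comp (hasPauliMatrix_pauliDiag _))).comp
    (hasPauliMatrix_pauliDiag _))

/-- The last rotation `R` can be moved to the other end of the period, as in passing from `A R` to
`R A`: if `c` is an eigenvector of the cut propagator, then `R c` is one of the channel, and it is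
nonzero because `μ ≠ 0`. -/
theorem hasEigenvalue_truncatedChannel (hN : Even N) {w : ℕ} {γ : ℝ} {D : Finset (ZMod N)}
    {V : Fin 2 → ZMod N → Gate} {μ : ℂ} (hμ : μ ≠ 0) {c : PauliString N → ℂ} (hc : c ≠ 0)
    (h : (cutMatrix w γ D V).mulVec c = μ • c) :
    Module.End.HasEigenvalue (truncatedChannel w γ D V) μ := by
  set d : Matrix (PauliString N) (PauliString N) ℂ :=
    Matrix.diagonal fun S => damping w γ (weight S) with hd
  have comm : d * rotMatrix D (V 1) = rotMatrix D (V 1) * d :=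
    diagonal_mul_rotMatrix D (V 1) (damping w γ)
  have e1 : cutMatrix w γ D V =
      d * (layerMatrix N 0 * rotMatrix D (V 0) * layerMatrix N 1) * d * rotMatrix D (V 1) := by
    rw [cutMatrix, coreMatrix, ← hd, Matrix.mul_assoc _ _ d, Matrix.mul_assoc _ (rotMatrix D (V 1)) d, ← comm]
    simp only [Matrix.mul_assoc]
  have e2 : d * floquetMatrix D V * d * rotMatrix D (V 1) =
      rotMatrix D (V 1) * cutMatrix w γ D V := by
    rw [e1, floquetMatrix]
    simp only [← Matrix.mul_assoc]
    rw [comm]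
  refine (hasPauliMatrix_truncatedChannel hN w γ D V).hasEigenvalue
    (c := (rotMatrix D (V 1)).mulVec c) ?_ ?_
  · intro h0
    rw [e1, ← Matrix.mulVec_mulVec, h0, Matrix.mulVec_zero] at h
    exact smul_ne_zero hμ hc h.symm
  · rw [Matrix.mulVec_mulVec, e2, ← Matrix.mulVec_mulVec, h, Matrix.mulVec_smul]

end Lift

/-! ### Strings supported in a window -/

/-- The label sequence with the given first labels and `0` afterwards. -/
def labels (l : List (Fin 4)) : ℕ → Fin 4 := fun k => l.getD k 0

section Window

variable {N : ℕ} [NeZero N]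

/-- The Pauli string with labels `f 0, f 1, …` at the sites `b, b + 1, …`. -/
def window (b : ZMod N) (f : ℕ → Fin 4) : PauliString N := fun j => f (j - b).val

theorem window_apply (b : ZMod N) (f : ℕ → Fin 4) {k : ℕ} (hk : k < N) :
    window b f (b + k) = f k := by
  rw [window, add_sub_cancel_left, ZMod.val_natCast_of_lt hk]

theorem exists_eq_add (b j : ZMod N) : ∃ k < N, j = b + (k : ℕ) :=
  ⟨(j - b).val, ZMod.val_lt _, by simp⟩

theorem string_ext (b : ZMod N) {S T : PauliString N}
    (h : ∀ k < N, S (b + (k : ℕ)) = T (b + (k : ℕ))) : S = T := by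
  funext j
  obtain ⟨k, hk, rfl⟩ := exists_eq_add b j
  exact h k hk

theorem window_congr (b : ZMod N) {f g : ℕ → Fin 4} (h : ∀ k < N, f k = g k) :
    window b f = window b g :=
  string_ext b fun k hk => by rw [window_apply b f hk, window_apply b g hk, h k hk]

theorem val_add_natCast_mod_two (hN : Even N) (b : ZMod N) (k : ℕ) :
    (b + (k : ℕ)).val % 2 = (b.val + k) % 2 := by
  induction k with
  | zero => simp
  | succ k ih =>
    rw [Nat.cast_succ, ← add_assoc, val_add_one_mod_two hN]
    omega

theorem layerMap_window_of_eq (hN : Even N) {p : ℕ} {b : ZMod N} (hb : b.val % 2 = p)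
    (f : ℕ → Fin 4) : layerMap p (window b f) =
      window b fun k => if k % 2 = 0 then gateL (f k) (f (k + 1)) else gateR (f (k - 1)) (f k) := by
  refine string_ext b fun k hk => ?_
  have hv := val_add_natCast_mod_two hN b k
  obtain ⟨m, hm⟩ := hN.two_dvd
  rw [window_apply b _ hk]
  by_cases hk2 : k % 2 = 0
  · rw [layerMap_left _ (by omega), if_pos hk2, window_apply b _ hk, add_assoc, ← Nat.cast_succ,
      window_apply b _ (by omega)]
  · obtain ⟨l, rfl⟩ : ∃ l, k = l + 1 := ⟨k - 1, by omega⟩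
    have hv' := val_add_natCast_mod_two hN b l
    rw [if_neg hk2, Nat.cast_succ, ← add_assoc, layerMap_right hN _ (by omega), add_assoc,
      ← Nat.cast_succ, window_apply b _ (by omega), window_apply b _ hk]
    rfl

/-- The window cuts through the bond `(b - 1, b)`. The two vanishing conditions empty both sites of
that bond, so nothing wraps round. -/
theorem layerMap_window_of_ne (hN : Even N) {p : ℕ} (hp : p < 2) {b : ZMod N}
    (hb : b.val % 2 ≠ p) (f : ℕ → Fin 4) (h0 : f 0 = 0) (hf : ∀ k, N ≤ k + 1 → f k = 0) :
    layerMap p (window b f) =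
      window b fun k => if k % 2 = 1 then gateL (f k) (f (k + 1)) else gateR (f (k - 1)) (f k) := by
  refine string_ext b fun k hk => ?_
  have hv := val_add_natCast_mod_two hN b k
  obtain ⟨m, hm⟩ := hN.two_dvd
  rw [window_apply b _ hk]
  by_cases hk2 : k % 2 = 1
  · rw [layerMap_left _ (by omega), if_pos hk2, window_apply b _ hk, add_assoc, ← Nat.cast_succ]
    congr 1
    rcases Nat.lt_or_ge (k + 1) N with hlt | hge
    · exact window_apply b _ hlt
    · rw [show k.succ = N by omega, CharP.cast_eq_zero, add_zero, hf (k + 1) (by omega)]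
      simpa [h0] using window_apply b f (k := 0) (by omega)
  · rw [if_neg hk2]
    rcases Nat.eq_zero_or_pos k with rfl | hpos
    · have hv' := val_sub_one_mod_two hN b
      have := layerMap_right hN (p := p) (window b f) (j := b - 1) (by omega)
      rw [sub_add_cancel] at this
      have e0 : window b f b = f 0 := by simpa using window_apply b f (k := 0) (by omega)
      have e1 : window b f (b - 1) = 0 := by
        have := window_apply b f (k := N - 1) (by omega)
        rw [Nat.cast_sub (by omega), CharP.cast_eq_zero] at this
        rw [show b - 1 = b + (0 - ((1 : ℕ) : ZMod N)) by simp [sub_eq_add_neg], this, hf _ (by omega)]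
      rw [Nat.cast_zero, add_zero, this, e0, e1, h0]
    · obtain ⟨l, rfl⟩ : ∃ l, k = l + 1 := ⟨k - 1, by omega⟩
      have hv' := val_add_natCast_mod_two hN b l
      rw [Nat.cast_succ, ← add_assoc, layerMap_right hN _ (by omega), add_assoc,
        ← Nat.cast_succ, window_apply b _ (by omega), window_apply b _ hk]
      rfl

theorem layerMap_window₄ (hN : Even N) {p : ℕ} {b : ZMod N} (hb : b.val % 2 = p)
    (x₀ x₁ x₂ x₃ : Fin 4) : layerMap p (window b (labels [x₀, x₁, x₂, x₃])) =
      window b (labels [gateL x₀ x₁, gateR x₀ x₁, gateL x₂ x₃, gateR x₂ x₃]) := by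
  rw [layerMap_window_of_eq hN hb]
  refine window_congr b fun k _ => ?_
  rcases k with _ | _ | _ | _ | _ | k <;> simp [labels, gate_zero_zero]

theorem layerMap_window₅ (hN : Even N) (h6 : 6 ≤ N) {p : ℕ} (hp : p < 2) {b : ZMod N}
    (hb : b.val % 2 ≠ p) (x₁ x₂ x₃ x₄ : Fin 4) :
    layerMap p (window b (labels [0, x₁, x₂, x₃, x₄])) =
      window b (labels [0, gateL x₁ x₂, gateR x₁ x₂, gateL x₃ x₄, gateR x₃ x₄]) := by
  rw [layerMap_window_of_ne hN hp hb _ rfl]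
  · refine window_congr b fun k _ => ?_
    rcases k with _ | _ | _ | _ | _ | _ | k <;> simp [labels, gate_zero_zero]
  · intro k hk
    obtain ⟨k, rfl⟩ : ∃ l, k = l + 5 := ⟨k - 5, by omega⟩
    simp [labels]

theorem gateSign_zero_right (s : Fin 4) : gateSign s 0 = 1 := by
  revert s; simp [gateSign]

theorem layerSign_window₃ (hN : Even N) (h6 : 6 ≤ N) {p : ℕ} {b : ZMod N} (hb : b.val % 2 = p)
    (x₀ x₁ x₂ : Fin 4) :
    layerSign p (window b (labels [x₀, x₁, x₂])) = gateSign x₀ x₁ := by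
  rw [layerSign, Finset.prod_eq_single b]
  · have e0 := window_apply b (labels [x₀, x₁, x₂]) (k := 0) (by omega)
    have e1 := window_apply b (labels [x₀, x₁, x₂]) (k := 1) (by omega)
    simp only [Nat.cast_zero, add_zero, Nat.cast_one] at e0 e1
    rw [e0, e1]; rfl
  · intro j hj hjb
    obtain ⟨k, hk, rfl⟩ := exists_eq_add b j
    have hv := val_add_natCast_mod_two hN b k
    have hk2 : (b + (k : ℕ)).val % 2 = p := by simpa [bonds] using hj
    have hk0 : k ≠ 0 := by rintro rfl; simp at hjb
    obtain ⟨m, hm⟩ := hN.two_dvd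
    obtain ⟨l, rfl⟩ : ∃ l, k = l + 2 := ⟨k - 2, by omega⟩
    rw [add_assoc, ← Nat.cast_succ, window_apply b _ hk, window_apply b _ (by omega)]
    exact gateSign_zero_right _
  · simp [bonds, hb]

theorem window_shift_one (h4 : 4 ≤ N) (b : ZMod N) (x₀ x₁ x₂ : Fin 4) :
    window b (labels [0, x₀, x₁, x₂]) = window (b + 1) (labels [x₀, x₁, x₂]) := by
  refine string_ext (b + 1) fun k hk => ?_
  rw [window_apply _ _ hk]
  rcases Nat.lt_or_ge (k + 1) N with hlt | hge
  · rw [add_assoc, add_comm (1 : ZMod N), ← Nat.cast_succ, window_apply b _ hlt]; rfl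
  · obtain ⟨l, rfl⟩ : ∃ l, k = l + 3 := ⟨k - 3, by omega⟩
    have hz : (((l + 3).succ : ℕ) : ZMod N) = 0 := by
      rw [show (l + 3).succ = N by omega]; exact ZMod.natCast_self N
    rw [add_assoc, add_comm (1 : ZMod N), ← Nat.cast_succ, hz]
    have := window_apply b (labels [0, x₀, x₁, x₂]) (k := 0) (by omega)
    rw [Nat.cast_zero] at this
    rw [this]; simp [labels]

theorem layerSign_window₄ (hN : Even N) (h6 : 6 ≤ N) {p : ℕ} (hp : p < 2) {b : ZMod N}
    (hb : b.val % 2 ≠ p) (x₁ x₂ x₃ : Fin 4) :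
    layerSign p (window b (labels [0, x₁, x₂, x₃])) = gateSign x₁ x₂ := by
  have hb1 := val_add_one_mod_two hN b
  rw [window_shift_one (by omega), layerSign_window₃ hN h6 (by omega)]

theorem window_shift (h6 : 6 ≤ N) (b : ZMod N) (x₀ x₁ x₂ : Fin 4) :
    window b (labels [0, 0, x₀, x₁, x₂]) = window (b + 2) (labels [x₀, x₁, x₂]) := by
  refine string_ext (b + 2) fun k hk => ?_
  rw [window_apply _ _ hk]
  have e : b + 2 + (k : ZMod N) = b + ((k + 2 : ℕ) : ZMod N) := by push_cast; ring
  rcases Nat.lt_or_ge (k + 2) N with hlt | hge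
  · rw [e, window_apply b _ hlt]; rfl
  · obtain ⟨l, rfl⟩ : ∃ l, k = l + 3 := ⟨k - 3, by omega⟩
    have e' : b + 2 + ((l + 3 : ℕ) : ZMod N) = b + ((l + 5 - N : ℕ) : ZMod N) := by
      rw [e, Nat.cast_sub (by omega), ZMod.natCast_self, sub_zero]
    rw [e', window_apply b _ (by omega)]
    have : l + 5 - N < 2 := by omega
    interval_cases l + 5 - N <;> simp [labels]

theorem window₃_apply (h6 : 6 ≤ N) (b : ZMod N) (x₀ x₁ x₂ : Fin 4) :
    window b (labels [x₀, x₁, x₂]) b = x₀ ∧ window b (labels [x₀, x₁, x₂]) (b + 1) = x₁ ∧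
      window b (labels [x₀, x₁, x₂]) (b + 2) = x₂ := by
  have e0 := window_apply b (labels [x₀, x₁, x₂]) (k := 0) (by omega)
  have e1 := window_apply b (labels [x₀, x₁, x₂]) (k := 1) (by omega)
  have e2 := window_apply b (labels [x₀, x₁, x₂]) (k := 2) (by omega)
  simp only [Nat.cast_zero, add_zero, Nat.cast_one, Nat.cast_ofNat] at e0 e1 e2
  exact ⟨e0, e1, e2⟩

theorem eq_window₃ (b : ZMod N) {S : PauliString N}
    (h : ∀ k, 3 ≤ k → k < N → S (b + (k : ℕ)) = 0) :
    S = window b (labels [S b, S (b + 1), S (b + 2)]) := by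
  refine string_ext b fun k hk => ?_
  rw [window_apply _ _ hk]
  rcases k with _ | _ | _ | k
  · simp [labels]
  · simp [labels]
  · simp [labels]
  · rw [h _ (by omega) hk]; simp [labels]

/-- The matrix elements of a layer of rotations at a site. -/
def siteTransfer (D : Finset (ZMod N)) (V : ZMod N → Gate) (j : ZMod N) (p q : Fin 4) : ℂ :=
  transfer (siteGate D V j) p q

theorem rotMatrix_window₃ (h6 : 6 ≤ N) (D : Finset (ZMod N)) (V : ZMod N → Gate) (b : ZMod N)
    (x₀ x₁ x₂ y₀ y₁ y₂ : Fin 4) :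
    rotMatrix D V (window b (labels [x₀, x₁, x₂])) (window b (labels [y₀, y₁, y₂])) =
      siteTransfer D V b x₀ y₀ * siteTransfer D V (b + 1) x₁ y₁ *
        siteTransfer D V (b + 2) x₂ y₂ := by
  rw [rotMatrix, Matrix.of_apply]
  have : ∏ j, transfer (siteGate D V j) (window b (labels [x₀, x₁, x₂]) j)
      (window b (labels [y₀, y₁, y₂]) j) = ∏ k : Fin 3, siteTransfer D V (b + (k : ℕ))
        (labels [x₀, x₁, x₂] k) (labels [y₀, y₁, y₂] k) := by
    symm
    refine Fintype.prod_of_injective (fun k : Fin 3 => b + ((k : ℕ) : ZMod N)) ?_ _ _ ?_ ?_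
    · intro k l hkl
      have := congrArg ZMod.val (add_left_cancel hkl)
      rw [ZMod.val_natCast_of_lt (by omega), ZMod.val_natCast_of_lt (by omega)] at this
      exact Fin.ext this
    · intro j hj
      obtain ⟨k, hk, rfl⟩ := exists_eq_add b j
      have hk3 : 3 ≤ k := by
        by_contra hlt
        exact hj ⟨⟨k, by omega⟩, rfl⟩
      obtain ⟨l, rfl⟩ : ∃ l, k = l + 3 := ⟨k - 3, by omega⟩
      rw [window_apply b _ hk, window_apply b _ hk]
      simp [labels, transfer_zero_left]
    · intro k
      rw [window_apply b _ (by omega), window_apply b _ (by omega), siteTransfer]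
  rw [this, Fin.prod_univ_three]
  simp [labels]

/-- Rotations preserve supports, so the sum over all strings collapses to the strings in the same
window. -/
theorem rotMatrix_mulVec_window₃ (h6 : 6 ≤ N) (D : Finset (ZMod N)) (V : ZMod N → Gate)
    (b : ZMod N) (c : PauliString N → ℂ) (x₀ x₁ x₂ : Fin 4) :
    (rotMatrix D V).mulVec c (window b (labels [x₀, x₁, x₂])) =
      ∑ y₀, ∑ y₁, ∑ y₂, siteTransfer D V b x₀ y₀ * siteTransfer D V (b + 1) x₁ y₁ *
        siteTransfer D V (b + 2) x₂ y₂ * c (window b (labels [y₀, y₁, y₂])) := by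
  rw [Matrix.mulVec, dotProduct]
  have := Fintype.sum_of_injective
    (fun y : Fin 4 × Fin 4 × Fin 4 => window b (labels [y.1, y.2.1, y.2.2]))
    (by
      rintro ⟨y₀, y₁, y₂⟩ ⟨z₀, z₁, z₂⟩ hyz
      obtain ⟨h0, h1, h2⟩ := window₃_apply h6 b y₀ y₁ y₂
      obtain ⟨k0, k1, k2⟩ := window₃_apply h6 b z₀ z₁ z₂
      simp only at hyz
      rw [hyz] at h0 h1 h2
      rw [k0] at h0; rw [k1] at h1; rw [k2] at h2
      rw [h0, h1, h2])
    (fun y => siteTransfer D V b x₀ y.1 * siteTransfer D V (b + 1) x₁ y.2.1 *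
        siteTransfer D V (b + 2) x₂ y.2.2 * c (window b (labels [y.1, y.2.1, y.2.2])))
    (fun S => rotMatrix D V (window b (labels [x₀, x₁, x₂])) S * c S)
    (fun S hS => by
      by_contra hne
      have hc := sameClass_of_rotMatrix_ne_zero (left_ne_zero_of_mul hne)
      refine hS ⟨(S b, S (b + 1), S (b + 2)), (eq_window₃ b fun k hk hkN => ?_).symm⟩
      rw [← (hc _).1, window_apply b _ hkN]
      obtain ⟨l, rfl⟩ : ∃ l, k = l + 3 := ⟨k - 3, by omega⟩
      simp [labels])
    (fun y => by rw [rotMatrix_window₃ h6])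
  rw [← this]
  simp only [Fintype.sum_prod_type]

end Window

/-! ### One period of a vector supported in a window of three sites -/

section Window

variable {N : ℕ} [NeZero N]

/-- The coefficient vector supported on the strings in a window of three sites. -/
def windowVec (b : ZMod N) (c : Fin 4 → Fin 4 → Fin 4 → ℂ) (S : PauliString N) : ℂ :=
  open Classical in
  if S = window b (labels [S b, S (b + 1), S (b + 2)]) then c (S b) (S (b + 1)) (S (b + 2)) else 0

theorem windowVec_window (h6 : 6 ≤ N) (b : ZMod N) (c : Fin 4 → Fin 4 → Fin 4 → ℂ)
    (x₀ x₁ x₂ : Fin 4) : windowVec b c (window b (labels [x₀, x₁, x₂])) = c x₀ x₁ x₂ := by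
  obtain ⟨h0, h1, h2⟩ := window₃_apply h6 b x₀ x₁ x₂
  rw [windowVec, h0, h1, h2, if_pos rfl]

/-- The coefficients of a rotated window vector. -/
def rotCoeff (D : Finset (ZMod N)) (V : ZMod N → Gate) (b : ZMod N)
    (c : Fin 4 → Fin 4 → Fin 4 → ℂ) (x₀ x₁ x₂ : Fin 4) : ℂ :=
  ∑ y₀, ∑ y₁, ∑ y₂, siteTransfer D V b x₀ y₀ * siteTransfer D V (b + 1) x₁ y₁ *
    siteTransfer D V (b + 2) x₂ y₂ * c y₀ y₁ y₂

theorem rotMatrix_mulVec_windowVec (h6 : 6 ≤ N) (D : Finset (ZMod N)) (V : ZMod N → Gate)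
    (b : ZMod N) (c : Fin 4 → Fin 4 → Fin 4 → ℂ) (x₀ x₁ x₂ : Fin 4) :
    (rotMatrix D V).mulVec (windowVec b c) (window b (labels [x₀, x₁, x₂])) =
      rotCoeff D V b c x₀ x₁ x₂ := by
  rw [rotMatrix_mulVec_window₃ h6]
  simp only [windowVec_window h6, rotCoeff]

theorem rotMatrix_mulVec_windowVec_eq_zero (h6 : 6 ≤ N) (D : Finset (ZMod N))
    (V : ZMod N → Gate) (b : ZMod N) (c : Fin 4 → Fin 4 → Fin 4 → ℂ) {S : PauliString N}
    (hS : S (b + 3) ≠ 0) : (rotMatrix D V).mulVec (windowVec b c) S = 0 := by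
  rw [Matrix.mulVec, dotProduct]
  refine Finset.sum_eq_zero fun T _ => ?_
  by_contra hne
  have hc := sameClass_of_rotMatrix_ne_zero (left_ne_zero_of_mul hne)
  have hT := right_ne_zero_of_mul hne
  rw [windowVec] at hT
  split_ifs at hT with h
  · refine hS ((hc _).1.mpr ?_)
    rw [h]
    have := window_apply b (labels [T b, T (b + 1), T (b + 2)]) (k := 3) (by omega)
    rw [Nat.cast_ofNat] at this
    rw [this]; rfl
  · exact hT rfl

theorem siteTransfer_zero_left (D : Finset (ZMod N)) (V : ZMod N → Gate) (j : ZMod N)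
    (q : Fin 4) : siteTransfer D V j 0 q = if q = 0 then 1 else 0 := transfer_zero_left _ _

theorem siteTransfer_zero_right (D : Finset (ZMod N)) (V : ZMod N → Gate) (j : ZMod N)
    (p : Fin 4) : siteTransfer D V j p 0 = if p = 0 then 1 else 0 := transfer_zero_right _ _

theorem siteTransfer_of_notMem {D : Finset (ZMod N)} (V : ZMod N → Gate) {j : ZMod N}
    (hj : j ∉ D) (p q : Fin 4) : siteTransfer D V j p q = if p = q then 1 else 0 := by
  rw [siteTransfer, siteGate, if_neg hj]
  exact transfer_one _ _

/-- The preimage labels under the Clifford gate. -/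
def preL : Fin 4 → Fin 4 → Fin 4 :=
  ![![0, 2, 3, 1], ![1, 3, 2, 0], ![1, 3, 2, 0], ![0, 2, 3, 1]]

/-- The preimage labels under the Clifford gate. -/
def preR : Fin 4 → Fin 4 → Fin 4 :=
  ![![0, 1, 1, 0], ![2, 3, 3, 2], ![3, 2, 2, 3], ![1, 0, 0, 1]]

theorem gateL_pre (s t : Fin 4) : gateL (preL s t) (preR s t) = s := by
  revert s t; decide

theorem gateR_pre (s t : Fin 4) : gateR (preL s t) (preR s t) = t := by
  revert s t; decide

theorem labels_append_zero (x₀ x₁ x₂ : Fin 4) :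
    labels [x₀, x₁, x₂, 0] = labels [x₀, x₁, x₂] := by
  funext k
  rcases k with _ | _ | _ | _ | k <;> simp [labels]

/-- Evaluated backwards through the odd bonds; the preimage lies in the window exactly when its
fourth label is trivial. -/
theorem layer_rot_windowVec (hN : Even N) (h6 : 6 ≤ N) (D : Finset (ZMod N)) (V : ZMod N → Gate)
    {b : ZMod N} (hb : b.val % 2 = 1) (c : Fin 4 → Fin 4 → Fin 4 → ℂ) (y₁ y₂ y₃ : Fin 4) :
    (layerMatrix N 1).mulVec ((rotMatrix D V).mulVec (windowVec b c))
      (window (b + 1) (labels [y₁, y₂, y₃])) =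
      if preR y₂ y₃ = 0 then gateSign (preL 0 y₁) (preR 0 y₁) *
        rotCoeff D V b c (preL 0 y₁) (preR 0 y₁) (preL y₂ y₃) else 0 := by
  have h := layerMap_window₄ hN hb (preL 0 y₁) (preR 0 y₁) (preL y₂ y₃) (preR y₂ y₃)
  simp only [gateL_pre, gateR_pre] at h
  rw [← window_shift_one (by omega), ← h, layerMatrix_mulVec hN (by norm_num)]
  split_ifs with h0
  · rw [h0, labels_append_zero, layerSign_window₃ hN h6 hb, rotMatrix_mulVec_windowVec h6]
  · rw [rotMatrix_mulVec_windowVec_eq_zero h6, mul_zero]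
    have := window_apply b (labels [preL 0 y₁, preR 0 y₁, preL y₂ y₃, preR y₂ y₃])
      (k := 3) (by omega)
    rw [Nat.cast_ofNat] at this
    rw [this]
    exact h0

/-- Both Clifford layers are undone in turn: `q` are the labels before the even bonds, `y` those
between the odd bonds and the first rotations. The condition on `q₁, q₂` says that the rear has left
`b + 1`. -/
theorem coreMatrix_mulVec_windowVec (hN : Even N) (h6 : 6 ≤ N) (D : Finset (ZMod N))
    (V : Fin 2 → ZMod N → Gate) {b : ZMod N} (hb : b.val % 2 = 1)
    (c : Fin 4 → Fin 4 → Fin 4 → ℂ) {q₁ q₂ : Fin 4} (hq : gateL q₁ q₂ = 0) (q₃ : Fin 4) :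
    (coreMatrix D V).mulVec (windowVec b c)
      (window (b + 2) (labels [gateR q₁ q₂, gateL q₃ 0, gateR q₃ 0])) =
      gateSign q₁ q₂ * ∑ y₁, ∑ y₂, ∑ y₃, siteTransfer D (V 0) (b + 1) q₁ y₁ *
        siteTransfer D (V 0) (b + 1 + 1) q₂ y₂ * siteTransfer D (V 0) (b + 1 + 2) q₃ y₃ *
        if preR y₂ y₃ = 0 then gateSign (preL 0 y₁) (preR 0 y₁) *
          rotCoeff D (V 1) b c (preL 0 y₁) (preR 0 y₁) (preL y₂ y₃) else 0 := by
  have h := layerMap_window₅ hN h6 (p := 0) (by norm_num) (b := b) (by omega) q₁ q₂ q₃ 0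
  rw [hq, window_shift h6] at h
  have e : labels [0, q₁, q₂, q₃, 0] = labels [0, q₁, q₂, q₃] := by
    funext k
    rcases k with _ | _ | _ | _ | _ | k <;> simp [labels]
  rw [← h, coreMatrix, ← Matrix.mulVec_mulVec, ← Matrix.mulVec_mulVec, ← Matrix.mulVec_mulVec,
    layerMatrix_mulVec hN (by norm_num), e, layerSign_window₄ hN h6 (by norm_num) (by omega),
    window_shift_one (by omega), rotMatrix_mulVec_window₃ h6]
  simp only [layer_rot_windowVec hN h6 D (V 1) hb]

/-- Rear labels X and Y. The odd bond `(b + 2, b + 3)` has a trivial right input, so it outputs `(Z,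
X)`, `(Z, Y)` or `(I, Z)` when occupied. As `b + 2` must be occupied here, only the first two
contribute. -/
theorem coreMatrix_mulVec_windowVec_mid (hN : Even N) (h6 : 6 ≤ N) (D : Finset (ZMod N))
    (V : Fin 2 → ZMod N → Gate) {b : ZMod N} (hb : b.val % 2 = 1)
    (c : Fin 4 → Fin 4 → Fin 4 → ℂ) {q₁ q₃ : Fin 4} (hq : q₁ = 2 ∨ q₁ = 3) (hq₃ : q₃ ≠ 0) :
    (coreMatrix D V).mulVec (windowVec b c)
      (window (b + 2) (labels [gateR q₁ 1, gateL q₃ 0, gateR q₃ 0])) =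
      siteTransfer D (V 0) (b + 2) 1 3 *
        (siteTransfer D (V 0) (b + 3) q₃ 1 * (
          siteTransfer D (V 0) (b + 1) q₁ 1 * rotCoeff D (V 1) b c 2 1 2 +
          siteTransfer D (V 0) (b + 1) q₁ 2 * rotCoeff D (V 1) b c 3 1 2 +
          siteTransfer D (V 0) (b + 1) q₁ 3 * rotCoeff D (V 1) b c 1 0 2) +
        siteTransfer D (V 0) (b + 3) q₃ 2 * (
          siteTransfer D (V 0) (b + 1) q₁ 1 * rotCoeff D (V 1) b c 2 1 3 +
          siteTransfer D (V 0) (b + 1) q₁ 2 * rotCoeff D (V 1) b c 3 1 3 +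
          siteTransfer D (V 0) (b + 1) q₁ 3 * rotCoeff D (V 1) b c 1 0 3)) := by
  have hL : gateL q₁ 1 = 0 := by rcases hq with rfl | rfl <;> rfl
  have hS : gateSign q₁ 1 = 1 := by rcases hq with rfl | rfl <;> simp [gateSign]
  have h1 : q₁ ≠ 0 := by rcases hq with rfl | rfl <;> decide
  rw [coreMatrix_mulVec_windowVec hN h6 D V hb c hL, hS, show b + 1 + 1 = b + 2 by ring,
    show b + 1 + 2 = b + 3 by ring]
  simp only [Fin.sum_univ_four, siteTransfer_zero_right, if_neg h1, if_neg hq₃]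
  simp [preL, preR, gateSign]
  ring

/-- Rear label Z. Now `b + 2` is empty between the layers, which selects the remaining output `(I,
Z)` of the odd bond. -/
theorem coreMatrix_mulVec_windowVec_end (hN : Even N) (h6 : 6 ≤ N) (D : Finset (ZMod N))
    (V : Fin 2 → ZMod N → Gate) {b : ZMod N} (hb : b.val % 2 = 1)
    (c : Fin 4 → Fin 4 → Fin 4 → ℂ) {q₃ : Fin 4} (hq₃ : q₃ ≠ 0) :
    (coreMatrix D V).mulVec (windowVec b c)
      (window (b + 2) (labels [3, gateL q₃ 0, gateR q₃ 0])) =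
      siteTransfer D (V 0) (b + 3) q₃ 3 * (
          siteTransfer D (V 0) (b + 1) 1 1 * rotCoeff D (V 1) b c 2 1 1 +
          siteTransfer D (V 0) (b + 1) 1 2 * rotCoeff D (V 1) b c 3 1 1 +
          siteTransfer D (V 0) (b + 1) 1 3 * rotCoeff D (V 1) b c 1 0 1) := by
  have h := coreMatrix_mulVec_windowVec hN h6 D V hb c (q₁ := 1) (q₂ := 0) rfl q₃
  rw [show gateR 1 0 = 3 from rfl] at h
  rw [h, show b + 1 + 1 = b + 2 by ring, show b + 1 + 2 = b + 3 by ring]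
  simp only [Fin.sum_univ_four, siteTransfer_zero_right, siteTransfer_zero_left, if_neg hq₃]
  simp [preL, preR, gateSign]
  ring

end Window

section Soliton

variable {N : ℕ} [NeZero N]

/-! ### The right-moving soliton and its amplitudes -/

/-- The matrix elements of the rotations of layer `l` at the position `i`. -/
def elem (D : Finset (ZMod N)) (V : Fin 2 → ZMod N → Gate) (l : Fin 2) (i : ℤ) (p q : Fin 4) : ℂ :=
  siteTransfer D (V l) (i : ZMod N) p q

open Classical in
/-- The amplitudes of the rear label of a soliton whose middle site is undoped. -/
def rearCoeff (D : Finset (ZMod N)) (V : Fin 2 → ZMod N → Gate) (a : ℤ) : Fin 4 → ℂ :=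
  if Undoped D (a - 2) then ![0, elem D V 0 (a - 1) 2 2, elem D V 0 (a - 1) 3 2, 0]
  else ![0, 0, 1, 0]

open Classical in
/-- The amplitudes of the front label of a soliton whose middle site is doped. -/
def frontCoeff (D : Finset (ZMod N)) (V : Fin 2 → ZMod N → Gate) (a : ℤ) : Fin 4 → ℂ :=
  if Undoped D (a + 2) then ![0, 1, 0, 0]
  else ![0, elem D V 0 (a + 1) 2 3, elem D V 0 (a + 1) 3 3, 0]

open Classical in
/-- The amplitudes of the labels of the soliton at the positions `a, a + 1, a + 2`. -/
def solCoeff (D : Finset (ZMod N)) (V : Fin 2 → ZMod N → Gate) (a : ℤ) (t₀ t₁ t₂ : Fin 4) : ℂ :=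
  if Undoped D (a + 1) then if t₁ = 0 ∧ t₂ = 3 then rearCoeff D V a t₀ else 0
  else if t₁ = 3 ∧ t₀ = (if Undoped D a then 3 else 2) then frontCoeff D V a t₂ else 0

/-- The coefficient vector of the soliton with rear end `a`. -/
def solVec (D : Finset (ZMod N)) (V : Fin 2 → ZMod N → Gate) (a : ℤ) : PauliString N → ℂ :=
  windowVec (a : ZMod N) (solCoeff D V a)

open Classical in
/-- The amplitude with which the soliton moves from `a` to `a + 2` in one undamped period. -/
def amp (D : Finset (ZMod N)) (V : Fin 2 → ZMod N → Gate) (a : ℤ) : ℂ :=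
  if Undoped D (a + 1) then
    (elem D V 1 a 1 1 * rearCoeff D V a 1 + elem D V 1 a 1 2 * rearCoeff D V a 2) *
      elem D V 0 (a + 2) 1 3 * (if Undoped D (a + 3) then elem D V 1 (a + 2) 2 3 else
        elem D V 0 (a + 3) 2 1 * elem D V 1 (a + 2) 2 3 +
          elem D V 0 (a + 3) 2 2 * elem D V 1 (a + 2) 3 3)
  else if Undoped D (a + 2) then
    elem D V 1 (a + 1) 1 3 * (if Undoped D a then elem D V 0 (a + 1) 1 2 else
        elem D V 0 (a + 1) 1 1 * elem D V 1 a 2 2 + elem D V 0 (a + 1) 1 2 * elem D V 1 a 3 2) *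
      (if Undoped D (a + 4) then elem D V 0 (a + 3) 2 3 else 1)
  else elem D V 1 (a + 1) 1 3 * elem D V 0 (a + 2) 1 3 *
      (elem D V 1 (a + 2) 2 1 * frontCoeff D V a 1 + elem D V 1 (a + 2) 2 2 * frontCoeff D V a 2)

open Classical in
/-- The weight of the soliton. -/
def solWeight (D : Finset (ZMod N)) (a : ℤ) : ℕ := if Undoped D (a + 1) then 2 else 3

theorem elem_of_undoped {D : Finset (ZMod N)} (V : Fin 2 → ZMod N → Gate) (l : Fin 2) {i : ℤ}
    (hi : Undoped D i) (p q : Fin 4) : elem D V l i p q = if p = q then 1 else 0 :=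
  siteTransfer_of_notMem _ hi p q

theorem rearCoeff_zero (D : Finset (ZMod N)) (V : Fin 2 → ZMod N → Gate) (a : ℤ) :
    rearCoeff D V a 0 = 0 ∧ rearCoeff D V a 3 = 0 := by
  unfold rearCoeff; split_ifs <;> simp

theorem frontCoeff_zero (D : Finset (ZMod N)) (V : Fin 2 → ZMod N → Gate) (a : ℤ) :
    frontCoeff D V a 0 = 0 ∧ frontCoeff D V a 3 = 0 := by
  unfold frontCoeff; split_ifs <;> simp

theorem rotCoeff_solCoeff_of_undoped {D : Finset (ZMod N)} (V : Fin 2 → ZMod N → Gate) {a : ℤ}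
    (ha : Undoped D (a + 1)) (x₀ x₁ x₂ : Fin 4) :
    rotCoeff D (V 1) a (solCoeff D V a) x₀ x₁ x₂ = if x₁ = 0 then
      (elem D V 1 a x₀ 1 * rearCoeff D V a 1 + elem D V 1 a x₀ 2 * rearCoeff D V a 2) *
        elem D V 1 (a + 2) x₂ 3 else 0 := by
  obtain ⟨h0, h3⟩ := rearCoeff_zero D V a
  simp only [rotCoeff, solCoeff, if_pos ha, Fin.sum_univ_four, h0, h3, siteTransfer_zero_right]
  simp [elem]
  split_ifs <;> ring

theorem rotCoeff_solCoeff_of_doped {D : Finset (ZMod N)} (V : Fin 2 → ZMod N → Gate) {a : ℤ}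
    (ha : ¬ Undoped D (a + 1)) (x₀ x₁ x₂ : Fin 4) :
    rotCoeff D (V 1) a (solCoeff D V a) x₀ x₁ x₂ =
      (open Classical in elem D V 1 a x₀ (if Undoped D a then 3 else 2)) *
        elem D V 1 (a + 1) x₁ 3 *
        (elem D V 1 (a + 2) x₂ 1 * frontCoeff D V a 1 +
          elem D V 1 (a + 2) x₂ 2 * frontCoeff D V a 2) := by
  obtain ⟨h0, h3⟩ := frontCoeff_zero D V a
  simp only [rotCoeff, solCoeff, if_neg ha, Fin.sum_univ_four, h0, h3]
  by_cases hU : Undoped D a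
  · simp [elem, hU]; ring
  · simp [elem, hU]; ring

theorem Compact.eq_window {S : PauliString N} {a : ℤ} (h : Compact N a (lift S)) :
    S = window (a : ZMod N) (labels [lift S a, lift S (a + 1), lift S (a + 2)]) := by
  have := eq_window₃ (a : ZMod N) (S := S) fun k hk hkN => by
    have := h.2.2.2.1 (a + k) (by omega) (by omega)
    simpa [lift] using this
  simpa [lift] using this

theorem gate_values : gateR 2 1 = 1 ∧ gateR 3 1 = 2 ∧ gateL 1 0 = 0 ∧ gateR 1 0 = 3 ∧
    gateL 2 0 = 3 ∧ gateR 2 0 = 1 ∧ gateL 3 0 = 3 ∧ gateR 3 0 = 2 := by decide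

set_option maxHeartbeats 400000 in
-- The amplitudes on the strings with soliton labels factorise. The dependence on the new rear and
-- front labels is through matrix elements of the first rotations at `a + 1` and `a + 3`, and these
-- are what `rearCoeff` and `frontCoeff` at `a + 2` record; the common factor is `amp`. The cases
-- are the possible undoped positions among `a, …, a + 4`.
theorem coreMatrix_mulVec_solVec (hN : Even N) (h6 : 6 ≤ N) {D : Finset (ZMod N)}
    (hD : LinePattern (Undoped D)) (V : Fin 2 → ZMod N → Gate) {a : ℤ} {S : PauliString N}
    (hS : Compact N (a + 2) (lift S)) (hM : MainLabels (Undoped D) (a + 2) (lift S)) :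
    (coreMatrix D V).mulVec (solVec D V a) S = amp D V a * solVec D V (a + 2) S := by
  obtain ⟨g1, g2, g3, g4, g5, g6, g7, g8⟩ := gate_values
  have hodd : a % 2 = 1 := by have := hS.1; omega
  have hb : (a : ZMod N).val % 2 = 1 := by have := val_intCast_mod_two hN a; omega
  have hW := hS.eq_window
  obtain ⟨m1, m2, m3, m4⟩ := hM
  generalize lift S (a + 2) = t₀ at *
  generalize lift S (a + 2 + 1) = t₁ at *
  generalize lift S (a + 2 + 2) = t₂ at *
  rw [show a + 2 + 1 = a + 3 by ring] at *
  rw [show a + 2 + 2 = a + 4 by ring] at *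
  have c1 : ((a : ZMod N) + 1) = ((a + 1 : ℤ) : ZMod N) := by push_cast; ring
  have c2 : ((a : ZMod N) + 2) = ((a + 2 : ℤ) : ZMod N) := by push_cast; ring
  have c3 : ((a : ZMod N) + 3) = ((a + 3 : ℤ) : ZMod N) := by push_cast; ring
  have p0 := hD a
  have p1 := hD (a + 1)
  have p2 := hD (a + 2)
  have p3 := hD (a + 3)
  rw [show a + 1 + 1 = a + 2 by ring, show a + 1 + 2 = a + 3 by ring] at p1
  rw [show a + 2 + 1 = a + 3 by ring, show a + 2 + 2 = a + 4 by ring] at p2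
  rw [show a + 3 + 1 = a + 4 by ring] at p3
  have mid := @coreMatrix_mulVec_windowVec_mid N _ hN h6 D V a hb (solCoeff D V a)
  have fin := @coreMatrix_mulVec_windowVec_end N _ hN h6 D V a hb (solCoeff D V a)
  rw [c1, c2, c3] at mid fin
  simp only [← elem.eq_def D V] at mid fin
  rw [hW]
  change (coreMatrix D V).mulVec (windowVec _ _) _ = _ * windowVec _ _ _
  rw [windowVec_window h6]
  by_cases u1 : Undoped D (a + 1)
  · simp only [rotCoeff_solCoeff_of_undoped V u1] at mid
    have u2 : ¬ Undoped D (a + 2) := p1.1 u1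
    have n0 : ¬ Undoped D a := fun h => p0.1 h u1
    by_cases u3 : Undoped D (a + 3)
    · obtain ⟨ht, rfl, rfl⟩ := m1 u3
      have e1 := elem_of_undoped V 0 u1
      have e3 := elem_of_undoped V 0 u3
      rcases ht with rfl | rfl
      · have := mid (q₁ := 2) (q₃ := 1) (.inl rfl) (by decide)
        simp only [g1, g3, g4] at this
        rw [this]
        simp [e1, e3, solCoeff, rearCoeff, u3, n0, add_assoc]
      · have := mid (q₁ := 3) (q₃ := 1) (.inr rfl) (by decide)
        simp only [g2, g3, g4] at this
        rw [this]
        simp [e1, e3, solCoeff, rearCoeff, u1, u3, n0, add_assoc, amp]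
        ring
    · obtain ⟨rfl, rfl, rfl⟩ := m2 u3 u2
      have u4 : Undoped D (a + 4) := (p2.2.resolve_left u2).resolve_left u3
      have := mid (q₁ := 3) (q₃ := 2) (.inr rfl) (by decide)
      simp only [g2, g5, g6] at this
      rw [this]
      have e1 := elem_of_undoped V 0 u1
      simp [e1, solCoeff, frontCoeff, u1, u3, u2, u4, add_assoc, amp]
      ring
  · simp only [rotCoeff_solCoeff_of_doped V u1] at mid fin
    by_cases u2 : Undoped D (a + 2)
    · have u3 : ¬ Undoped D (a + 3) := p2.1 u2
      have u1' := u1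
      have ef : frontCoeff D V a 1 = 1 ∧ frontCoeff D V a 2 = 0 := by simp [frontCoeff, u2]
      have e2 := elem_of_undoped V 1 u2
      have ez : elem D V 1 (a + 1) 0 3 = 0 := siteTransfer_zero_left _ _ _ _
      have key : t₀ = 3 ∧ t₁ = 3 := by
        by_cases u4 : Undoped D (a + 4)
        · exact ⟨(m3 u2 u4).1, (m3 u2 u4).2.1⟩
        · exact ⟨(m4 u2 u4).1, (m4 u2 u4).2.1⟩
      obtain ⟨rfl, rfl⟩ := key
      have key2 : t₂ = 1 ∨ (t₂ = 2 ∧ ¬ Undoped D (a + 4)) := by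
        by_cases u4 : Undoped D (a + 4)
        · exact .inl (m3 u2 u4).2.2
        · rcases (m4 u2 u4).2.2 with h | h
          · exact .inl h
          · exact .inr ⟨h, u4⟩
      rcases key2 with rfl | ⟨rfl, u4⟩
      · have := fin (q₃ := 2) (by decide)
        simp only [g5, g6] at this
        rw [this]
        by_cases u0 : Undoped D a
        · have e0 := elem_of_undoped V 1 u0
          by_cases u4 : Undoped D (a + 4) <;>
          · simp [e0, e2, ez, solCoeff, frontCoeff, u0, u1, u2, u3, u4, add_assoc, amp]
            ring
        · by_cases u4 : Undoped D (a + 4) <;>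
          · simp [e2, ez, solCoeff, frontCoeff, u0, u1, u2, u3, u4, add_assoc, amp]
            ring
      · have := fin (q₃ := 3) (by decide)
        simp only [g7, g8] at this
        rw [this]
        by_cases u0 : Undoped D a
        · have e0 := elem_of_undoped V 1 u0
          simp [e0, e2, ez, solCoeff, frontCoeff, u0, u1, u2, u3, u4, add_assoc, amp]
          ring
        · simp [e2, ez, solCoeff, frontCoeff, u0, u1, u2, u3, u4, add_assoc, amp]
          ring
    · have u0 : Undoped D a := p0.2.resolve_right (not_or.mpr ⟨u1, u2⟩)
      have u3 : Undoped D (a + 3) := (p1.2.resolve_left u1).resolve_left u2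
      have e0 := elem_of_undoped V 1 u0
      have e3 := elem_of_undoped V 0 u3
      obtain ⟨ht, rfl, rfl⟩ := m1 u3
      have ez : elem D V 1 (a + 1) 0 3 = 0 := siteTransfer_zero_left _ _ _ _
      rcases ht with rfl | rfl
      · have := mid (q₁ := 2) (q₃ := 1) (.inl rfl) (by decide)
        simp only [g1, g3, g4] at this
        rw [this]
        simp [e0, e3, ez, solCoeff, rearCoeff, u0, u1, u2, u3, add_assoc, amp]
        ring
      · have := mid (q₁ := 3) (q₃ := 1) (.inr rfl) (by decide)
        simp only [g2, g3, g4] at this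
        rw [this]
        simp [e0, e3, ez, solCoeff, rearCoeff, u0, u1, u2, u3, add_assoc, amp]
        ring

end Soliton

/-! ### Powers of a matrix: paths and eigenvalues -/

theorem Matrix.exists_chain_of_pow_mulVec_ne_zero {ι R : Type*} [Fintype ι] [DecidableEq ι]
    [CommSemiring R] (M : Matrix ι ι R) (f : ι → R) (k : ℕ) {i : ι}
    (h : (M ^ k).mulVec f i ≠ 0) :
    ∃ c : ℕ → ι, c k = i ∧ f (c 0) ≠ 0 ∧ ∀ j < k, M (c (j + 1)) (c j) ≠ 0 := by
  induction k generalizing i with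
  | zero => exact ⟨fun _ => i, rfl, by simpa using h, by simp⟩
  | succ k ih =>
    rw [pow_succ', ← Matrix.mulVec_mulVec, Matrix.mulVec, dotProduct] at h
    obtain ⟨j, -, hj⟩ := Finset.exists_ne_zero_of_sum_ne_zero h
    obtain ⟨c, hc, h0, hs⟩ := ih (right_ne_zero_of_mul hj)
    refine ⟨fun m => if m ≤ k then c m else i, by simp, by simpa using h0, fun m hm => ?_⟩
    rcases Nat.lt_or_ge m k with hlt | hge
    · simpa [hlt.le, Nat.succ_le_of_lt hlt] using hs m hlt
    · have : m = k := by omega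
      subst this
      simpa [hc] using left_ne_zero_of_mul hj

/-- Spectral mapping over ℂ. The vector `v` itself need not be an eigenvector of `M`. -/
theorem Matrix.exists_eigenvalue_of_pow_mulVec {ι : Type*} [Fintype ι] [DecidableEq ι]
    (M : Matrix ι ι ℂ) {n : ℕ} (hn : 0 < n) {v : ι → ℂ} (hv : v ≠ 0) {z : ℂ}
    (h : (M ^ n).mulVec v = z • v) : ∃ μ : ℂ, μ ^ n = z ∧ ∃ c ≠ 0, M.mulVec c = μ • c := by
  set f := Matrix.toLin' M with hf
  have h1 : Module.End.HasEigenvalue (f ^ n) z := by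
    refine Module.End.hasEigenvalue_of_hasEigenvector (x := v) ⟨?_, hv⟩
    rw [Module.End.mem_eigenspace_iff, hf, ← Matrix.toLin'_pow, Matrix.toLin'_apply, h]
  have h2 := h1.mem_spectrum
  rw [spectrum.map_pow_of_pos f hn] at h2
  obtain ⟨μ, hμ, rfl⟩ := h2
  obtain ⟨c, hc⟩ := (Module.End.hasEigenvalue_iff_mem_spectrum.mpr hμ).exists_hasEigenvector
  refine ⟨μ, rfl, c, hc.2, ?_⟩
  have := hc.1
  rwa [Module.End.mem_eigenspace_iff, hf, Matrix.toLin'_apply] at this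

/-! ### Periodicity and support of the soliton vectors -/

section Soliton

variable {N : ℕ} [NeZero N] {D : Finset (ZMod N)} {V : Fin 2 → ZMod N → Gate} {γ : ℝ}

theorem undoped_add_period (i : ℤ) : Undoped D (i + N) = Undoped D i := by simp [Undoped]

theorem elem_add_period (l : Fin 2) (i : ℤ) : elem D V l (i + N) = elem D V l i := by
  funext p q; simp [elem]

theorem rearCoeff_add_period (a : ℤ) : rearCoeff D V (a + N) = rearCoeff D V a := by
  rw [rearCoeff, show a + N - 2 = a - 2 + N by ring, show a + N - 1 = a - 1 + N by ring,
    undoped_add_period, elem_add_period, rearCoeff]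

theorem frontCoeff_add_period (a : ℤ) : frontCoeff D V (a + N) = frontCoeff D V a := by
  rw [frontCoeff, show a + N + 2 = a + 2 + N by ring, show a + N + 1 = a + 1 + N by ring,
    undoped_add_period, elem_add_period, frontCoeff]

theorem solVec_add_period (a : ℤ) : solVec D V (a + N) = solVec D V a := by
  have : solCoeff D V (a + N) = solCoeff D V a := by
    funext t₀ t₁ t₂
    rw [solCoeff, rearCoeff_add_period, frontCoeff_add_period,
      show a + N + 1 = a + 1 + N by ring, undoped_add_period, undoped_add_period, solCoeff]
  rw [solVec, solVec, this]
  simp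

theorem solWeight_add_period (a : ℤ) : solWeight D (a + N) = solWeight D a := by
  rw [solWeight, show a + N + 1 = a + 1 + N by ring, undoped_add_period, solWeight]

theorem solVec_support (h6 : 6 ≤ N) (hD : LinePattern (Undoped D)) {a : ℤ} (ha : a % 2 = 1)
    {S : PauliString N} (h : solVec D V a S ≠ 0) :
    Compact N a (lift S) ∧ MainLabels (Undoped D) a (lift S) ∧ weight S = solWeight D a := by
  rw [solVec, windowVec] at h
  split_ifs at h with hw
  swap
  · exact absurd rfl h
  have hlift : ∀ k : ℕ, k < N → lift S (a + k) = labels [lift S a, lift S (a + 1), lift S (a + 2)] k := by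
    intro k hk
    have := congrFun hw ((a : ZMod N) + (k : ℕ))
    rw [window_apply _ _ hk] at this
    simpa [lift] using this
  have hz : ∀ i, a + 2 < i → i < a + N → lift S i = 0 := by
    intro i hi hi'
    obtain ⟨k, rfl⟩ : ∃ k : ℕ, i = a + k := ⟨(i - a).toNat, by omega⟩
    rw [hlift k (by omega)]
    obtain ⟨l, rfl⟩ : ∃ l, k = l + 3 := ⟨k - 3, by omega⟩
    simp [labels]
  have hc : solCoeff D V a (lift S a) (lift S (a + 1)) (lift S (a + 2)) ≠ 0 := by
    simpa [lift] using h
  have hcard : weight S = (Finset.univ.filter fun k : Fin 3 =>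
      labels [lift S a, lift S (a + 1), lift S (a + 2)] k ≠ 0).card := by
    rw [weight]
    symm
    refine Finset.card_bij (fun k _ => (a : ZMod N) + ((k : ℕ) : ZMod N)) ?_ ?_ ?_
    · intro k hk
      simp only [Finset.mem_filter, Finset.mem_univ, true_and] at hk ⊢
      have := hlift k (by omega)
      simp only [lift, Int.cast_add, Int.cast_natCast] at this hk
      rw [this]; exact hk
    · intro k _ l _ hkl
      have := congrArg ZMod.val (add_left_cancel hkl)
      rw [ZMod.val_natCast_of_lt (by omega), ZMod.val_natCast_of_lt (by omega)] at this
      exact Fin.ext this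
    · intro j hj
      obtain ⟨k, hk, rfl⟩ := exists_eq_add (a : ZMod N) j
      have h1 := hlift k hk
      simp only [lift, Int.cast_add, Int.cast_natCast] at h1
      simp only [Finset.mem_filter, Finset.mem_univ, true_and, h1] at hj
      have hk3 : k < 3 := by
        by_contra hge
        obtain ⟨l, rfl⟩ : ∃ l, k = l + 3 := ⟨k - 3, by omega⟩
        exact hj (by simp [labels])
      exact ⟨⟨k, hk3⟩, by simpa [lift] using hj, rfl⟩
  obtain ⟨p1, -⟩ := hD a
  obtain ⟨p2, -⟩ := hD (a + 1)
  rw [show a + 1 + 1 = a + 2 by ring] at p2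
  have q1 := rearCoeff_zero D V a
  have q2 := frontCoeff_zero D V a
  have e2 : a + 2 = a + 1 + 1 := by ring
  simp only [Compact, MainLabels]
  revert hcard hc
  generalize lift S a = t₀
  generalize lift S (a + 1) = t₁
  generalize lift S (a + 2) = t₂
  intro hc hcard
  by_cases u1 : Undoped D (a + 1)
  · have n2 : ¬ Undoped D (a + 2) := p2 u1
    have n0 : ¬ Undoped D a := fun h => p1 h u1
    rw [solCoeff, if_pos u1] at hc
    split_ifs at hc with ht
    swap
    · exact absurd rfl hc
    obtain ⟨rfl, rfl⟩ := ht
    have ht0 : t₀ = 1 ∨ t₀ = 2 := by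
      have : t₀ ≠ 0 := by rintro rfl; exact hc q1.1
      have : t₀ ≠ 3 := by rintro rfl; exact hc q1.2
      omega
    rcases ht0 with rfl | rfl <;> simp [u1, n0, ha, solWeight, hcard] <;> exact ⟨hz, rfl⟩
  · rw [solCoeff, if_neg u1] at hc
    have ht2 : ¬ frontCoeff D V a t₂ = 0 → t₂ = 1 ∨ (t₂ = 2 ∧ ¬ Undoped D (a + 2)) := by
      intro hc
      have h0 : t₂ ≠ 0 := by rintro rfl; exact hc q2.1
      have h3 : t₂ ≠ 3 := by rintro rfl; exact hc q2.2
      by_cases u2 : Undoped D (a + 2)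
      · left
        by_contra h1
        have : t₂ = 2 := by omega
        subst this
        exact hc (by simp [frontCoeff, u2])
      · have : t₂ = 1 ∨ t₂ = 2 := by omega
        exact this.imp id fun h => ⟨h, u2⟩
    by_cases u0 : Undoped D a
    · rw [if_pos u0] at hc
      obtain ⟨ht, hc⟩ := ite_ne_right_iff.mp hc
      obtain ⟨rfl, rfl⟩ := ht
      rcases ht2 hc with rfl | ⟨rfl, u2⟩
      · simp [u1, u0, ha, solWeight, hcard]; exact ⟨hz, rfl⟩
      · simp [u1, u0, u2, ha, solWeight, hcard]; exact ⟨hz, rfl⟩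
    · have u2 : Undoped D (a + 2) := by
        have := ((hD a).2.resolve_left u0).resolve_left u1
        exact this
      rw [if_neg u0] at hc
      obtain ⟨ht, hc⟩ := ite_ne_right_iff.mp hc
      obtain ⟨rfl, rfl⟩ := ht
      rcases ht2 hc with rfl | ⟨rfl, u2'⟩
      · simp [u1, u0, u2, ha, solWeight, hcard]; exact ⟨hz, rfl⟩
      · exact absurd u2 u2'

/-! ### Strings off the soliton -/

/-- A string that has left the soliton at `b` for at most `t` periods. -/
def Off (D : Finset (ZMod N)) (t : ℕ) (b : ℤ) (S : PauliString N) : Prop :=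
  (Compact N b (lift S) ∧ ¬ Passing (Undoped D) b (lift S)) ∨
    ∃ ℓ r, Spread N ℓ r (lift S) ∧ ℓ < r ∧ r - ℓ ≤ 5 + 4 * t

theorem MainLabels.passing {U : ℤ → Prop} (hU : LinePattern U) {a : ℤ} {s : ℤ → Fin 4}
    (h : MainLabels U a s) : Passing U a s := by
  obtain ⟨m1, m2, m3, m4⟩ := h
  have h0 := hU a
  refine ⟨fun h => (m1 h).2, fun h => ?_, fun h1 h2 => ?_⟩
  · have h1 : ¬ U (a + 1) := fun h1 => (hU (a + 1)).1 h1 (by rwa [add_assoc])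
    by_cases u0 : U a
    · exact (m3 u0 h).2
    · exact (m2 h1 u0).2
  · have u0 : U a := h0.2.resolve_right (not_or.mpr ⟨h1, h2⟩)
    exact .inl (m4 u0 h2).2.1

/-- A left end is even while the window `[b, b + 2]` has odd ends, so the left end of a spreading
string in the window would be `b + 1`, leaving `b` outside its support. The bound on `t` keeps both
ends in one copy of the window. Thus the emitted strings can never cancel the soliton. -/
theorem Off.not_main (hN : Even N) (hD : LinePattern (Undoped D)) {t : ℕ} (ht : 4 * t + 10 ≤ N) {b : ℤ}
    {S : PauliString N} (h : Off D t b S) (hc : Compact N b (lift S))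
    (hm : MainLabels (Undoped D) b (lift S)) : False := by
  rcases h with ⟨-, h⟩ | ⟨ℓ, r, ⟨h1, h2, h3, h4, h7⟩, h5, h6⟩
  · exact h (hm.passing hD)
  · obtain ⟨c1, c0, -, c2, -⟩ := hc
    have hN0 : (0 : ℤ) < N := by omega
    have key (i : ℤ) (hi : lift S i ≠ 0) : ∃ q : ℤ, ∃ e : ℤ, 0 ≤ e ∧ e ≤ 2 ∧ i = b + e + N * q := by
      refine ⟨(i - b) / N, (i - b) % N, Int.emod_nonneg _ hN0.ne', ?_, ?_⟩
      · by_contra hgt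
        have hz := c2 (b + (i - b) % N) (by omega) (by have := Int.emod_lt_of_pos (i - b) hN0; omega)
        refine hi ?_
        have e : ((i : ℤ) : ZMod N) = ((b + (i - b) % N : ℤ) : ZMod N) := by
          rw [ZMod.intCast_eq_intCast_iff, Int.modEq_iff_dvd]
          exact ⟨-((i - b) / N), by have := Int.emod_add_mul_ediv (i - b) N; linarith⟩
        rw [lift] at hz ⊢
        rw [e, hz]
      · have := Int.emod_add_mul_ediv (i - b) N; linarith
    obtain ⟨q, e, he, he', rfl⟩ := key _ h3
    obtain ⟨q', e', hf, hf', rfl⟩ := key _ h4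
    have hq : q' - q = 0 := by
      have h9 : N * (q' - q) < N * 1 := by ring_nf at h6 h5 ⊢; omega
      have h8 : N * (-1) < N * (q' - q) := by ring_nf at h6 h5 ⊢; omega
      have := lt_of_mul_lt_mul_left h9 hN0.le
      have := lt_of_mul_lt_mul_left h8 hN0.le
      omega
    have : q' = q := by omega
    subst this
    have hpar : (N * q' : ℤ) % 2 = 0 := by
      have : (2 : ℤ) ∣ N := by exact_mod_cast hN.two_dvd
      exact Int.emod_eq_zero_of_dvd (this.mul_right _)
    have hz := h7 (b + N * q' + N) (by omega) (by omega)
    refine c0 ?_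
    simpa [lift] using hz

end Soliton

/-! ### The soliton winding round the ring -/

section Soliton

variable {N : ℕ} [NeZero N] {D : Finset (ZMod N)} {V : Fin 2 → ZMod N → Gate} {γ : ℝ}

theorem cutMatrix_ne_zero (hN : Even N) {S' S : PauliString N} (h : cutMatrix 3 γ D V S' S ≠ 0) :
    LineStep (Undoped D) (lift S) (lift S') ∧ Light N (lift S) ∧ Light N (lift S') := by
  rw [cutMatrix, Matrix.mul_diagonal, Matrix.diagonal_mul] at h
  have h1 := right_ne_zero_of_mul h
  have h2 := left_ne_zero_of_mul (left_ne_zero_of_mul h)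
  have h3 := right_ne_zero_of_mul (left_ne_zero_of_mul h)
  refine ⟨lineStep_of_coreMatrix_ne_zero hN h3, light_lift ?_, light_lift ?_⟩
  · by_contra hgt; exact h1 (if_neg hgt)
  · by_contra hgt; exact h2 (if_neg hgt)

theorem emod_two_of_even (hN : Even N) : (N : ℤ) % 2 = 0 := by
  obtain ⟨m, rfl⟩ := hN; omega

theorem Off.next (hD : LinePattern (Undoped D)) (hN : Even N) {t : ℕ} (ht : 4 * t + 20 ≤ N)
    {b : ℤ} {S S' : PauliString N} (h : Off D t b S) (hst : LineStep (Undoped D) (lift S) (lift S')) :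
    Off D (t + 1) (b + 2) S' := by
  have hn := emod_two_of_even hN
  rcases h with ⟨h, hp⟩ | ⟨ℓ, r, h, hlt, hle⟩
  · rcases h.step hst hn (by omega) (lift_add_period S) (lift_add_period S') with h' | h' | h'
    · exact absurd (h.passing hD hst hn (by omega) (lift_add_period S) (lift_add_period S') h') hp
    · exact .inr ⟨_, _, h', by omega, by push_cast; omega⟩
    · exact .inr ⟨_, _, h', by omega, by push_cast; omega⟩
  · exact .inr ⟨_, _, h.step hst hn (lift_add_period S) (lift_add_period S') (by omega),
      by omega, by push_cast; omega⟩

/-- The six periods: at most one in which a compact string that cannot pass turns into a spreading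
one, and five in which a spreading string outgrows weight 3. -/
theorem Off.dies (hD : LinePattern (Undoped D)) (hN : Even N) (h60 : 60 ≤ N)
    {b : ℤ} {c : ℕ → PauliString N} (h : Off D 0 b (c 0))
    (hc : ∀ j < 6, cutMatrix 3 γ D V (c (j + 1)) (c j) ≠ 0) : False := by
  have hn := emod_two_of_even hN
  have key : ∀ m, m ≤ 1 → (∃ ℓ r, Spread N ℓ r (lift (c m)) ∧ ℓ < r ∧ r - ℓ ≤ 5) → False := by
    rintro m hm ⟨ℓ, r, hs, hlt, hle⟩
    refine Spread.not_light hD hn (c := fun k => lift (c (m + k))) hs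
      (fun k hk => (cutMatrix_ne_zero hN (hc (m + k) (by omega))).1)
      (fun k _ => lift_add_period _) (fun k hk => ?_) hlt (by omega)
    rcases Nat.eq_zero_or_pos (m + k) with h0 | hpos
    · have := (cutMatrix_ne_zero hN (hc 0 (by omega))).2.1
      simpa [h0] using this
    · obtain ⟨l, hl⟩ : ∃ l, m + k = l + 1 := ⟨m + k - 1, by omega⟩
      have := (cutMatrix_ne_zero hN (hc l (by omega))).2.2
      simpa [hl] using this
  rcases h with ⟨h, hp⟩ | ⟨ℓ, r, h, hlt, hle⟩
  · have hst := (cutMatrix_ne_zero hN (hc 0 (by omega))).1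
    rcases h.step hst hn (by omega) (lift_add_period _) (lift_add_period _) with h' | h' | h'
    · exact hp (h.passing hD hst hn (by omega) (lift_add_period _) (lift_add_period _) h')
    · exact key 1 le_rfl ⟨_, _, h', by omega, by omega⟩
    · exact key 1 le_rfl ⟨_, _, h', by omega, by omega⟩
  · exact key 0 zero_le_one ⟨ℓ, r, h, hlt, by simpa using hle⟩

/-- The amplitude with which the soliton moves from `a` to `a + 2` in one damped period. -/
def dampedAmp (γ : ℝ) (D : Finset (ZMod N)) (V : Fin 2 → ZMod N → Gate) (a : ℤ) : ℂ :=
  damping 3 γ (solWeight D (a + 2)) * amp D V a * damping 3 γ (solWeight D a)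

/-- A successor of a soliton string is compact or spreading. A compact one that can pass has soliton
labels, where the amplitude is exact and the difference vanishes. -/
theorem cutMatrix_mulVec_solVec (hD : LinePattern (Undoped D)) (hN : Even N) (h60 : 60 ≤ N)
    {a : ℤ} (ha : a % 2 = 1) {S : PauliString N}
    (h : (cutMatrix 3 γ D V).mulVec (solVec D V a) S - dampedAmp γ D V a * solVec D V (a + 2) S ≠ 0) :
    Off D 0 (a + 2) S := by
  have hn := emod_two_of_even hN
  have e : (cutMatrix 3 γ D V).mulVec (solVec D V a) S = damping 3 γ (weight S) *
      (coreMatrix D V).mulVec (solVec D V a) S * damping 3 γ (solWeight D a) := by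
    have hd : (Matrix.diagonal fun S => damping 3 γ (weight S)).mulVec (solVec D V a) =
        damping 3 γ (solWeight D a) • solVec D V a := by
      funext T
      rw [Matrix.mulVec_diagonal, Pi.smul_apply, smul_eq_mul]
      by_cases hT : solVec D V a T = 0
      · simp [hT]
      · rw [(solVec_support (by omega) hD ha hT).2.2]
    rw [cutMatrix, ← Matrix.mulVec_mulVec, hd, ← Matrix.mulVec_mulVec, Matrix.mulVec_diagonal,
      Matrix.mulVec_smul, Pi.smul_apply, smul_eq_mul]
    ring
  have main (hc : Compact N (a + 2) (lift S)) (hm : MainLabels (Undoped D) (a + 2) (lift S)) :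
      False := by
    refine h ?_
    rw [e, coreMatrix_mulVec_solVec hN (by omega) hD V hc hm, dampedAmp]
    by_cases hT : solVec D V (a + 2) S = 0
    · simp [hT]
    · rw [(solVec_support (by omega) hD (by omega) hT).2.2]
      ring
  by_cases hT : solVec D V (a + 2) S = 0
  · rw [hT, mul_zero, sub_zero, Matrix.mulVec, dotProduct] at h
    obtain ⟨T, -, hne⟩ := Finset.exists_ne_zero_of_sum_ne_zero h
    have hst := (cutMatrix_ne_zero hN (left_ne_zero_of_mul hne)).1
    obtain ⟨hc, hm, -⟩ := solVec_support (by omega) hD ha (right_ne_zero_of_mul hne)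
    rcases hc.step hst hn (by omega) (lift_add_period _) (lift_add_period _) with h' | h' | h'
    · refine .inl ⟨h', fun hp => ?_⟩
      exact main h' (hm.next hD hc hst hn (by omega) (lift_add_period _) (lift_add_period _) h' hp)
    · exact .inr ⟨_, _, h', by omega, by push_cast; omega⟩
    · exact .inr ⟨_, _, h', by omega, by push_cast; omega⟩
  · obtain ⟨hc, hm, -⟩ := solVec_support (by omega) hD (by omega) hT
    exact (main hc hm).elim

/-- Each period adds an error that the sixth power annihilates, and the propagator preserves that
kernel, so this holds for all `k`. The location of the error is tracked for six periods only, just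
enough to show that the sixth power does not annihilate the soliton. -/
theorem cutMatrix_pow_mulVec_solVec (hD : LinePattern (Undoped D)) (hN : Even N) (h60 : 60 ≤ N)
    {a : ℤ} (ha : a % 2 = 1) (k : ℕ) :
    ∃ f : PauliString N → ℂ, ((cutMatrix 3 γ D V) ^ k).mulVec (solVec D V a) =
      (∏ j ∈ Finset.range k, dampedAmp γ D V (a + 2 * j)) • solVec D V (a + 2 * k) + f ∧
      ((cutMatrix 3 γ D V) ^ 6).mulVec f = 0 ∧
      (k ≤ 6 → ∀ S, f S ≠ 0 → Off D k (a + 2 * k) S) := by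
  induction k with
  | zero => exact ⟨0, by simp, by simp, by simp⟩
  | succ k ih =>
    obtain ⟨f, hf, hf6, hoff⟩ := ih
    set M := cutMatrix 3 γ D V with hM
    set p := ∏ j ∈ Finset.range k, dampedAmp γ D V (a + 2 * j) with hp
    set g : PauliString N → ℂ := fun S => M.mulVec (solVec D V (a + 2 * k)) S -
      dampedAmp γ D V (a + 2 * k) * solVec D V (a + 2 * k + 2) S with hg
    have hgoff : ∀ S, g S ≠ 0 → Off D 0 (a + 2 * k + 2) S := fun S hS =>
      cutMatrix_mulVec_solVec hD hN h60 (by omega) hS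
    have e2 : a + 2 * ((k + 1 : ℕ) : ℤ) = a + 2 * k + 2 := by push_cast; ring
    have hg6 : (M ^ 6).mulVec g = 0 := by
      funext S
      by_contra hne
      obtain ⟨c, -, h0, hc⟩ := Matrix.exists_chain_of_pow_mulVec_ne_zero M g 6 hne
      exact (hgoff _ h0).dies hD hN h60 hc
    refine ⟨p • g + M.mulVec f, ?_, ?_, ?_⟩
    · rw [pow_succ', ← Matrix.mulVec_mulVec, hf, Matrix.mulVec_add, Matrix.mulVec_smul,
        Finset.prod_range_succ, e2, ← hp]
      funext S
      simp only [Pi.add_apply, Pi.smul_apply, smul_eq_mul, hg]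
      ring
    · rw [Matrix.mulVec_add, Matrix.mulVec_smul, hg6, Matrix.mulVec_mulVec, ← pow_succ, pow_succ',
        ← Matrix.mulVec_mulVec, hf6]
      simp
    · intro hk S hS
      rw [e2]
      by_cases h1 : g S = 0
      · rw [Pi.add_apply, Pi.smul_apply, h1, smul_zero, zero_add, Matrix.mulVec, dotProduct] at hS
        obtain ⟨T, -, hT⟩ := Finset.exists_ne_zero_of_sum_ne_zero hS
        exact (hoff (by omega) T (right_ne_zero_of_mul hT)).next hD hN (by omega)
          (cutMatrix_ne_zero hN (left_ne_zero_of_mul hT)).1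
      · rcases hgoff S h1 with h | ⟨ℓ, r, h, hlt, hle⟩
        · exact .inl h
        · exact .inr ⟨ℓ, r, h, hlt, by push_cast at hle ⊢; omega⟩

theorem amp_add_period (a : ℤ) : amp D V (a + N) = amp D V a := by
  rw [amp, amp, show a + N + 1 = a + 1 + N by ring, show a + N + 2 = a + 2 + N by ring,
    show a + N + 3 = a + 3 + N by ring, show a + N + 4 = a + 4 + N by ring]
  simp only [elem_add_period, rearCoeff_add_period, frontCoeff_add_period]
  rw [undoped_add_period, undoped_add_period, undoped_add_period, undoped_add_period,
    undoped_add_period]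

theorem exists_solVec_ne_zero (h6 : 6 ≤ N) {a : ℤ} (ha : amp D V a ≠ 0) :
    ∃ S, solVec D V a S ≠ 0 := by
  by_contra! h
  have key (t₀ t₁ t₂ : Fin 4) : solCoeff D V a t₀ t₁ t₂ = 0 := by
    rw [← windowVec_window h6 (a : ZMod N) (solCoeff D V a)]; exact h _
  refine ha ?_
  by_cases u1 : Undoped D (a + 1)
  · have k1 := key 1 0 3
    have k2 := key 2 0 3
    simp only [solCoeff, if_pos u1, and_self, if_true] at k1 k2
    simp [amp, u1, k1, k2]
  · have k1 := key (open Classical in if Undoped D a then 3 else 2) 3 1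
    have k2 := key (open Classical in if Undoped D a then 3 else 2) 3 2
    simp only [solCoeff, if_neg u1, and_self, if_true] at k1 k2
    by_cases u2 : Undoped D (a + 2)
    · simp [frontCoeff, u2] at k1
    · simp [amp, u1, u2, k1, k2]

/-- The soliton winding once around the ring gives an eigenvalue of the truncated propagator. -/
theorem exists_hasEigenvalue_truncatedChannel (hD : LinePattern (Undoped D)) (hN : Even N)
    (h60 : 60 ≤ N) (h : ∀ j : ℕ, amp D V (1 + 2 * j) ≠ 0) :
    ∃ μ : ℂ, μ ^ (N / 2) = ∏ j ∈ Finset.range (N / 2), dampedAmp γ D V (1 + 2 * j) ∧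
      Module.End.HasEigenvalue (truncatedChannel 3 γ D V) μ := by
  have hβ (j : ℕ) : dampedAmp γ D V (1 + 2 * j) ≠ 0 := by
    have hw (b : ℤ) : damping 3 γ (solWeight D b) ≠ 0 := by
      have : solWeight D b ≤ 3 := by unfold solWeight; split_ifs <;> norm_num
      rw [damping, if_pos this]
      exact_mod_cast (Real.exp_pos _).ne'
    exact mul_ne_zero (mul_ne_zero (hw _) (h j)) (hw _)
  set M := cutMatrix 3 γ D V with hM
  -- Six preliminary periods remove all errors: on `u` the power `N / 2` acts exactly as a scalar.
  set u := (M ^ 6).mulVec (solVec D V 1) with hu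
  have hu0 : u ≠ 0 := by
    obtain ⟨f, hf, -, hoff⟩ := cutMatrix_pow_mulVec_solVec (V := V) (γ := γ) hD hN h60 (a := 1)
      (by norm_num) 6
    obtain ⟨S, hS⟩ := exists_solVec_ne_zero (by omega) (h 6)
    intro h0
    have h1 := congrFun (hf.symm.trans h0) S
    obtain ⟨hc, hm, -⟩ := solVec_support (by omega) hD (by norm_num) hS
    have hfS : f S = 0 := by
      by_contra hne
      exact (hoff le_rfl S hne).not_main hN hD (by omega) hc hm
    rw [Pi.add_apply, hfS, add_zero, Pi.smul_apply, Pi.zero_apply] at h1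
    exact smul_ne_zero (Finset.prod_ne_zero_iff.mpr fun j _ => hβ _) hS h1
  have hn2 : 2 * ((N / 2 : ℕ) : ℤ) = N := by
    obtain ⟨m, hm⟩ := hN.two_dvd; omega
  have hpow : (M ^ (N / 2)).mulVec u =
      (∏ j ∈ Finset.range (N / 2), dampedAmp γ D V (1 + 2 * j)) • u := by
    obtain ⟨f, hf, hf6, -⟩ := cutMatrix_pow_mulVec_solVec (V := V) (γ := γ) hD hN h60 (a := 1)
      (by norm_num) (N / 2)
    rw [hu, Matrix.mulVec_mulVec, ← pow_add, add_comm, pow_add, ← Matrix.mulVec_mulVec, hf,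
      Matrix.mulVec_add, hf6, add_zero, Matrix.mulVec_smul, hn2, solVec_add_period]
  obtain ⟨μ, hμ, c, hc, hcμ⟩ := Matrix.exists_eigenvalue_of_pow_mulVec M (by omega) hu0 hpow
  refine ⟨μ, hμ, hasEigenvalue_truncatedChannel hN ?_ hc hcμ⟩
  rintro rfl
  rw [zero_pow (by omega)] at hμ
  exact Finset.prod_ne_zero_iff.mpr (fun j _ => hβ _) hμ.symm

end Soliton

/-! ### The uniform law on `[-1, 1]` -/

/-- The uniform probability measure on `[-1, 1]`. -/
def uniformLaw : Measure ℝ := (2⁻¹ : ENNReal) • volume.restrict (Set.Icc (-1) 1)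

instance : IsProbabilityMeasure uniformLaw := by
  constructor
  rw [uniformLaw, Measure.smul_apply, Measure.restrict_apply_univ, Real.volume_Icc, smul_eq_mul]
  norm_num
  exact ENNReal.inv_mul_cancel (by norm_num) (by norm_num)

theorem integral_uniformLaw (f : ℝ → ℝ) : ∫ x, f x ∂uniformLaw = 2⁻¹ * ∫ x in (-1 : ℝ)..1, f x := by
  rw [uniformLaw, integral_smul_measure, intervalIntegral.integral_of_le (by norm_num),
    integral_Icc_eq_integral_Ioc]
  simp

theorem ae_uniformLaw : ∀ᵐ x ∂uniformLaw, x ∈ Set.Icc (-1 : ℝ) 1 := by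
  refine Measure.ae_smul_measure ?_ _
  exact ae_restrict_mem measurableSet_Icc

theorem integral_pow_uniformLaw (k : ℕ) :
    ∫ x, x ^ (2 * k) ∂uniformLaw = 1 / (2 * k + 1) ∧ ∫ x, x ^ (2 * k + 1) ∂uniformLaw = 0 := by
  rw [integral_uniformLaw, integral_uniformLaw, integral_pow, integral_pow]
  constructor
  · rw [Odd.neg_pow ⟨k, rfl⟩]
    push_cast
    field_simp
    norm_num
  · rw [Even.neg_pow ⟨k + 1, by ring⟩]
    simp

theorem integrable_of_abs_le {Ω : Type*} [MeasurableSpace Ω] {μ : Measure Ω} [IsFiniteMeasure μ]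
    {f : Ω → ℝ} (hf : Measurable f) {C : ℝ} (h : ∀ ω, |f ω| ≤ C) : Integrable f μ :=
  Integrable.of_bound hf.aestronglyMeasurable C (ae_of_all _ h)

/-- Probability measures on `[-1, 1]` are determined by their moments. -/
theorem measure_eq_of_moments {μ ν : Measure ℝ} [IsProbabilityMeasure μ] [IsProbabilityMeasure ν]
    (hμ : ∀ᵐ x ∂μ, x ∈ Set.Icc (-1 : ℝ) 1) (hν : ∀ᵐ x ∂ν, x ∈ Set.Icc (-1 : ℝ) 1)
    (h : ∀ n : ℕ, ∫ x, x ^ n ∂μ = ∫ x, x ^ n ∂ν) : μ = ν := by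
  have int {ρ : Measure ℝ} [IsProbabilityMeasure ρ] (hρ : ∀ᵐ x ∂ρ, x ∈ Set.Icc (-1 : ℝ) 1)
      {f : ℝ → ℝ} (hf : Continuous f) : Integrable f ρ := by
    obtain ⟨C, hC⟩ := isCompact_Icc.exists_bound_of_continuousOn (hf.continuousOn (s := Set.Icc (-1) 1))
    exact Integrable.of_bound hf.aestronglyMeasurable C (hρ.mono hC)
  have poly (p : Polynomial ℝ) : ∫ x, p.eval x ∂μ = ∫ x, p.eval x ∂ν := by
    simp only [Polynomial.eval_eq_sum_range]
    rw [integral_finsetSum _ fun i _ => int hμ (by fun_prop),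
      integral_finsetSum _ fun i _ => int hν (by fun_prop)]
    simp only [integral_const_mul, h]
  refine ext_of_forall_integral_eq_of_IsFiniteMeasure fun f => ?_
  refine eq_of_abs_sub_le_all fun ε hε => ?_
  obtain ⟨p, hp⟩ := exists_polynomial_near_of_continuousOn (-1) 1 f f.continuous.continuousOn
    (ε / 2) (by positivity)
  have close {ρ : Measure ℝ} [IsProbabilityMeasure ρ] (hρ : ∀ᵐ x ∂ρ, x ∈ Set.Icc (-1 : ℝ) 1) :
      |∫ x, p.eval x ∂ρ - ∫ x, f x ∂ρ| ≤ ε / 2 := by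
    rw [← integral_sub (int hρ (by fun_prop)) (int hρ f.continuous)]
    have := norm_integral_le_of_norm_le_const (μ := ρ) (C := ε / 2)
      (f := fun x => p.eval x - f x) (hρ.mono fun x hx => (hp x hx).le)
    simpa using this
  have h1 := close hμ
  have h2 := close hν
  rw [poly p] at h1
  rw [abs_le] at *
  constructor <;> linarith [h1.1, h1.2, h2.1, h2.2]

section Sphere

variable {Ω : Type*} [MeasurableSpace Ω] {μ : Measure Ω} [IsProbabilityMeasure μ] {X Y Z : Ω → ℝ}

/-- By invariance, applied to the normalised vector `(1, s)`, the mean of `(X + s Y) ^ (2k + 2)` is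
`(1 + s ^ 2) ^ (k + 1)` times that of `X ^ (2k + 2)`. Both sides are polynomials in `s`; the
identity is the comparison of the coefficients of `s ^ 2`. -/
theorem integral_pow_mul_sq (hX : Measurable X) (hY : Measurable Y) (hX1 : ∀ ω, |X ω| ≤ 1)
    (hY1 : ∀ ω, |Y ω| ≤ 1)
    (h : ∀ c d : ℝ, c ^ 2 + d ^ 2 = 1 → ∀ m : ℕ, ∫ ω, (c * X ω + d * Y ω) ^ m ∂μ = ∫ ω, X ω ^ m ∂μ)
    (k : ℕ) : (2 * k + 1) * ∫ ω, X ω ^ (2 * k) * Y ω ^ 2 ∂μ = ∫ ω, X ω ^ (2 * k + 2) ∂μ := by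
  have int (i j : ℕ) : Integrable (fun ω => X ω ^ i * Y ω ^ j) μ := by
    refine integrable_of_abs_le (by fun_prop) (C := 1) fun ω => ?_
    rw [abs_mul, abs_pow, abs_pow]
    exact mul_le_one₀ (pow_le_one₀ (abs_nonneg _) (hX1 ω)) (by positivity)
      (pow_le_one₀ (abs_nonneg _) (hY1 ω))
  have hom (s : ℝ) : ∫ ω, (s * Y ω + X ω) ^ (2 * k + 2) ∂μ =
      (1 + s ^ 2) ^ (k + 1) * ∫ ω, X ω ^ (2 * k + 2) ∂μ := by
    have hpos : 0 < 1 + s ^ 2 := by positivity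
    set r := Real.sqrt (1 + s ^ 2) with hr
    have hr2 : r ^ 2 = 1 + s ^ 2 := Real.sq_sqrt hpos.le
    have hr0 : r ≠ 0 := (Real.sqrt_pos.mpr hpos).ne'
    rw [← h (1 / r) (s / r) (by field_simp; rw [hr2]) (2 * k + 2), ← hr2, ← pow_mul,
      ← integral_const_mul]
    refine integral_congr_ae (ae_of_all _ fun ω => ?_)
    show (s * Y ω + X ω) ^ (2 * k + 2) = r ^ (2 * (k + 1)) * (1 / r * X ω + s / r * Y ω) ^ (2 * k + 2)
    rw [show 2 * (k + 1) = 2 * k + 2 by ring, ← mul_pow]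
    congr 1
    field_simp
    ring
  set c := ∫ ω, X ω ^ (2 * k + 2) ∂μ with hc
  set P : Polynomial ℝ := ∑ i ∈ Finset.range (2 * k + 2 + 1), Polynomial.monomial i
    (((2 * k + 2).choose i : ℝ) * ∫ ω, X ω ^ (2 * k + 2 - i) * Y ω ^ i ∂μ) with hP
  have hPQ : P = Polynomial.C c * Polynomial.expand ℝ 2 ((1 + Polynomial.X) ^ (k + 1)) := by
    refine Polynomial.funext fun s => ?_
    rw [Polynomial.eval_mul, Polynomial.expand_eval, Polynomial.eval_C, Polynomial.eval_pow,
      Polynomial.eval_add, Polynomial.eval_one, Polynomial.eval_X, mul_comm, ← hom s, hP,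
      Polynomial.eval_finsetSum]
    simp only [add_pow, Polynomial.eval_monomial]
    rw [integral_finsetSum]
    · refine Finset.sum_congr rfl fun i _ => ?_
      rw [mul_right_comm, ← integral_const_mul]
      refine integral_congr_ae (ae_of_all _ fun ω => ?_)
      simp only [mul_pow]
      ring
    · intro i _
      have := (int (2 * k + 2 - i) i).const_mul (s ^ i * ((2 * k + 2).choose i : ℝ))
      refine this.congr (ae_of_all _ fun ω => ?_)
      simp only [mul_pow]
      ring
  have hcoef := congrArg (fun p => Polynomial.coeff p 2) hPQ
  simp only [hP, Polynomial.finsetSum_coeff, Polynomial.coeff_monomial, Polynomial.coeff_C_mul,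
    Finset.sum_ite_eq', Finset.mem_range] at hcoef
  rw [if_pos (by omega), Polynomial.coeff_expand (by norm_num), if_pos (dvd_refl 2),
    Nat.div_self (by norm_num), Polynomial.coeff_one_add_X_pow, Nat.choose_one_right,
    show 2 * k + 2 - 2 = 2 * k by omega, Nat.cast_choose_two] at hcoef
  push_cast at hcoef
  have hk : (k : ℝ) + 1 ≠ 0 := by positivity
  have : ((k : ℝ) + 1) * ((2 * k + 1) * ∫ ω, X ω ^ (2 * k) * Y ω ^ 2 ∂μ) = ((k : ℝ) + 1) * c := by
    linear_combination hcoef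
  exact mul_left_cancel₀ hk this

/-- A coordinate of a vector on the sphere with rotation-invariant law is uniformly distributed. -/
theorem map_eq_uniformLaw (hX : Measurable X) (hY : Measurable Y) (hZ : Measurable Z)
    (hs : ∀ ω, X ω ^ 2 + Y ω ^ 2 + Z ω ^ 2 = 1)
    (hXY : ∀ c d : ℝ, c ^ 2 + d ^ 2 = 1 → ∀ m : ℕ,
      ∫ ω, (c * X ω + d * Y ω) ^ m ∂μ = ∫ ω, X ω ^ m ∂μ)
    (hXZ : ∀ c d : ℝ, c ^ 2 + d ^ 2 = 1 → ∀ m : ℕ,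
      ∫ ω, (c * X ω + d * Z ω) ^ m ∂μ = ∫ ω, X ω ^ m ∂μ) :
    μ.map X = uniformLaw := by
  have hX1 ω : |X ω| ≤ 1 := abs_le_one_iff_mul_self_le_one.mpr (by nlinarith [hs ω, sq_nonneg (Y ω), sq_nonneg (Z ω)])
  have hY1 ω : |Y ω| ≤ 1 := abs_le_one_iff_mul_self_le_one.mpr (by nlinarith [hs ω, sq_nonneg (X ω), sq_nonneg (Z ω)])
  have hZ1 ω : |Z ω| ≤ 1 := abs_le_one_iff_mul_self_le_one.mpr (by nlinarith [hs ω, sq_nonneg (Y ω), sq_nonneg (X ω)])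
  have int {T : Ω → ℝ} (hT : Measurable T) (hT1 : ∀ ω, |T ω| ≤ 1) (i j : ℕ) :
      Integrable (fun ω => X ω ^ i * T ω ^ j) μ := by
    refine integrable_of_abs_le (by fun_prop) (C := 1) fun ω => ?_
    rw [abs_mul, abs_pow, abs_pow]
    exact mul_le_one₀ (pow_le_one₀ (abs_nonneg _) (hX1 ω)) (by positivity)
      (pow_le_one₀ (abs_nonneg _) (hT1 ω))
  -- Multiplying `X² + Y² + Z² = 1` by `X ^ (2k)` and integrating gives the recursion `E X ^ (2k) =
  -- (1 + 2 / (2k + 1)) E X ^ (2k + 2)`.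
  have even (k : ℕ) : ∫ ω, X ω ^ (2 * k) ∂μ = 1 / (2 * k + 1) := by
    induction k with
    | zero => simp
    | succ k ih =>
      have hy := integral_pow_mul_sq hX hY hX1 hY1 hXY k
      have hz := integral_pow_mul_sq hX hZ hX1 hZ1 hXZ k
      have hsum : ∫ ω, X ω ^ (2 * k) ∂μ = ∫ ω, X ω ^ (2 * k + 2) ∂μ +
          ∫ ω, X ω ^ (2 * k) * Y ω ^ 2 ∂μ + ∫ ω, X ω ^ (2 * k) * Z ω ^ 2 ∂μ := by
        have h2 : Integrable (fun ω => X ω ^ (2 * k + 2)) μ := by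
          simpa using int hY hY1 (2 * k + 2) 0
        have h4 : Integrable (fun ω => X ω ^ (2 * k + 2) + X ω ^ (2 * k) * Y ω ^ 2) μ :=
          h2.add (int hY hY1 _ _)
        rw [← integral_add h2 (int hY hY1 _ _), ← integral_add h4 (int hZ hZ1 _ _)]
        refine integral_congr_ae (ae_of_all _ fun ω => ?_)
        have := hs ω
        simp only
        linear_combination (-(X ω ^ (2 * k))) * this
      rw [ih] at hsum
      rw [show 2 * (k + 1) = 2 * k + 2 by ring]
      push_cast
      have h1 : (2 * k + 1 : ℝ) ≠ 0 := by positivity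
      have h3 : (2 * (k + 1) + 1 : ℝ) ≠ 0 := by positivity
      rw [eq_div_iff h3]
      rw [div_eq_iff h1] at hsum
      linear_combination -hsum - hy - hz
  have := Measure.isProbabilityMeasure_map (μ := μ) hX.aemeasurable
  refine measure_eq_of_moments ?_ ae_uniformLaw fun n => ?_
  · exact (ae_map_iff hX.aemeasurable (p := fun x => x ∈ Set.Icc (-1 : ℝ) 1)
      measurableSet_Icc).mpr (ae_of_all _ fun ω => abs_le.mp (hX1 ω))
  · rw [integral_map hX.aemeasurable (by fun_prop)]
    rcases Nat.even_or_odd' n with ⟨k, rfl | rfl⟩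
    · rw [even k, (integral_pow_uniformLaw k).1]
    · rw [(integral_pow_uniformLaw k).2]
      have := hXY (-1) 0 (by norm_num) (2 * k + 1)
      simp only [zero_mul, add_zero, neg_one_mul, Odd.neg_pow ⟨k, rfl⟩, integral_neg] at this
      linarith

end Sphere

/-! ### The Bloch rotation of a gate -/

/-- The matrix elements of the rotation of the Bloch sphere. -/
def bloch (V : Matrix (Fin 2) (Fin 2) ℂ) (p q : Fin 4) : ℝ := (transfer V p q).re

theorem conjTranspose_pauli (p : Fin 4) : (pauli p).conjTranspose = pauli p := by
  ext i j
  fin_cases p <;> fin_cases i <;> fin_cases j <;>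
    simp [pauli, Matrix.conjTranspose_apply]

theorem transfer_conjTranspose (V : Matrix (Fin 2) (Fin 2) ℂ) (p q : Fin 4) :
    transfer V.conjTranspose p q = transfer V q p := by
  rw [transfer, transfer, Matrix.conjTranspose_conjTranspose, Matrix.mul_assoc, Matrix.mul_assoc,
    Matrix.trace_mul_comm, Matrix.mul_assoc, Matrix.trace_mul_comm]

theorem transfer_eq_bloch (V : Matrix (Fin 2) (Fin 2) ℂ) (p q : Fin 4) :
    transfer V p q = (bloch V p q : ℂ) := by
  have h : star (transfer V p q) = transfer V p q := by
    rw [transfer, star_div₀, ← Matrix.trace_conjTranspose]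
    simp only [Matrix.conjTranspose_mul, Matrix.conjTranspose_conjTranspose, conjTranspose_pauli]
    rw [← Matrix.mul_assoc, ← Matrix.mul_assoc, Matrix.trace_mul_comm]
    simp [Matrix.mul_assoc]
  exact (Complex.conj_eq_iff_re.mp h).symm

theorem transfer_mul (A B : Matrix (Fin 2) (Fin 2) ℂ) (p q : Fin 4) :
    transfer (A * B) p q = ∑ r, transfer A p r * transfer B r q := by
  have h : A * B * pauli q * (A * B).conjTranspose =
      ∑ r, transfer B r q • (A * pauli r * A.conjTranspose) := by
    have := conj_pauli_eq_sum_transfer B q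
    rw [Matrix.conjTranspose_mul]
    calc A * B * pauli q * (B.conjTranspose * A.conjTranspose)
        = A * (B * pauli q * B.conjTranspose) * A.conjTranspose := by simp only [Matrix.mul_assoc]
      _ = _ := by
        rw [this, Matrix.mul_sum, Matrix.sum_mul]
        simp only [Matrix.mul_smul, Matrix.smul_mul]
  have e : transfer (A * B) p q =
      (pauli p * (A * B * pauli q * (A * B).conjTranspose)).trace / 2 := by
    simp only [transfer, Matrix.mul_assoc]
  rw [e, h, Matrix.mul_sum, Matrix.trace_sum, Finset.sum_div]
  refine Finset.sum_congr rfl fun r _ => ?_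
  have h2 : (pauli p * (A * pauli r * A.conjTranspose)).trace = 2 * transfer A p r := by
    rw [transfer]
    simp only [Matrix.mul_assoc]
    ring
  rw [Matrix.mul_smul, Matrix.trace_smul, h2, smul_eq_mul]
  ring

theorem bloch_mul (A B : Matrix (Fin 2) (Fin 2) ℂ) (p q : Fin 4) :
    bloch (A * B) p q = ∑ r, bloch A p r * bloch B r q := by
  have := transfer_mul A B p q
  simp only [transfer_eq_bloch] at this
  exact_mod_cast this

theorem bloch_zero_left (V : Gate) (q : Fin 4) : bloch V 0 q = if q = 0 then 1 else 0 := by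
  rw [bloch, transfer_zero_left]; split_ifs <;> simp

/-- Conjugate transposition of the gate transposes its real Bloch matrix, so unitarity turns into
orthogonality. -/
theorem sum_bloch_mul_bloch (V : Gate) (q q' : Fin 4) :
    ∑ p, bloch V p q * bloch V p q' = if q = q' then 1 else 0 := by
  have h : (V : Matrix (Fin 2) (Fin 2) ℂ).conjTranspose * (V : Matrix (Fin 2) (Fin 2) ℂ) = 1 :=
    Matrix.mem_unitaryGroup_iff'.mp V.2
  have e := bloch_mul (V : Matrix (Fin 2) (Fin 2) ℂ).conjTranspose V q q'
  rw [h] at e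
  simp only [bloch, transfer_conjTranspose] at e ⊢
  rw [← e, transfer_one]
  split_ifs <;> simp

theorem continuous_bloch (p q : Fin 4) : Continuous fun V : Gate => bloch V p q := by
  unfold bloch transfer
  have : Continuous fun V : Gate => (V : Matrix (Fin 2) (Fin 2) ℂ) := continuous_subtype_val
  fun_prop

/-- The half turn about an axis of the Bloch sphere. -/
def halfTurn (x y z : ℝ) : Matrix (Fin 2) (Fin 2) ℂ :=
  !![(z : ℂ), x - y * Complex.I; x + y * Complex.I, -z]

theorem halfTurn_mem (x y z : ℝ) (h : x ^ 2 + y ^ 2 + z ^ 2 = 1) :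
    halfTurn x y z ∈ Matrix.unitaryGroup (Fin 2) ℂ := by
  have hc : (x : ℂ) ^ 2 + (y : ℂ) ^ 2 + (z : ℂ) ^ 2 = 1 := by exact_mod_cast h
  rw [Matrix.mem_unitaryGroup_iff, Matrix.star_eq_conjTranspose]
  ext i j
  fin_cases i <;> fin_cases j <;>
    simp [halfTurn, Matrix.mul_apply, Fin.sum_univ_two] <;>
    first | ring1 | linear_combination hc - (y : ℂ) ^ 2 * Complex.I_sq

theorem conjTranspose_halfTurn (x y z : ℝ) : (halfTurn x y z).conjTranspose = halfTurn x y z := by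
  ext i j
  fin_cases i <;> fin_cases j <;> simp [halfTurn, Matrix.conjTranspose_apply]
  ring

theorem bloch_halfTurn (x y z : ℝ) (p r : Fin 4) (hp : p ≠ 0) (hr : r ≠ 0) :
    bloch (halfTurn x y z) p r = 2 * (![0, x, y, z] : Fin 4 → ℝ) p * (![0, x, y, z] : Fin 4 → ℝ) r -
      if p = r then x ^ 2 + y ^ 2 + z ^ 2 else 0 := by
  rw [bloch, transfer, conjTranspose_halfTurn]
  fin_cases p <;> fin_cases r <;> simp_all [halfTurn, pauli, Matrix.trace,
    Fin.sum_univ_two] <;> ring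

/-! ### The law of the rotated Bloch vector -/

instance : IsProbabilityMeasure haarGate := by
  constructor
  exact Measure.haarMeasure_self (K₀ := (⊤ : TopologicalSpace.PositiveCompacts Gate))

instance : haarGate.IsMulLeftInvariant := by
  unfold haarGate; infer_instance

/-- The coordinate `p` of the Bloch vector `w` rotated by a gate. -/
def rotated (w : Fin 4 → ℝ) (p : Fin 4) (V : Gate) : ℝ := ∑ q, bloch V p q * w q

theorem continuous_rotated (w : Fin 4 → ℝ) (p : Fin 4) : Continuous (rotated w p) := by
  unfold rotated
  exact continuous_finsetSum _ fun q _ => (continuous_bloch p q).mul continuous_const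

theorem rotated_mul (w : Fin 4 → ℝ) (p : Fin 4) (A B : Gate) :
    rotated w p (A * B) = ∑ r, bloch A p r * rotated w r B := by
  simp only [rotated, Submonoid.coe_mul, bloch_mul, Finset.sum_mul, Finset.mul_sum, mul_assoc]
  exact Finset.sum_comm

theorem sum_rotated_sq (w : Fin 4 → ℝ) (V : Gate) : ∑ p, rotated w p V ^ 2 = ∑ q, w q ^ 2 := by
  calc ∑ p, rotated w p V ^ 2
      = ∑ q, ∑ q', w q * w q' * ∑ p, bloch V p q * bloch V p q' := by
        simp only [rotated, sq, Finset.sum_mul_sum]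
        simp only [Finset.mul_sum]
        rw [Finset.sum_comm]
        refine Finset.sum_congr rfl fun q _ => ?_
        rw [Finset.sum_comm]
        exact Finset.sum_congr rfl fun q' _ => Finset.sum_congr rfl fun p _ => by ring
    _ = ∑ q, w q ^ 2 := by
        simp only [sum_bloch_mul_bloch, mul_ite, mul_one, mul_zero, Finset.sum_ite_eq,
          Finset.mem_univ, if_true, sq]

theorem rotated_zero {w : Fin 4 → ℝ} (hw : w 0 = 0) (V : Gate) : rotated w 0 V = 0 := by
  simp [rotated, bloch_zero_left, hw]

/-- Left invariance under the half turn about `v = a e_p + b e_r`. Its Bloch matrix is `2 v vᵀ - 1`,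
whose row `p` has entries `2a² - 1` and `2ab` at `p` and `r`; half-angle formulas give every unit
vector `(c, d)` this form. -/
theorem integral_rotated_pow {w : Fin 4 → ℝ} (hw : w 0 = 0) {p r : Fin 4} (hp : p ≠ 0)
    (hr : r ≠ 0) (hpr : p ≠ r) {c d : ℝ} (h : c ^ 2 + d ^ 2 = 1) (m : ℕ) :
    ∫ V, (c * rotated w p V + d * rotated w r V) ^ m ∂haarGate =
      ∫ V, rotated w p V ^ m ∂haarGate := by
  obtain ⟨a, b, hab, h1, h2⟩ : ∃ a b : ℝ, a ^ 2 + b ^ 2 = 1 ∧ 2 * a ^ 2 - 1 = c ∧ 2 * a * b = d := by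
    rcases eq_or_ne c (-1) with rfl | hc
    · exact ⟨0, 1, by norm_num, by norm_num, by
        have : d ^ 2 = 0 := by linarith
        rw [pow_eq_zero_iff (by norm_num)] at this
        rw [this]; ring⟩
    · have hc1 : 0 < 1 + c := by
        have : -1 ≤ c := by nlinarith [sq_nonneg d]
        have := lt_of_le_of_ne this (Ne.symm hc)
        linarith
      set a := Real.sqrt ((1 + c) / 2) with ha
      have ha2 : a ^ 2 = (1 + c) / 2 := Real.sq_sqrt (by positivity)
      have ha0 : a ≠ 0 := (Real.sqrt_pos.mpr (by positivity)).ne'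
      refine ⟨a, d / (2 * a), ?_, by rw [ha2]; ring, by field_simp⟩
      rw [div_pow, mul_pow, ha2]
      field_simp
      linarith
  set v : Fin 4 → ℝ := fun i => (if i = p then a else 0) + if i = r then b else 0 with hv
  have hv2 : v 1 ^ 2 + v 2 ^ 2 + v 3 ^ 2 = 1 := by
    fin_cases p <;> fin_cases r <;> simp_all <;> linarith
  have hv0 : v 0 = 0 := by simp [hv, hp.symm, hr.symm]
  have hvv : (![0, v 1, v 2, v 3] : Fin 4 → ℝ) = v := by
    funext i; fin_cases i <;> simp [hv0]
  set H : Gate := ⟨halfTurn (v 1) (v 2) (v 3), halfTurn_mem _ _ _ hv2⟩ with hH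
  rw [← integral_mul_left_eq_self (fun V => rotated w p V ^ m) H]
  refine integral_congr_ae (ae_of_all _ fun V => ?_)
  simp only
  congr 1
  rw [rotated_mul]
  have hb (s : Fin 4) (hs : s ≠ 0) : bloch H p s = 2 * v p * v s - if p = s then 1 else 0 := by
    rw [hH, bloch_halfTurn _ _ _ _ _ hp hs, hvv, hv2]
  have key : ∀ s, bloch H p s * rotated w s V =
      (2 * v p * v s - if p = s then 1 else 0) * rotated w s V := by
    intro s
    rcases eq_or_ne s 0 with rfl | hs
    · rw [rotated_zero hw]; simp
    · rw [hb s hs]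
  simp only [key]
  have hvp : v p = a := by simp [hv, hpr]
  simp only [sub_mul, Finset.sum_sub_distrib, ite_mul, one_mul, zero_mul, Finset.sum_ite_eq,
    Finset.mem_univ, if_true, hvp]
  simp only [hv, mul_add, add_mul, Finset.sum_add_distrib, mul_ite, mul_zero, ite_mul, zero_mul,
    Finset.sum_ite_eq', Finset.mem_univ, if_true, ← h1, ← h2]
  ring

theorem map_rotated {w : Fin 4 → ℝ} (hw : w 0 = 0) (hw1 : ∑ q, w q ^ 2 = 1) {p : Fin 4}
    (hp : p ≠ 0) : haarGate.map (rotated w p) = uniformLaw := by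
  obtain ⟨r, s, hr, hs, hpr, hps, hrs⟩ : ∃ r s : Fin 4, r ≠ 0 ∧ s ≠ 0 ∧ p ≠ r ∧ p ≠ s ∧ r ≠ s := by
    revert p; decide
  refine map_eq_uniformLaw (Y := rotated w r) (Z := rotated w s)
    (continuous_rotated w p).measurable (continuous_rotated w r).measurable
    (continuous_rotated w s).measurable (fun V => ?_)
    (fun c d h m => integral_rotated_pow hw hp hr hpr h m)
    (fun c d h m => integral_rotated_pow hw hp hs hps h m)
  have h := sum_rotated_sq w V
  rw [hw1, Fin.sum_univ_four, rotated_zero hw] at h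
  revert h
  fin_cases p <;> fin_cases r <;> fin_cases s <;> simp_all <;> intro h <;> linarith

/-! ### Negative moments -/

theorem lintegral_rpow_neg {s : ℝ} (hs : s < 1) :
    ∫⁻ x in Set.Ioc (0 : ℝ) 1, ENNReal.ofReal x ^ (-s) = ENNReal.ofReal (1 / (1 - s)) := by
  have hint : IntegrableOn (fun x : ℝ => x ^ (-s)) (Set.Ioc 0 1) := by
    have := intervalIntegral.intervalIntegrable_rpow' (a := 0) (b := 1) (r := -s) (by linarith)
    rwa [intervalIntegrable_iff_integrableOn_Ioc_of_le zero_le_one] at this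
  have h1 : ∫⁻ x in Set.Ioc (0 : ℝ) 1, ENNReal.ofReal x ^ (-s) =
      ∫⁻ x in Set.Ioc (0 : ℝ) 1, ENNReal.ofReal (x ^ (-s)) :=
    setLIntegral_congr_fun measurableSet_Ioc fun x hx => ENNReal.ofReal_rpow_of_pos hx.1
  rw [h1, ← ofReal_integral_eq_lintegral_ofReal hint
    ((ae_restrict_mem measurableSet_Ioc).mono fun x hx => Real.rpow_nonneg hx.1.le _),
    ← intervalIntegral.integral_of_le zero_le_one, integral_rpow (Or.inl (by linarith))]
  congr 1
  rw [Real.one_rpow, Real.zero_rpow (by linarith)]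
  ring

/-- Integration over `[-1, 1]` of functions bounded by an integral over `[0, 1]` on either side. -/
theorem lintegral_uniformLaw_le {f F : ℝ → ENNReal} (hF : Measurable F) {C : ENNReal}
    (hC : ∫⁻ x in Set.Ioc (0 : ℝ) 1, F x = C) (h : ∀ x, x ∈ Set.Ioc (0 : ℝ) 1 → f x ≤ F x)
    (h' : ∀ x, x ∈ Set.Ioc (0 : ℝ) 1 → f (-x) ≤ F x) : ∫⁻ x, f x ∂uniformLaw ≤ C := by
  set G : ℝ → ENNReal := (Set.Ioc (0 : ℝ) 1).indicator F with hG
  have hGm : Measurable G := hF.indicator measurableSet_Ioc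
  have hGi : ∫⁻ x, G x = C := by rw [hG, lintegral_indicator measurableSet_Ioc, hC]
  have hGn : ∫⁻ x, G (-x) = C := by rw [lintegral_neg_eq_self (fun x => G x), hGi]
  have h0 : ∀ᵐ x ∂(volume.restrict (Set.Icc (-1 : ℝ) 1)), f x ≤ G x + G (-x) := by
    have hne : ∀ᵐ x ∂(volume.restrict (Set.Icc (-1 : ℝ) 1)), x ≠ 0 :=
      ae_restrict_of_ae (Measure.ae_ne volume 0)
    filter_upwards [hne, ae_restrict_mem measurableSet_Icc] with x hx hx'
    rcases lt_or_gt_of_ne hx with hlt | hgt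
    · have hm : -x ∈ Set.Ioc (0 : ℝ) 1 := ⟨by linarith, by linarith [hx'.1]⟩
      refine le_add_left ?_
      rw [hG, Set.indicator_of_mem hm]
      simpa using h' _ hm
    · have hm : x ∈ Set.Ioc (0 : ℝ) 1 := ⟨hgt, hx'.2⟩
      refine le_add_right ?_
      rw [hG, Set.indicator_of_mem hm]
      exact h _ hm
  rw [uniformLaw, lintegral_smul_measure, smul_eq_mul]
  calc 2⁻¹ * ∫⁻ x in Set.Icc (-1 : ℝ) 1, f x
      ≤ 2⁻¹ * ∫⁻ x, (G x + G (-x)) := by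
        exact mul_le_mul_right ((lintegral_mono_ae h0).trans (setLIntegral_le_lintegral _ _)) _
    _ = C := by
        rw [lintegral_add_left hGm, hGi, hGn, ← two_mul, ← mul_assoc,
          ENNReal.inv_mul_cancel (by norm_num) (by norm_num), one_mul]

theorem lintegral_abs_rpow_neg_le {s : ℝ} (hs : s < 1) :
    ∫⁻ x, ENNReal.ofReal |x| ^ (-s) ∂uniformLaw ≤ ENNReal.ofReal (1 / (1 - s)) := by
  refine lintegral_uniformLaw_le (F := fun x => ENNReal.ofReal x ^ (-s)) (by fun_prop)
    (lintegral_rpow_neg hs) (fun x hx => ?_) fun x hx => ?_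
  · rw [abs_of_pos hx.1]
  · rw [abs_neg, abs_of_pos hx.1]

/-- On [0, 1] one has `1 - x² ≥ 1 - x`, and reflecting `x` reduces the bound to the pure power. -/
theorem lintegral_one_sub_sq_rpow_neg_le {s : ℝ} (hs0 : 0 ≤ s) (hs : s < 1) :
    ∫⁻ x, ENNReal.ofReal (1 - x ^ 2) ^ (-s) ∂uniformLaw ≤ ENNReal.ofReal (1 / (1 - s)) := by
  have hm : ∀ x ∈ Set.Ioc (0 : ℝ) 1,
      ENNReal.ofReal (1 - x ^ 2) ^ (-s) ≤ ENNReal.ofReal (1 - x) ^ (-s) := fun x hx => by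
    rw [ENNReal.rpow_neg, ENNReal.rpow_neg]
    gcongr
    nlinarith [hx.1, hx.2]
  refine lintegral_uniformLaw_le (F := fun x => ENNReal.ofReal (1 - x) ^ (-s)) (by fun_prop)
    ?_ hm fun x hx => by rw [neg_sq]; exact hm x hx
  rw [← lintegral_rpow_neg hs, ← lintegral_indicator measurableSet_Ioc,
    ← lintegral_indicator measurableSet_Ioc,
    ← lintegral_sub_left_eq_self (μ := volume) _ (1 : ℝ)]
  refine lintegral_congr_ae ?_
  filter_upwards [Measure.ae_ne volume (0 : ℝ), Measure.ae_ne volume (1 : ℝ)] with x h0 h1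
  by_cases hx : x ∈ Set.Ioc (0 : ℝ) 1
  · have h2 : 1 - x ∈ Set.Ioc (0 : ℝ) 1 :=
      ⟨by have := lt_of_le_of_ne hx.2 h1; linarith, by linarith [hx.1]⟩
    rw [Set.indicator_of_mem hx, Set.indicator_of_mem h2]
    simp
  · have h2 : 1 - x ∉ Set.Ioc (0 : ℝ) 1 := fun h2 => hx
      ⟨lt_of_le_of_ne (by linarith [h2.2]) h0.symm, by linarith [h2.1]⟩
    rw [Set.indicator_of_notMem hx, Set.indicator_of_notMem h2]

/-- By homogeneity `w` may be taken of length 1, where the coordinate is uniform. For `w = 0` the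
right-hand side is infinite. -/
theorem lintegral_rotated_rpow_neg_le {w : Fin 4 → ℝ} (hw : w 0 = 0) {p : Fin 4} (hp : p ≠ 0)
    {t : ℝ} (ht0 : 0 < t) (ht : t < 1) :
    ∫⁻ V, ENNReal.ofReal |rotated w p V| ^ (-t) ∂haarGate ≤
      ENNReal.ofReal (1 / (1 - t)) * ENNReal.ofReal (∑ q, w q ^ 2) ^ (-(t / 2)) := by
  set S := ∑ q, w q ^ 2 with hS
  have hS0 : 0 ≤ S := Finset.sum_nonneg fun q _ => sq_nonneg _
  rcases hS0.eq_or_lt with h0 | hpos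
  · rw [← h0, ENNReal.ofReal_zero, ENNReal.zero_rpow_of_neg (by linarith), ENNReal.mul_top]
    · exact le_top
    · rw [Ne, ENNReal.ofReal_eq_zero, not_le]
      exact one_div_pos.mpr (by linarith)
  · set r := Real.sqrt S with hr
    have hr0 : 0 < r := Real.sqrt_pos.mpr hpos
    have hr2 : r ^ 2 = S := Real.sq_sqrt hS0
    set v : Fin 4 → ℝ := fun q => w q / r with hv
    have hv1 : ∑ q, v q ^ 2 = 1 := by
      simp only [hv, div_pow, ← Finset.sum_div, hr2, ← hS]
      exact div_self hpos.ne'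
    have hwv (V : Gate) : rotated w p V = r * rotated v p V := by
      simp only [rotated, hv, Finset.mul_sum]
      refine Finset.sum_congr rfl fun q _ => ?_
      field_simp
    have hpow : ENNReal.ofReal S ^ (-(t / 2)) = ENNReal.ofReal r ^ (-t) := by
      rw [← hr2, ENNReal.ofReal_pow hr0.le, ← ENNReal.rpow_natCast, ← ENNReal.rpow_mul]
      congr 1
      push_cast
      ring
    have e (V : Gate) : ENNReal.ofReal |rotated w p V| ^ (-t) =
        ENNReal.ofReal |rotated v p V| ^ (-t) * ENNReal.ofReal r ^ (-t) := by
      rw [hwv, abs_mul, abs_of_pos hr0, mul_comm, ENNReal.ofReal_mul (abs_nonneg _),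
        ENNReal.mul_rpow_of_ne_top ENNReal.ofReal_ne_top ENNReal.ofReal_ne_top]
    have hm : Measurable fun x : ℝ => ENNReal.ofReal |x| ^ (-t) := by fun_prop
    simp only [e, hpow]
    have hm' : Measurable fun V : Gate => ENNReal.ofReal |rotated v p V| ^ (-t) :=
      hm.comp (continuous_rotated v p).measurable
    rw [lintegral_mul_const _ hm']
    gcongr
    rw [← lintegral_map (f := fun x => ENNReal.ofReal |x| ^ (-t)) hm
      (continuous_rotated v p).measurable, map_rotated (by simp [hv, hw]) hv1 hp]
    exact lintegral_abs_rpow_neg_le ht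

theorem enorm_ofReal_complex (x : ℝ) : ‖(x : ℂ)‖ₑ = ENNReal.ofReal |x| := by
  rw [← ofReal_norm, Complex.norm_real, Real.norm_eq_abs]

theorem lintegral_transfer_rpow_neg_le {p q : Fin 4} (hp : p ≠ 0) (hq : q ≠ 0)
    {t : ℝ} (ht0 : 0 < t) (ht : t < 1) :
    ∫⁻ V : Gate, ‖transfer V p q‖ₑ ^ (-t) ∂haarGate ≤ ENNReal.ofReal (1 / (1 - t)) := by
  have h := lintegral_rotated_rpow_neg_le (w := Pi.single q 1) (by simp [hq.symm]) hp ht0 ht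
  have e (V : Gate) : rotated (Pi.single q 1) p V = bloch V p q := by
    simp [rotated, Pi.single_apply]
  have e2 : ∑ r, (Pi.single q 1 : Fin 4 → ℝ) r ^ 2 = 1 := by
    simp [Pi.single_apply]
  simpa only [e, e2, transfer_eq_bloch, enorm_ofReal_complex, ENNReal.ofReal_one,
    ENNReal.one_rpow, mul_one] using h

/-- For fixed `W` the sum is a coordinate of the rotated vector with entries `W 2 q` and `W 3 q`.
Orthogonality makes its squared length `1 - (W 1 q)²`, where `W 1 q` is again uniform. -/
theorem lintegral_transfer_pair_rpow_neg_le {p q : Fin 4} (hp : p ≠ 0) (hq : q ≠ 0)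
    {t : ℝ} (ht0 : 0 < t) (ht : t < 1) :
    ∫⁻ W : Gate, ∫⁻ V : Gate,
        ‖transfer V p 1 * transfer W 2 q + transfer V p 2 * transfer W 3 q‖ₑ ^ (-t)
          ∂haarGate ∂haarGate ≤
      ENNReal.ofReal (1 / (1 - t)) * ENNReal.ofReal (1 / (1 - t / 2)) := by
  have inner (W : Gate) : ∫⁻ V : Gate,
        ‖transfer V p 1 * transfer W 2 q + transfer V p 2 * transfer W 3 q‖ₑ ^ (-t) ∂haarGate ≤
      ENNReal.ofReal (1 / (1 - t)) * ENNReal.ofReal (1 - bloch W 1 q ^ 2) ^ (-(t / 2)) := by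
    have h := lintegral_rotated_rpow_neg_le (w := ![0, bloch W 2 q, bloch W 3 q, 0]) rfl hp ht0 ht
    have e (V : Gate) : transfer V p 1 * transfer W 2 q + transfer V p 2 * transfer W 3 q =
        (rotated ![0, bloch W 2 q, bloch W 3 q, 0] p V : ℂ) := by
      simp [rotated, Fin.sum_univ_four, transfer_eq_bloch]
    have e2 : ∑ r, (![0, bloch W 2 q, bloch W 3 q, 0] : Fin 4 → ℝ) r ^ 2 = 1 - bloch W 1 q ^ 2 := by
      have := sum_bloch_mul_bloch W q q
      rw [if_pos rfl, Fin.sum_univ_four, bloch_zero_left, if_neg hq] at this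
      simp only [Fin.sum_univ_four, Matrix.cons_val_zero, Matrix.cons_val_one, Matrix.cons_val]
      linarith
    simpa only [e, e2, enorm_ofReal_complex] using h
  refine (lintegral_mono inner).trans ?_
  have hm : Measurable fun x : ℝ => ENNReal.ofReal (1 - x ^ 2) ^ (-(t / 2)) := by fun_prop
  have hm' : Measurable fun W : Gate => ENNReal.ofReal (1 - bloch W 1 q ^ 2) ^ (-(t / 2)) :=
    hm.comp (continuous_bloch 1 q).measurable
  rw [lintegral_const_mul _ hm']
  gcongr
  have e (V : Gate) : rotated (Pi.single q 1) 1 V = bloch V 1 q := by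
    simp [rotated, Pi.single_apply]
  have hmap := map_rotated (w := Pi.single q 1) (p := 1) (by simp [hq.symm])
    (by simp [Pi.single_apply]) (by decide)
  have := lintegral_one_sub_sq_rpow_neg_le (s := t / 2) (by linarith) (by linarith)
  rw [← hmap, lintegral_map hm (continuous_rotated _ _).measurable] at this
  simpa only [e] using this

/-! ### Functions of disjoint sets of independent coordinates -/

section Independent

variable {ι X : Type*} [Fintype ι] [MeasurableSpace X] {μ : Measure X} [IsProbabilityMeasure μ]

theorem lintegral_mul_of_dependsOn {f g : (ι → X) → ENNReal} (hf : Measurable f)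
    (hg : Measurable g) {S T : Finset ι} (hS : DependsOn f S) (hT : DependsOn g T)
    (hST : Disjoint S T) :
    ∫⁻ x, f x * g x ∂(Measure.pi fun _ => μ) =
      (∫⁻ x, f x ∂(Measure.pi fun _ => μ)) * ∫⁻ x, g x ∂(Measure.pi fun _ => μ) := by
  classical
  obtain ⟨x₀⟩ : Nonempty X := nonempty_of_isProbabilityMeasure μ
  have ind : iIndepFun (fun (i : ι) (x : ι → X) => x i) (Measure.pi fun _ => μ) :=
    iIndepFun_pi (X := fun _ => id) fun _ => aemeasurable_id
  have hind := ind.indepFun_finset S T hST fun i => measurable_pi_apply i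
  have fac {h : (ι → X) → ENNReal} (hh : Measurable h) {R : Finset ι} (hR : DependsOn h R) :
      ∃ φ : (R → X) → ENNReal, Measurable φ ∧ h = φ ∘ fun x (i : R) => x i := by
    refine ⟨fun y => h fun i => if hi : i ∈ R then y ⟨i, hi⟩ else x₀, hh.comp ?_, ?_⟩
    · refine measurable_pi_iff.mpr fun i => ?_
      by_cases hi : i ∈ R
      · simp only [hi, dif_pos]; exact measurable_pi_apply _
      · simp only [hi, dif_neg, not_false_eq_true]; exact measurable_const
    · funext x
      refine hR fun i hi => ?_
      have hi' : i ∈ R := hi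
      simp [hi']
  obtain ⟨φ, hφ, rfl⟩ := fac hf hS
  obtain ⟨ψ, hψ, rfl⟩ := fac hg hT
  exact lintegral_mul_eq_lintegral_mul_lintegral_of_indepFun hf hg (hind.comp hφ hψ)

end Independent

/-! ### Negative moments and the Chernoff bound -/

section NegMoment

variable {ι : Type*} [Fintype ι]

/-- The function `F` of independent Haar-random gates depends only on the gates in `S`, and the
expectation of `-log |F|` is at most `k / 2`, with control of the negative moments of `F`. -/
structure NegMoment (F : (ι → Gate) → ℂ) (S : Finset ι) (k : ℕ) : Prop where
  measurable : Measurable F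
  dependsOn : DependsOn F S
  lintegral_le : ∀ t : ℝ, 0 < t → t ≤ 1 / 2 →
    ∫⁻ W, ‖F W‖ₑ ^ (-t) ∂(Measure.pi fun _ => haarGate) ≤
      ENNReal.ofReal (Real.exp (t * (k / 2) + k * t ^ 2))

theorem NegMoment.one : NegMoment (fun _ : ι → Gate => (1 : ℂ)) ∅ 0 where
  measurable := measurable_const
  dependsOn := fun _ _ _ => rfl
  lintegral_le t _ _ := by simp

theorem NegMoment.mono {F : (ι → Gate) → ℂ} {S T : Finset ι} {k l : ℕ} (h : NegMoment F S k)
    (hST : S ⊆ T) (hkl : k ≤ l) : NegMoment F T l where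
  measurable := h.measurable
  dependsOn := fun x y hxy => h.dependsOn fun i hi => hxy i (hST hi)
  lintegral_le t ht ht' := (h.lintegral_le t ht ht').trans (by gcongr)

theorem NegMoment.mul [DecidableEq ι] {F G : (ι → Gate) → ℂ} {S T : Finset ι} {k l : ℕ}
    (h : NegMoment F S k) (h' : NegMoment G T l) (hST : Disjoint S T) :
    NegMoment (fun W => F W * G W) (S ∪ T) (k + l) where
  measurable := h.measurable.mul h'.measurable
  dependsOn := fun x y hxy => by
    rw [Finset.coe_union] at hxy
    simp only [h.dependsOn fun i hi => hxy i (.inl hi), h'.dependsOn fun i hi => hxy i (.inr hi)]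
  lintegral_le t ht ht' := by
    have hF : Measurable fun W => ‖F W‖ₑ ^ (-t) := h.measurable.enorm.pow_const _
    have hG : Measurable fun W => ‖G W‖ₑ ^ (-t) := h'.measurable.enorm.pow_const _
    simp only [enorm_mul, ENNReal.mul_rpow_of_ne_top enorm_ne_top enorm_ne_top]
    rw [lintegral_mul_of_dependsOn hF hG (fun x y hxy => by simp only [h.dependsOn hxy])
      (fun x y hxy => by simp only [h'.dependsOn hxy]) hST]
    calc _ ≤ ENNReal.ofReal (Real.exp (t * (k / 2) + k * t ^ 2)) *
          ENNReal.ofReal (Real.exp (t * (l / 2) + l * t ^ 2)) :=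
          mul_le_mul' (h.lintegral_le t ht ht') (h'.lintegral_le t ht ht')
      _ = _ := by
          rw [← ENNReal.ofReal_mul (Real.exp_pos _).le, ← Real.exp_add]
          congr 2
          push_cast
          ring

theorem NegMoment.prod [DecidableEq ι] {κ : Type*} (s : Finset κ) {F : κ → (ι → Gate) → ℂ}
    {S : κ → Finset ι} {k : κ → ℕ} (h : ∀ a ∈ s, NegMoment (F a) (S a) (k a))
    (hS : (s : Set κ).PairwiseDisjoint S) :
    NegMoment (fun W => ∏ a ∈ s, F a W) (s.biUnion S) (∑ a ∈ s, k a) := by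
  classical
  induction s using Finset.induction_on with
  | empty => simpa using NegMoment.one
  | insert a s ha ih =>
    have h1 := ih (fun b hb => h b (Finset.mem_insert_of_mem hb))
      (hS.subset (by simp))
    have h2 := (h a (Finset.mem_insert_self a s)).mul h1 (by
      rw [Finset.disjoint_biUnion_right]
      intro b hb
      exact hS (by simp) (by simp [hb]) (by rintro rfl; exact ha hb))
    simpa only [Finset.prod_insert ha, Finset.sum_insert ha, Finset.biUnion_insert] using h2

/-- The source of the range `t ≤ 1 / 2` and of the quadratic term in `NegMoment`. -/
theorem one_div_one_sub_le_exp {t : ℝ} (ht0 : 0 ≤ t) (ht : t ≤ 1 / 2) :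
    1 / (1 - t) ≤ Real.exp (t + t ^ 2) := by
  have h1 : 0 < 1 - t := by linarith
  rw [div_le_iff₀ h1]
  have := Real.quadratic_le_exp_of_nonneg (x := t + t ^ 2) (by positivity)
  nlinarith [mul_le_mul_of_nonneg_right this h1.le, pow_nonneg ht0 3, pow_nonneg ht0 4, pow_nonneg ht0 2,
    mul_nonneg (pow_nonneg ht0 2) (by linarith : 0 ≤ 1 / 2 - t),
    mul_nonneg (pow_nonneg ht0 3) (by linarith : 0 ≤ 1 / 2 - t),
    mul_nonneg (pow_nonneg ht0 4) (by linarith : 0 ≤ 1 / 2 - t)]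

/-- The mean of `-log |x|` for uniform `x` is 1, hence the cost 2 in units of one half. -/
theorem NegMoment.single (i : ι) {p q : Fin 4} (hp : p ≠ 0) (hq : q ≠ 0) :
    NegMoment (fun W : ι → Gate => transfer (W i) p q) {i} 2 where
  measurable := by
    simp only [transfer_eq_bloch]
    exact Complex.measurable_ofReal.comp ((continuous_bloch p q).measurable.comp
      (measurable_pi_apply i))
  dependsOn := fun x y hxy => by simp only [hxy i (by simp)]
  lintegral_le t ht ht' := by
    have hm : Measurable fun V : Gate => ‖transfer V p q‖ₑ ^ (-t) := by
      simp only [transfer_eq_bloch]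
      exact (Complex.measurable_ofReal.comp (continuous_bloch p q).measurable).enorm.pow_const _
    have := (measurePreserving_eval (fun _ : ι => haarGate) i).lintegral_comp hm
    calc _ = _ := this
      _ ≤ _ := lintegral_transfer_rpow_neg_le hp hq ht (by linarith)
      _ ≤ _ := by
        refine ENNReal.ofReal_le_ofReal ((one_div_one_sub_le_exp ht.le ht').trans ?_)
        refine Real.exp_le_exp.mpr ?_
        push_cast
        nlinarith [sq_nonneg t]

/-- Cost 3: a mean of 1 from the uniform coordinate and at most 1/2 from the length of the vector
that is rotated. -/
theorem NegMoment.pair [DecidableEq ι] {i j : ι} (hij : i ≠ j) {p q : Fin 4} (hp : p ≠ 0)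
    (hq : q ≠ 0) :
    NegMoment (fun W : ι → Gate => transfer (W i) p 1 * transfer (W j) 2 q +
      transfer (W i) p 2 * transfer (W j) 3 q) {i, j} 3 where
  measurable := by
    simp only [transfer_eq_bloch]
    have (r s : Fin 4) (l : ι) : Measurable fun W : ι → Gate => ((bloch (W l) r s : ℝ) : ℂ) :=
      Complex.measurable_ofReal.comp ((continuous_bloch r s).measurable.comp
        (measurable_pi_apply l))
    exact ((this _ _ _).mul (this _ _ _)).add ((this _ _ _).mul (this _ _ _))
  dependsOn := fun x y hxy => by simp only [hxy i (by simp), hxy j (by simp)]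
  lintegral_le t ht ht' := by
    have hm : Measurable fun P : Gate × Gate => ‖transfer P.1 p 1 * transfer P.2 2 q +
        transfer P.1 p 2 * transfer P.2 3 q‖ₑ ^ (-t) := by
      simp only [transfer_eq_bloch]
      have h1 (r s : Fin 4) : Measurable fun P : Gate × Gate => ((bloch P.1 r s : ℝ) : ℂ) :=
        Complex.measurable_ofReal.comp ((continuous_bloch r s).measurable.comp measurable_fst)
      have h2 (r s : Fin 4) : Measurable fun P : Gate × Gate => ((bloch P.2 r s : ℝ) : ℂ) :=
        Complex.measurable_ofReal.comp ((continuous_bloch r s).measurable.comp measurable_snd)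
      exact (((h1 _ _).mul (h2 _ _)).add ((h1 _ _).mul (h2 _ _))).enorm.pow_const _
    have ind : iIndepFun (fun (i : ι) (x : ι → Gate) => x i) (Measure.pi fun _ => haarGate) :=
      iIndepFun_pi (X := fun _ => id) fun _ => aemeasurable_id
    have hmap := (indepFun_iff_map_prod_eq_prod_map_map (measurable_pi_apply i).aemeasurable
      (measurable_pi_apply j).aemeasurable).mp (ind.indepFun hij)
    rw [(measurePreserving_eval (fun _ : ι => haarGate) i).map_eq,
      (measurePreserving_eval (fun _ : ι => haarGate) j).map_eq] at hmap
    have h1 := lintegral_map (μ := Measure.pi fun _ : ι => haarGate) hm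
      ((measurable_pi_apply i).prodMk (measurable_pi_apply j))
    rw [hmap, lintegral_prod_symm _ hm.aemeasurable] at h1
    calc _ = _ := h1.symm
      _ ≤ _ := lintegral_transfer_pair_rpow_neg_le hp hq ht (by linarith)
      _ ≤ _ := by
        rw [← ENNReal.ofReal_mul (one_div_nonneg.mpr (by linarith))]
        refine ENNReal.ofReal_le_ofReal ?_
        calc 1 / (1 - t) * (1 / (1 - t / 2)) ≤ Real.exp (t + t ^ 2) * Real.exp (t / 2 + (t / 2) ^ 2) :=
              mul_le_mul (one_div_one_sub_le_exp ht.le ht')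
                (one_div_one_sub_le_exp (by linarith) (by linarith))
                (one_div_nonneg.mpr (by linarith)) (Real.exp_pos _).le
          _ ≤ _ := by
            rw [← Real.exp_add]
            refine Real.exp_le_exp.mpr ?_
            push_cast
            nlinarith [sq_nonneg t]

/-- The Chernoff bound. -/
theorem NegMoment.measure_le {F : (ι → Gate) → ℂ} {S : Finset ι} {k : ℕ} (h : NegMoment F S k)
    {t : ℝ} (ht : 0 < t) (ht' : t ≤ 1 / 2) (δ : ℝ) :
    (Measure.pi fun _ => haarGate) {W | ‖F W‖ < Real.exp (-(k / 2) - δ)} ≤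
      ENNReal.ofReal (Real.exp (k * t ^ 2 - t * δ)) := by
  have hm : Measurable fun W => ‖F W‖ₑ ^ (-t) := h.measurable.enorm.pow_const _
  set c := Real.exp (t * (k / 2 + δ)) with hc
  have hc0 : 0 < c := Real.exp_pos _
  have hsub : {W | ‖F W‖ < Real.exp (-(k / 2) - δ)} ⊆ {W | ENNReal.ofReal c ≤ ‖F W‖ₑ ^ (-t)} := by
    intro W hW
    have hle : ‖F W‖ₑ ≤ ENNReal.ofReal (Real.exp (-(k / 2) - δ)) := by
      rw [← ofReal_norm]
      exact ENNReal.ofReal_le_ofReal (le_of_lt hW)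
    have he : ENNReal.ofReal c = ENNReal.ofReal (Real.exp (-(k / 2) - δ)) ^ (-t) := by
      rw [ENNReal.ofReal_rpow_of_pos (Real.exp_pos _), ← Real.exp_mul, hc]
      congr 2
      ring
    show ENNReal.ofReal c ≤ ‖F W‖ₑ ^ (-t)
    rw [he, ENNReal.rpow_neg, ENNReal.rpow_neg]
    gcongr
  refine (measure_mono hsub).trans ?_
  have hmk := mul_meas_ge_le_lintegral₀ (μ := Measure.pi fun _ => haarGate) hm.aemeasurable
    (ENNReal.ofReal c)
  have h2 := hmk.trans (h.lintegral_le t ht ht')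
  rw [mul_comm, ← ENNReal.le_div_iff_mul_le (.inl (by simpa using hc0))
    (.inl ENNReal.ofReal_ne_top), ← ENNReal.ofReal_div_of_pos hc0, hc, ← Real.exp_sub] at h2
  refine h2.trans_eq ?_
  congr 2
  ring

end NegMoment

/-! ### Costs and negative moments of the soliton amplitudes -/

section Amplitude

variable {N : ℕ} [NeZero N] {D : Finset (ZMod N)}

/-- The gates of a circuit, indexed by the layer and the site together. -/
def gates (W : Fin 2 × ZMod N → Gate) : Fin 2 → ZMod N → Gate := fun l j => W (l, j)

open Classical in
/-- The part of twice the mean of `-log` of the amplitudes that telescopes around the ring. -/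
def normCost (D : Finset (ZMod N)) (a : ℤ) : ℕ :=
  if Undoped D (a + 1) then (if Undoped D (a - 2) then 1 else 0)
  else if Undoped D (a + 2) then (if Undoped D a then 0 else 1) else 2

open Classical in
/-- A bound for twice the mean of `-log` of the amplitude. -/
def ampCost (D : Finset (ZMod N)) (a : ℤ) : ℕ :=
  (if Undoped D (a + 1) then 8 else 6) + normCost D a - normCost D (a + 2)

open Classical in
-- The natural subtraction in `ampCost` does not truncate, as `normCost` is at most 2.
theorem ampCost_add (D : Finset (ZMod N)) (a : ℤ) :
    ampCost D a + normCost D (a + 2) = (if Undoped D (a + 1) then 8 else 6) + normCost D a := by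
  have : normCost D (a + 2) ≤ 2 := by unfold normCost; split_ifs <;> norm_num
  unfold ampCost
  split_ifs <;> omega

theorem ampCost_le (D : Finset (ZMod N)) (a : ℤ) : ampCost D a ≤ 10 := by
  have : normCost D a ≤ 2 := by unfold normCost; split_ifs <;> norm_num
  unfold ampCost
  split_ifs <;> omega

/-- The gates on which the amplitude depends. -/
def ampGates (N : ℕ) (a : ℤ) : Finset (Fin 2 × ZMod N) :=
  open Classical in
  ((Finset.univ : Finset (Fin 2)) ×ˢ Finset.Icc (a - 1) (a + 3)).image
    fun x => (x.1, (x.2 : ZMod N))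

theorem mem_ampGates {a i : ℤ} (l : Fin 2) (h : a - 1 ≤ i) (h' : i ≤ a + 3) :
    (l, (i : ZMod N)) ∈ ampGates N a := by
  simp only [ampGates, Finset.mem_image, Finset.mem_product, Finset.mem_univ, true_and,
    Finset.mem_Icc]
  exact ⟨(l, i), ⟨h, h'⟩, rfl⟩

theorem intCast_ne {i j : ℤ} (h : i < j) (h' : j < i + N) : (i : ZMod N) ≠ j := by
  intro he
  rw [ZMod.intCast_eq_intCast_iff_dvd_sub] at he
  have := Int.le_of_dvd (by omega) he
  omega

theorem disjoint_ampGates {a b : ℤ} (h : a + 4 < b) (h' : b + 4 < a + N) :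
    Disjoint (ampGates N a) (ampGates N b) := by
  rw [Finset.disjoint_left]
  rintro ⟨l, x⟩ hx hy
  simp only [ampGates, Finset.mem_image, Finset.mem_product, Finset.mem_univ, true_and,
    Finset.mem_Icc, Prod.mk.injEq, Prod.exists] at hx hy
  obtain ⟨_, i, hi, -, rfl⟩ := hx
  obtain ⟨_, j, hj, -, hji⟩ := hy
  exact intCast_ne (i := i) (j := j) (by omega) (by omega) hji.symm

theorem NegMoment.congr {ι : Type*} [Fintype ι] {F G : (ι → Gate) → ℂ} {S : Finset ι} {k : ℕ}
    (h : NegMoment F S k) (hFG : ∀ W, G W = F W) : NegMoment G S k := by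
  rwa [show G = F from funext hFG]

theorem elem_gates_of_doped (W : Fin 2 × ZMod N → Gate) (l : Fin 2) {i : ℤ}
    (hi : ¬ Undoped D i) (p q : Fin 4) :
    elem D (gates W) l i p q = transfer (W (l, (i : ZMod N))) p q := by
  rw [Undoped, not_not] at hi
  rw [elem, siteTransfer, siteGate, if_pos hi, gates]

/-- In each doping pattern the amplitude is a product of single matrix elements (cost 2) and
two-gate sums (cost 3) over disjoint gates. `normCost` books the excess that comes from unnormalised
rear and front vectors, so that it cancels between successive steps. -/
theorem negMoment_amp (hD : LinePattern (Undoped D)) (h6 : 6 ≤ N) (a : ℤ) :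
    NegMoment (fun W => amp D (gates W) a) (ampGates N a) (ampCost D a) := by
  classical
  have p2' := hD (a - 2)
  have p1' := hD (a - 1)
  have p0 := hD a
  have p1 := hD (a + 1)
  have p2 := hD (a + 2)
  rw [show a - 2 + 1 = a - 1 by ring, show a - 2 + 2 = a by ring] at p2'
  rw [show a - 1 + 1 = a by ring, show a - 1 + 2 = a + 1 by ring] at p1'
  rw [show a + 1 + 1 = a + 2 by ring, show a + 1 + 2 = a + 3 by ring] at p1
  rw [show a + 2 + 1 = a + 3 by ring, show a + 2 + 2 = a + 4 by ring] at p2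
  have e1 : a + 2 + 1 = a + 3 := by ring
  have e2 : a + 2 + 2 = a + 4 := by ring
  have e0 : a + 2 - 2 = a := by ring
  have cost := ampCost_add D a
  have m (l : Fin 2) (i : ℤ) := mem_ampGates (N := N) (a := a) (i := i) l
  have sing (l : Fin 2) (i : ℤ) {p q : Fin 4} (hp : p ≠ 0) (hq : q ≠ 0) :=
    NegMoment.single (l, (i : ZMod N)) hp hq
  have d1 : (1 : Fin 4) ≠ 0 := by decide
  have d2 : (2 : Fin 4) ≠ 0 := by decide
  have d3 : (3 : Fin 4) ≠ 0 := by decide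
  have g := elem_gates_of_doped (D := D)
  have dis {S T : Finset (Fin 2 × ZMod N)} (h : ∀ x ∈ S, ∀ y ∈ T, x ≠ y) : Disjoint S T :=
    Finset.disjoint_iff_ne.mpr h
  have n1 : ((a - 1 : ℤ) : ZMod N) ≠ ((a + 2 : ℤ) : ZMod N) := intCast_ne (by omega) (by omega)
  have n2 : ((a - 1 : ℤ) : ZMod N) ≠ ((a + 3 : ℤ) : ZMod N) := intCast_ne (by omega) (by omega)
  have n3 : (a : ZMod N) ≠ ((a + 2 : ℤ) : ZMod N) := intCast_ne (by omega) (by omega)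
  have n4 : (a : ZMod N) ≠ ((a + 1 : ℤ) : ZMod N) := intCast_ne (by omega) (by omega)
  have n5 : ((a + 1 : ℤ) : ZMod N) ≠ ((a + 3 : ℤ) : ZMod N) := intCast_ne (by omega) (by omega)
  have n6 : ((a + 1 : ℤ) : ZMod N) ≠ ((a + 2 : ℤ) : ZMod N) := intCast_ne (by omega) (by omega)
  have n7 : ((a + 2 : ℤ) : ZMod N) ≠ ((a + 3 : ℤ) : ZMod N) := intCast_ne (by omega) (by omega)
  have m0 (l : Fin 2) := mem_ampGates (N := N) (a := a) (i := a) l (by omega) (by omega)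
  have mm (l : Fin 2) := mem_ampGates (N := N) (a := a) (i := a - 1) l (by omega) (by omega)
  have m1 (l : Fin 2) := mem_ampGates (N := N) (a := a) (i := a + 1) l (by omega) (by omega)
  have m2 (l : Fin 2) := mem_ampGates (N := N) (a := a) (i := a + 2) l (by omega) (by omega)
  have m3 (l : Fin 2) := mem_ampGates (N := N) (a := a) (i := a + 3) l (by omega) (by omega)
  have pr (l l' : Fin 2) (i i' : ℤ) (h : ((l, (i : ZMod N)) : Fin 2 × ZMod N) ≠ (l', (i' : ZMod N)))
    {p q : Fin 4} (hp : p ≠ 0) (hq : q ≠ 0) := NegMoment.pair h hp hq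
  clear p0 p1'
  by_cases u1 : Undoped D (a + 1)
  · have u2 := p1.1 u1
    have u0 : ¬ Undoped D a := fun h => (hD a).1 h u1
    have hrear : NegMoment (fun W => elem D (gates W) 1 a 1 1 * rearCoeff D (gates W) a 1 +
        elem D (gates W) 1 a 1 2 * rearCoeff D (gates W) a 2)
        {(1, (a : ZMod N)), (0, ((a - 1 : ℤ) : ZMod N))}
        (2 + if Undoped D (a - 2) then 1 else 0) := by
      by_cases um : Undoped D (a - 2)
      · rw [if_pos um]
        have h := pr 1 0 a (a - 1) (by simp) d1 d2
        convert h using 2 with W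
        simp [rearCoeff, um, g W 1 u0, g W 0 (p2'.1 um)]
      · have h := sing 1 a d1 d2
        convert h.mono (T := {(1, (a : ZMod N)), (0, ((a - 1 : ℤ) : ZMod N))})
          (l := 2 + if Undoped D (a - 2) then 1 else 0) (by simp) (by simp) using 2 with W
        simp [rearCoeff, um, g W 1 u0]
    have hH : normCost D a = if Undoped D (a - 2) then 1 else 0 := by rw [normCost, if_pos u1]
    rw [if_pos u1, hH] at cost
    by_cases u3 : Undoped D (a + 3)
    · have hc : normCost D (a + 2) = 0 := by simp [normCost, e1, e0, u3, u0]
      have h := (hrear.mul (sing 0 (a + 2) d1 d3) (dis (by grind))).mul (sing 1 (a + 2) d2 d3)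
        (dis (by grind))
      refine (h.mono (T := ampGates N a) (by
        simp only [Finset.union_subset_iff, Finset.insert_subset_iff, Finset.singleton_subset_iff,
          m0, mm, m2, and_self]) (by omega)).congr fun W => ?_
      rw [amp, if_pos u1, if_pos u3, g W 0 u2, g W 1 u2]
    · have u4 := (p2.2.resolve_left u2).resolve_left u3
      have hc : normCost D (a + 2) = 1 := by simp [normCost, e1, e2, u3, u4, u2]
      have h := (hrear.mul (sing 0 (a + 2) d1 d3) (dis (by grind))).mul
        (pr 0 1 (a + 3) (a + 2) (by simp) d2 d3) (dis (by grind))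
      refine (h.mono (T := ampGates N a) (by
        simp only [Finset.union_subset_iff, Finset.insert_subset_iff, Finset.singleton_subset_iff,
          m0, mm, m2, m3, and_self]) (by omega)).congr fun W => ?_
      rw [amp, if_pos u1, if_neg u3, g W 0 u2, g W 1 u2, g W 1 u2, g W 0 u3, g W 0 u3]
  · rw [if_neg u1] at cost
    by_cases u2 : Undoped D (a + 2)
    · have u3 := p2.1 u2
      have hfac : NegMoment (fun W => if Undoped D a then elem D (gates W) 0 (a + 1) 1 2 else
          elem D (gates W) 0 (a + 1) 1 1 * elem D (gates W) 1 a 2 2 +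
            elem D (gates W) 0 (a + 1) 1 2 * elem D (gates W) 1 a 3 2)
          {(0, ((a + 1 : ℤ) : ZMod N)), (1, (a : ZMod N))} (2 + normCost D a) := by
        by_cases u0 : Undoped D a
        · have h := sing 0 (a + 1) d1 d2
          convert h.mono (T := {(0, ((a + 1 : ℤ) : ZMod N)), (1, (a : ZMod N))})
            (l := 2 + normCost D a) (by simp) (by simp) using 2 with W
          rw [if_pos u0, g W 0 u1]
        · have hc : normCost D a = 1 := by simp [normCost, u1, u2, u0]
          rw [hc]
          have h := pr 0 1 (a + 1) a (by simp) d1 d2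
          convert h using 2 with W
          simp only [if_neg u0, g W 0 u1, g W 1 u0]
      have hlast : NegMoment (fun W => if Undoped D (a + 4) then elem D (gates W) 0 (a + 3) 2 3
          else 1) {(0, ((a + 3 : ℤ) : ZMod N))} (2 - normCost D (a + 2)) := by
        by_cases u4 : Undoped D (a + 4)
        · have hc : normCost D (a + 2) = 0 := by simp [normCost, e1, e2, u3, u4, u2]
          rw [hc]
          simp only [if_pos u4, g _ 0 u3]
          exact sing 0 (a + 3) d2 d3
        · simp only [if_neg u4]
          exact NegMoment.one.mono (by simp) (by omega)
      have hc : normCost D (a + 2) ≤ 2 := by unfold normCost; split_ifs <;> norm_num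
      have h := ((sing 1 (a + 1) d1 d3).mul hfac (dis (by grind))).mul hlast (dis (by grind))
      refine (h.mono (T := ampGates N a) (by
        simp only [Finset.union_subset_iff, Finset.insert_subset_iff, Finset.singleton_subset_iff,
          m0, m1, m3, and_self]) (by omega)).congr fun W => ?_
      rw [amp, if_neg u1, if_pos u2, g W 1 u1]
    · have u3 := (p1.2.resolve_left u1).resolve_left u2
      have u0 := (hD a).2.resolve_right (not_or.mpr ⟨u1, u2⟩)
      have hc : normCost D a = 2 := by simp [normCost, u1, u2]
      have hc' : normCost D (a + 2) = 1 := by simp [normCost, e1, e0, u3, u0]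
      have h := ((sing 1 (a + 1) d1 d3).mul (sing 0 (a + 2) d1 d3) (dis (by grind))).mul
        (pr 1 0 (a + 2) (a + 1) (by simp) d2 d3) (dis (by grind))
      refine (h.mono (T := ampGates N a) (by
        simp only [Finset.union_subset_iff, Finset.insert_subset_iff, Finset.singleton_subset_iff,
          m1, m2, and_self]) (by omega)).congr fun W => ?_
      rw [amp, if_neg u1, if_neg u2, g W 1 u1, g W 0 u2, g W 1 u2, g W 1 u2, frontCoeff, if_neg u2]
      simp only [Matrix.cons_val_one, Matrix.cons_val, g W 0 u1]

end Amplitude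

/-! ### Concentration of the product of the amplitudes -/

section Product

variable {N : ℕ} [NeZero N] {D : Finset (ZMod N)}

theorem measurePreserving_uncurry_haarCircuit (N : ℕ) [NeZero N] :
    MeasurePreserving (fun (V : Fin 2 → ZMod N → Gate) (x : Fin 2 × ZMod N) => V x.1 x.2)
      (haarCircuit N) (Measure.pi fun _ => haarGate) := by
  have hm : Measurable fun (V : Fin 2 → ZMod N → Gate) (x : Fin 2 × ZMod N) => V x.1 x.2 :=
    measurable_pi_iff.mpr fun x => (measurable_pi_apply x.2).comp (measurable_pi_apply x.1)
  refine ⟨hm, ?_⟩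
  symm
  refine Measure.pi_eq fun s hs => ?_
  rw [Measure.map_apply hm (MeasurableSet.univ_pi hs)]
  have : (fun (V : Fin 2 → ZMod N → Gate) (x : Fin 2 × ZMod N) => V x.1 x.2) ⁻¹' Set.univ.pi s =
      Set.univ.pi fun l => Set.univ.pi fun j => s (l, j) := by
    ext V
    simp
  rw [this, haarCircuit, Measure.pi_pi, Fintype.prod_prod_type]
  simp only [Measure.pi_pi]

/-- A partition of the positions of the soliton into five classes of distant positions. -/
def spacing (n j : ℕ) : ℕ := if j < 3 * (n / 3) then j % 3 else 3 + (j - 3 * (n / 3))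

theorem spacing_lt {n j : ℕ} (h : j < n) : spacing n j < 5 := by
  unfold spacing; split_ifs <;> omega

/-- An amplitude uses gates on five consecutive sites, so positions three steps, that is six sites,
apart share none. Residues modulo 3 alone would fail at the seam of the ring; the at most two
leftover positions get classes of their own. -/
theorem disjoint_ampGates_of_spacing (hN : Even N) (h6 : 6 ≤ N) {i j : ℕ} (hi : i < N / 2) (hj : j < N / 2)
    (hij : i ≠ j) (h : spacing (N / 2) i = spacing (N / 2) j) :
    Disjoint (ampGates N (1 + 2 * i)) (ampGates N (1 + 2 * j)) := by
  obtain ⟨m, rfl⟩ := hN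
  have hm : (m + m) / 2 = m := by omega
  rw [hm] at *
  wlog hlt : i < j generalizing i j
  · exact (this hij.symm hj hi h.symm (by omega)).symm
  unfold spacing at h
  have h3 : i + 3 ≤ j ∧ j + 3 ≤ i + m := by split_ifs at h <;> omega
  exact disjoint_ampGates (by omega) (by push_cast; omega)

theorem measurable_prod_amp (hD : LinePattern (Undoped D)) (h6 : 6 ≤ N) (s : Finset ℕ) :
    Measurable fun W => ∏ j ∈ s, amp D (gates W) (1 + 2 * j) :=
  Finset.measurable_fun_prod s fun j _ => (negMoment_amp hD h6 (1 + 2 * j)).measurable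

/-- The product of the amplitudes around the ring is rarely small. -/
theorem measure_prod_amp_lt (hD : LinePattern (Undoped D)) (hN : Even N) (h6 : 6 ≤ N)
    {ε : ℝ} (hε : 0 < ε) (hε1 : ε ≤ 1) :
    haarCircuit N {V | ‖∏ j ∈ Finset.range (N / 2), amp D V (1 + 2 * j)‖ <
      Real.exp (-((∑ j ∈ Finset.range (N / 2), ampCost D (1 + 2 * j) : ℕ) / 2 : ℝ) - ε * (N / 2 : ℕ))} ≤
      5 * ENNReal.ofReal (Real.exp (-(ε ^ 2 / 1000 * (N / 2 : ℕ)))) := by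
  set n := N / 2 with hn
  set C : ℕ → Finset ℕ := fun c => (Finset.range n).filter fun j => spacing n j = c with hC
  set K : ℕ → ℕ := fun c => ∑ j ∈ C c, ampCost D (1 + 2 * j) with hK
  set A : ℕ → Set (Fin 2 × ZMod N → Gate) := fun c =>
    {W | ‖∏ j ∈ C c, amp D (gates W) (1 + 2 * j)‖ < Real.exp (-(K c / 2 : ℝ) - ε * n / 5)} with hA
  have hmaps : ∀ j ∈ Finset.range n, spacing n j ∈ Finset.range 5 := fun j hj =>
    Finset.mem_range.mpr (spacing_lt (Finset.mem_range.mp hj))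
  have hsub : {V : Fin 2 → ZMod N → Gate | ‖∏ j ∈ Finset.range n, amp D V (1 + 2 * j)‖ <
      Real.exp (-((∑ j ∈ Finset.range n, ampCost D (1 + 2 * j) : ℕ) / 2 : ℝ) - ε * n)} ⊆
      (fun (V : Fin 2 → ZMod N → Gate) (x : Fin 2 × ZMod N) => V x.1 x.2) ⁻¹'
        ⋃ c ∈ Finset.range 5, A c := by
    intro V hV
    by_contra hnot
    simp only [Set.mem_preimage, Set.mem_iUnion, not_exists, hA, Set.mem_ofPred_eq, not_lt] at hnot
    rw [Set.mem_ofPred_eq] at hV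
    refine absurd hV (not_lt.mpr ?_)
    rw [← Finset.prod_fiberwise_of_maps_to hmaps, ← Finset.sum_fiberwise_of_maps_to hmaps, norm_prod]
    have : Real.exp (-((∑ c ∈ Finset.range 5, K c : ℕ) / 2 : ℝ) - ε * n) =
        ∏ c ∈ Finset.range 5, Real.exp (-(K c / 2 : ℝ) - ε * n / 5) := by
      rw [← Real.exp_sum]
      congr 1
      rw [Finset.sum_sub_distrib, Finset.sum_const, Finset.card_range, Finset.sum_neg_distrib,
        ← Finset.sum_div]
      push_cast
      ring
    refine this.trans_le (Finset.prod_le_prod (fun _ _ => (Real.exp_pos _).le) fun c hc => ?_)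
    exact hnot c hc
  have hAm (c : ℕ) : MeasurableSet (A c) :=
    measurableSet_lt (measurable_prod_amp hD h6 _).norm measurable_const
  have hbound (c : ℕ) : (Measure.pi fun _ => haarGate) (A c) ≤
      ENNReal.ofReal (Real.exp (-(ε ^ 2 / 1000 * n))) := by
    have h1 : NegMoment (fun W => ∏ j ∈ C c, amp D (gates W) (1 + 2 * j)) _ (K c) :=
      NegMoment.prod (C c) (fun j _ => negMoment_amp hD h6 (1 + 2 * j)) (by
        intro i hi j hj hij
        simp only [hC, Finset.coe_filter, Finset.mem_range, Set.mem_ofPred_eq] at hi hj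
        exact disjoint_ampGates_of_spacing hN h6 hi.1 hj.1 hij (hi.2.trans hj.2.symm))
    -- With `K ≤ 10 n` this choice gives the exponent `ε² n / 1000 - ε² n / 500 = -ε² n / 1000`.
    refine (h1.measure_le (t := ε / 100) (by positivity) (by linarith) (ε * n / 5)).trans ?_
    refine ENNReal.ofReal_le_ofReal (Real.exp_le_exp.mpr ?_)
    have hK10 : (K c : ℝ) ≤ 10 * n := by
      have : K c ≤ n * 10 := by
        calc K c ≤ (C c).card * 10 := Finset.sum_le_card_nsmul _ _ _ fun j _ => ampCost_le D _
          _ ≤ n * 10 := by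
            gcongr
            exact (Finset.card_filter_le _ _).trans (Finset.card_range n).le
      have h2 : (K c : ℝ) ≤ ((n * 10 : ℕ) : ℝ) := by exact_mod_cast this
      push_cast at h2
      linarith
    have : (K c : ℝ) * (ε / 100) ^ 2 ≤ 10 * n * (ε / 100) ^ 2 := by gcongr
    nlinarith
  refine (measure_mono hsub).trans ?_
  rw [(measurePreserving_uncurry_haarCircuit N).measure_preimage
    (Finset.measurableSet_biUnion _ fun c _ => hAm c).nullMeasurableSet]
  refine (measure_biUnion_finset_le _ _).trans ?_
  refine (Finset.sum_le_sum fun c _ => hbound c).trans ?_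
  rw [Finset.sum_const, Finset.card_range, nsmul_eq_mul]
  norm_num

end Product

/-- Almost surely the products of the amplitudes of a growing sequence of circuits are not small. -/
theorem ae_eventually_prod_amp {Ω : Type*} [MeasurableSpace Ω] (P : Measure Ω)
    [IsProbabilityMeasure P] (N : ℕ → ℕ) [∀ k, NeZero (N k)] (hN : StrictMono N)
    (hEven : ∀ k, Even (N k)) (D : ∀ k, Finset (ZMod (N k)))
    (hD : ∀ k, LinePattern (Undoped (D k)))
    (V : ∀ k, Ω → Fin 2 → ZMod (N k) → Gate) (hV : ∀ k, HasLaw (V k) (haarCircuit (N k)) P)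
    {ε : ℝ} (hε : 0 < ε) (hε1 : ε ≤ 1) :
    ∀ᵐ ω ∂P, ∀ᶠ k in atTop,
      Real.exp (-((∑ j ∈ Finset.range (N k / 2), ampCost (D k) (1 + 2 * j) : ℕ) / 2 : ℝ) -
        ε * (N k / 2 : ℕ)) ≤
      ‖∏ j ∈ Finset.range (N k / 2), amp (D k) (V k ω) (1 + 2 * j)‖ := by
  set B : ∀ k, Set (Fin 2 → ZMod (N k) → Gate) := fun k =>
    {V | ‖∏ j ∈ Finset.range (N k / 2), amp (D k) V (1 + 2 * j)‖ <
      Real.exp (-((∑ j ∈ Finset.range (N k / 2), ampCost (D k) (1 + 2 * j) : ℕ) / 2 : ℝ) -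
        ε * (N k / 2 : ℕ))} with hB
  have hid : ∀ k, k ≤ N k := fun k => hN.le_apply
  have hBm (k : ℕ) (h6 : 6 ≤ N k) : MeasurableSet (B k) := by
    have h1 := (measurable_prod_amp (hD k) h6 (Finset.range (N k / 2))).comp
      (measurePreserving_uncurry_haarCircuit (N k)).measurable
    exact measurableSet_lt h1.norm measurable_const
  set r := Real.exp (-(ε ^ 2 / 2000)) with hr
  have hr1 : r < 1 := Real.exp_lt_one_iff.mpr (by have := pow_pos hε 2; linarith)
  have hbound (k : ℕ) : P {ω | V (k + 6) ω ∈ B (k + 6)} ≤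
      5 * ENNReal.ofReal (r ^ k) := by
    have h6 : 6 ≤ N (k + 6) := le_trans (by omega) (hid (k + 6))
    have h1 : P {ω | V (k + 6) ω ∈ B (k + 6)} = haarCircuit (N (k + 6)) (B (k + 6)) := by
      rw [← (hV (k + 6)).map_eq, Measure.map_apply_of_aemeasurable (hV (k + 6)).aemeasurable
        (hBm _ h6)]
      rfl
    rw [h1]
    refine (measure_prod_amp_lt (hD _) (hEven _) h6 hε hε1).trans ?_
    gcongr
    rw [hr, ← Real.exp_nat_mul]
    refine Real.exp_le_exp.mpr ?_
    have h2 : (k : ℝ) ≤ 2 * ((N (k + 6) / 2 : ℕ) : ℝ) := by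
      have := hid (k + 6)
      have h3 : k ≤ 2 * (N (k + 6) / 2) := by omega
      exact_mod_cast h3
    nlinarith [pow_pos hε 2]
  have hsum : ∑' k, P {ω | V (k + 6) ω ∈ B (k + 6)} ≠ ⊤ := by
    refine ne_top_of_le_ne_top ?_ (ENNReal.tsum_le_tsum hbound)
    rw [ENNReal.tsum_mul_left]
    refine ENNReal.mul_ne_top (by norm_num) ?_
    rw [← ENNReal.ofReal_tsum_of_nonneg (fun k => by positivity)
      (summable_geometric_of_lt_one (Real.exp_pos _).le hr1)]
    exact ENNReal.ofReal_ne_top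
  -- The convergent half of Borel–Cantelli: only the law of each single circuit enters.
  filter_upwards [ae_eventually_notMem hsum] with ω hω
  filter_upwards [(tendsto_sub_atTop_nat 6).eventually hω, eventually_ge_atTop 6] with k hk hk6
  obtain ⟨k, rfl⟩ := Nat.exists_eq_add_of_le' hk6
  rw [Nat.add_sub_cancel] at hk
  simpa [hB] using hk

theorem solWeight_le_three {N : ℕ} {D : Finset (ZMod N)} (a : ℤ) : solWeight D a ≤ 3 := by
  unfold solWeight; split_ifs <;> norm_num

theorem two_le_solWeight {N : ℕ} {D : Finset (ZMod N)} (a : ℤ) : 2 ≤ solWeight D a := by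
  unfold solWeight; split_ifs <;> norm_num

/-! ### The slow mode of the truncated dynamics -/

section Bounds

variable {N : ℕ} [NeZero N] {D : Finset (ZMod N)} {V : Fin 2 → ZMod N → Gate} {γ : ℝ}

theorem abs_bloch_le_one (U : Gate) (p q : Fin 4) : |bloch U p q| ≤ 1 := by
  have h := sum_bloch_mul_bloch U q q
  rw [if_pos rfl] at h
  have := Finset.single_le_sum (f := fun p => bloch U p q * bloch U p q)
    (fun p _ => mul_self_nonneg _) (Finset.mem_univ p)
  rw [h] at this
  exact abs_le_one_iff_mul_self_le_one.mpr this

theorem norm_elem_le_one (l : Fin 2) (i : ℤ) (p q : Fin 4) : ‖elem D V l i p q‖ ≤ 1 := by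
  by_cases hi : Undoped D i
  · rw [elem_of_undoped V l hi]
    split_ifs <;> simp
  · rw [elem, siteTransfer, transfer_eq_bloch, Complex.norm_real]
    exact abs_bloch_le_one _ p q

theorem norm_rearCoeff_le_one (a : ℤ) (p : Fin 4) : ‖rearCoeff D V a p‖ ≤ 1 := by
  unfold rearCoeff
  split_ifs <;> fin_cases p <;> simp [norm_elem_le_one]

theorem norm_frontCoeff_le_one (a : ℤ) (p : Fin 4) : ‖frontCoeff D V a p‖ ≤ 1 := by
  unfold frontCoeff
  split_ifs <;> fin_cases p <;> simp [norm_elem_le_one]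

theorem norm_mul_le_of_le_one {z w : ℂ} {r : ℝ} (hr : ‖z‖ ≤ r) (hw : ‖w‖ ≤ 1) : ‖z * w‖ ≤ r := by
  rw [norm_mul]
  exact (mul_le_of_le_one_right (norm_nonneg z) hw).trans hr

theorem norm_mul_add_mul_le_two {z w z' w' : ℂ} (hz : ‖z‖ ≤ 1) (hw : ‖w‖ ≤ 1) (hz' : ‖z'‖ ≤ 1)
    (hw' : ‖w'‖ ≤ 1) : ‖z * w + z' * w'‖ ≤ 2 :=
  (norm_add_le_of_le (norm_mul_le_of_le_one hz hw) (norm_mul_le_of_le_one hz' hw')).trans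
    (by norm_num)

/-- A crude bound, used only to rule out the eigenvalue 1. -/
theorem norm_amp_le (a : ℤ) : ‖amp D V a‖ ≤ 4 := by
  have he := norm_elem_le_one (D := D) (V := V)
  have hf := norm_frontCoeff_le_one (D := D) (V := V) a
  have hr := norm_rearCoeff_le_one (D := D) (V := V) a
  unfold amp
  split_ifs
  · refine norm_mul_le_of_le_one (norm_mul_le_of_le_one ?_ (he ..)) (he ..)
    exact (norm_mul_add_mul_le_two (he ..) (hr _) (he ..) (hr _)).trans (by norm_num)
  · rw [norm_mul, show (4 : ℝ) = 2 * 2 by norm_num]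
    gcongr
    · exact norm_mul_le_of_le_one (norm_mul_add_mul_le_two (he ..) (hr _) (he ..) (hr _)) (he ..)
    · exact norm_mul_add_mul_le_two (he ..) (he ..) (he ..) (he ..)
  · refine norm_mul_le_of_le_one (norm_mul_le_of_le_one ?_ (he ..)) (he ..)
    exact (he ..).trans (by norm_num)
  · refine norm_mul_le_of_le_one (norm_mul_le_of_le_one ?_ (he ..)) (by simp)
    exact (he ..).trans (by norm_num)
  · refine norm_mul_le_of_le_one ?_ (he ..)
    rw [mul_comm]
    refine norm_mul_le_of_le_one ?_ (he ..)
    exact (norm_mul_add_mul_le_two (he ..) (he ..) (he ..) (he ..)).trans (by norm_num)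
  · refine norm_mul_le_of_le_one ?_ (by simp)
    rw [mul_comm]
    refine norm_mul_le_of_le_one ?_ (he ..)
    exact (norm_mul_add_mul_le_two (he ..) (he ..) (he ..) (he ..)).trans (by norm_num)
  · rw [mul_comm]
    refine norm_mul_le_of_le_one ?_ (norm_mul_le_of_le_one (he ..) (he ..))
    exact (norm_mul_add_mul_le_two (he ..) (hf _) (he ..) (hf _)).trans (by norm_num)

theorem norm_dampedAmp (a : ℤ) : ‖dampedAmp γ D V a‖ =
    Real.exp (-γ / 2 * (solWeight D (a + 2) + solWeight D a)) * ‖amp D V a‖ := by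
  rw [dampedAmp, damping, damping, if_pos (solWeight_le_three _), if_pos (solWeight_le_three _), norm_mul,
    norm_mul, Complex.norm_real, Complex.norm_real, Real.norm_of_nonneg (Real.exp_pos _).le,
    Real.norm_of_nonneg (Real.exp_pos _).le, mul_add, Real.exp_add]
  ring_nf

/-- The weights are at least 2, so the damping is at most `e⁻²`, and `4 e⁻² < 1`. Hence the soliton
eigenvalue is not the one of the steady state. -/
theorem norm_dampedAmp_lt_one (hγ : 1 ≤ γ) (a : ℤ) : ‖dampedAmp γ D V a‖ < 1 := by
  rw [norm_dampedAmp]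
  have h1 : (2 : ℝ) ≤ solWeight D a := by exact_mod_cast two_le_solWeight a
  have h2 : (2 : ℝ) ≤ solWeight D (a + 2) := by exact_mod_cast two_le_solWeight (a + 2)
  have h3 : Real.exp (-γ / 2 * (solWeight D (a + 2) + solWeight D a)) ≤ Real.exp (-2) := by
    refine Real.exp_le_exp.mpr ?_
    nlinarith
  have h4 : Real.exp (-2) * 4 < 1 := by
    rw [Real.exp_neg, inv_mul_lt_iff₀ (Real.exp_pos _), mul_one,
      show (2 : ℝ) = 1 + 1 by norm_num, Real.exp_add]
    nlinarith [Real.exp_one_gt_d9]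
  exact (mul_le_mul h3 (norm_amp_le a) (norm_nonneg _) (Real.exp_pos _).le).trans_lt h4

theorem sum_range_add_two {f : ℤ → ℕ} (hN : Even N) (hf : ∀ a, f (a + N) = f a) :
    ∑ j ∈ Finset.range (N / 2), f (1 + 2 * j + 2) = ∑ j ∈ Finset.range (N / 2), f (1 + 2 * j) := by
  obtain ⟨m, rfl⟩ := hN
  rw [show (m + m) / 2 = m by omega]
  have h1 := Finset.sum_range_succ (fun j : ℕ => f (1 + 2 * j)) m
  rw [Finset.sum_range_succ'] at h1
  have h2 : f (1 + 2 * (m : ℤ)) = f (1 + 2 * ((0 : ℕ) : ℤ)) := by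
    rw [← hf (1 + 2 * ((0 : ℕ) : ℤ))]; push_cast; ring_nf
  rw [h2] at h1
  convert Nat.add_right_cancel h1 using 3 with j
  push_cast; ring

theorem normCost_add_period (a : ℤ) : normCost D (a + N) = normCost D a := by
  rw [normCost, show a + N + 1 = a + 1 + N by ring, show a + N + 2 = a + 2 + N by ring,
    show a + N - 2 = a - 2 + N by ring, undoped_add_period, undoped_add_period,
    undoped_add_period, undoped_add_period, normCost]

/-- `normCost` telescopes round the ring. What remains per step is 8 for weight 2 and 6 for weight
3, that is `12 - 2 w`: a lighter soliton is damped less but has a smaller amplitude. -/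
theorem sum_ampCost_add (hN : Even N) : ∑ j ∈ Finset.range (N / 2), ampCost D (1 + 2 * j) +
    2 * ∑ j ∈ Finset.range (N / 2), solWeight D (1 + 2 * j) = 12 * (N / 2) := by
  have h1 := sum_range_add_two hN (normCost_add_period (D := D))
  have h2 : ∑ j ∈ Finset.range (N / 2), (ampCost D (1 + 2 * j) + normCost D (1 + 2 * j + 2) +
      2 * solWeight D (1 + 2 * j)) = ∑ j ∈ Finset.range (N / 2), (12 + normCost D (1 + 2 * j)) := by
    refine Finset.sum_congr rfl fun j _ => ?_
    rw [ampCost_add, solWeight]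
    split_ifs <;> ring
  simp only [Finset.sum_add_distrib, ← Finset.mul_sum, Finset.sum_const, Finset.card_range,
    smul_eq_mul] at h2
  omega

theorem norm_prod_dampedAmp (hN : Even N) : ‖∏ j ∈ Finset.range (N / 2), dampedAmp γ D V (1 + 2 * j)‖ =
    Real.exp (-γ * (∑ j ∈ Finset.range (N / 2), solWeight D (1 + 2 * j) : ℕ)) *
      ‖∏ j ∈ Finset.range (N / 2), amp D V (1 + 2 * j)‖ := by
  simp only [norm_prod, norm_dampedAmp, Finset.prod_mul_distrib, ← Real.exp_sum, ← Finset.mul_sum,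
    Finset.sum_add_distrib]
  have := sum_range_add_two hN (solWeight_add_period (D := D))
  congr 2
  rw [← Nat.cast_sum, ← Nat.cast_sum, this]
  ring

theorem amp_ne_zero_of_prod (hN : Even N)
    (h : ∏ j ∈ Finset.range (N / 2), amp D V (1 + 2 * j) ≠ 0) (j : ℕ) : amp D V (1 + 2 * j) ≠ 0 := by
  obtain ⟨m, rfl⟩ := hN
  rw [show (m + m) / 2 = m by omega, Finset.prod_ne_zero_iff] at h
  have hm : 0 < m := by have := NeZero.ne (m + m); omega
  have key (k i : ℕ) : amp D V (1 + 2 * ((i + m * k : ℕ) : ℤ)) = amp D V (1 + 2 * (i : ℤ)) := by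
    induction k with
    | zero => simp
    | succ k ih =>
      rw [← ih, ← amp_add_period (1 + 2 * ((i + m * k : ℕ) : ℤ))]
      push_cast; ring_nf
  rw [← Nat.mod_add_div j m, key]
  exact h _ (Finset.mem_range.mpr (Nat.mod_lt _ hm))

/-- A lower bound for the amplitudes yields a slow mode of the truncated dynamics. -/
theorem exists_eigenvalue_ge (hD : LinePattern (Undoped D)) (hN : Even N) (h60 : 60 ≤ N)
    (hγ : 1 ≤ γ) {ε : ℝ}
    (h : Real.exp (-((∑ j ∈ Finset.range (N / 2), ampCost D (1 + 2 * j) : ℕ) / 2 : ℝ) -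
      ε * (N / 2 : ℕ)) ≤ ‖∏ j ∈ Finset.range (N / 2), amp D V (1 + 2 * j)‖) :
    ∃ μ : ℂ, Module.End.HasEigenvalue (truncatedChannel 3 γ D V) μ ∧ μ ≠ 1 ∧
      Real.exp (-(3 * γ + 3 + ε)) ≤ ‖μ‖ := by
  have hne : ∏ j ∈ Finset.range (N / 2), amp D V (1 + 2 * j) ≠ 0 := by
    rw [← norm_ne_zero_iff]
    exact ((Real.exp_pos _).trans_le h).ne'
  have hn : N / 2 ≠ 0 := by omega
  obtain ⟨μ, hμ, hev⟩ := exists_hasEigenvalue_truncatedChannel (γ := γ) hD hN h60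
    (amp_ne_zero_of_prod hN hne)
  refine ⟨μ, hev, ?_, ?_⟩
  · rintro rfl
    have h1 : ‖∏ j ∈ Finset.range (N / 2), dampedAmp γ D V (1 + 2 * j)‖ < 1 := by
      rw [norm_prod]
      obtain ⟨m, hm⟩ := Nat.exists_eq_succ_of_ne_zero hn
      rw [hm, Finset.prod_range_succ]
      exact mul_lt_one_of_nonneg_of_lt_one_right
        (Finset.prod_le_one (fun _ _ => norm_nonneg _) fun _ _ => (norm_dampedAmp_lt_one hγ _).le)
        (norm_nonneg _) (norm_dampedAmp_lt_one hγ _)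
    rw [← hμ] at h1
    simp at h1
  · refine le_of_pow_le_pow_left₀ hn (norm_nonneg _) ?_
    rw [← norm_pow, hμ, norm_prod_dampedAmp hN]
    refine le_trans ?_ (mul_le_mul_of_nonneg_left h (Real.exp_pos _).le)
    rw [← Real.exp_add, ← Real.exp_nat_mul]
    refine Real.exp_le_exp.mpr ?_
    have h1 := sum_ampCost_add (D := D) hN
    have h2 : ∑ j ∈ Finset.range (N / 2), solWeight D (1 + 2 * j) ≤ N / 2 * 3 := by
      simpa using Finset.sum_le_card_nsmul (Finset.range (N / 2)) _ 3
        fun j _ => solWeight_le_three (D := D) (1 + 2 * j)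
    generalize ∑ j ∈ Finset.range (N / 2), solWeight D (1 + 2 * j) = W at *
    generalize ∑ j ∈ Finset.range (N / 2), ampCost D (1 + 2 * j) = C at *
    generalize N / 2 = n at *
    -- The total rate is `γ W + C / 2 = 6 n + (γ - 1) W`; as `γ ≥ 1`, it is largest for `W = 3 n`,
    -- which gives `(3 γ + 3) n`.
    have h1' : (C : ℝ) + 2 * W = 12 * n := by exact_mod_cast h1
    have h2' : (W : ℝ) ≤ n * 3 := by exact_mod_cast h2
    nlinarith

end Bounds

theorem gap_le {N : ℕ} {Φ : Op N →ₗ[ℂ] Op N} {μ : ℂ} (h : Module.End.HasEigenvalue Φ μ)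
    (h1 : μ ≠ 1) {c : ℝ} (hc : Real.exp (-c) ≤ ‖μ‖) : gap Φ ≤ (c : EReal) := by
  rw [gap, EReal.neg_le, ← EReal.coe_neg, ← Real.log_exp (-c),
    ← ENNReal.log_ofReal_of_pos (Real.exp_pos _)]
  refine ENNReal.log_monotone (le_trans ?_ (le_iSup₂ (f := fun (μ : ℂ) (_ : μ ∈ {μ : ℂ |
    Module.End.HasEigenvalue Φ μ ∧ μ ≠ 1}) => ‖μ‖ₑ) μ ⟨h, h1⟩))
  rw [← ofReal_norm]
  exact ENNReal.ofReal_le_ofReal hc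

/-- The slow mode of the circuits truncated to weight three. -/
theorem ae_limsup_truncatedGap_le {Ω : Type*} [MeasurableSpace Ω] (P : Measure Ω)
    [IsProbabilityMeasure P] (N : ℕ → ℕ) [∀ k, NeZero (N k)] (hN : StrictMono N)
    (hEven : ∀ k, Even (N k)) (D : ∀ k, Finset (ZMod (N k)))
    (hD : ∀ k, LinePattern (Undoped (D k)))
    (V : ∀ k, Ω → Fin 2 → ZMod (N k) → Gate) (hV : ∀ k, HasLaw (V k) (haarCircuit (N k)) P) :
    ∀ᵐ ω ∂P, ∀ γ : ℝ, 1 ≤ γ → ∀ ε : ℝ, 0 < ε → ∀ᶠ k in atTop,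
      truncatedGap 3 γ (D k) (V k ω) ≤ ((3 * γ + 3 + ε : ℝ) : EReal) := by
  -- The event concerns undamped amplitudes only, and countably many errors `1 / (m + 1)` suffice;
  -- so one null set serves all `γ` and `ε`.
  have h : ∀ᵐ ω ∂P, ∀ m : ℕ, ∀ᶠ k in atTop,
      Real.exp (-((∑ j ∈ Finset.range (N k / 2), ampCost (D k) (1 + 2 * j) : ℕ) / 2 : ℝ) -
        1 / (m + 1 : ℝ) * (N k / 2 : ℕ)) ≤
      ‖∏ j ∈ Finset.range (N k / 2), amp (D k) (V k ω) (1 + 2 * j)‖ :=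
    ae_all_iff.mpr fun m => ae_eventually_prod_amp P N hN hEven D hD V hV Nat.one_div_pos_of_nat
      ((div_le_one (by positivity)).mpr (by linarith [Nat.cast_nonneg (α := ℝ) m]))
  filter_upwards [h] with ω hω γ hγ ε hε
  obtain ⟨m, hm⟩ := exists_nat_one_div_lt hε
  filter_upwards [hω m, eventually_ge_atTop 60] with k hk h60
  obtain ⟨μ, h1, h2, h3⟩ := exists_eigenvalue_ge (hD k) (hEven k) (h60.trans hN.le_apply) hγ hk
  refine (gap_le h1 h2 h3).trans ?_
  rw [EReal.coe_le_coe_iff]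
  linarith

theorem limsup_le_of_forall_pos {u : ℕ → EReal} {c : ℝ}
    (h : ∀ ε : ℝ, 0 < ε → ∀ᶠ k in atTop, u k ≤ ((c + ε : ℝ) : EReal)) :
    limsup u atTop ≤ (c : EReal) := by
  refine EReal.le_of_forall_lt_iff_le.mp fun z hz => ?_
  have hz' : c < z := by exact_mod_cast hz
  refine limsup_le_of_le (by isBoundedDefault) ?_
  simpa using h (z - c) (by linarith)

/-! ### Trace polynomials of damped signed permutations -/

theorem exists_iterate_eq_id {ι : Type*} [Finite ι] {f : ι → ι} (hf : Function.Injective f) :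
    ∃ k : ℕ, 0 < k ∧ ∀ T, f^[k] T = T := by
  let e := Equiv.ofBijective f (Finite.injective_iff_bijective.mp hf)
  refine ⟨orderOf e, orderOf_pos e, fun T => ?_⟩
  have h : (e ^ orderOf e) T = T := by rw [pow_orderOf_eq_one]; rfl
  rwa [← Equiv.Perm.iterate_eq_pow] at h

section SignedPerm

open Polynomial

variable {ι : Type*} [Fintype ι] [DecidableEq ι]

/-- The matrix `M` maps each basis vector to a signed basis vector, along the map `f`. -/
def IsSignedMap (M : Matrix ι ι ℂ) (f : ι → ι) : Prop :=
  ∃ s : ι → ℂ, (∀ T, s T ^ 2 = 1) ∧ ∀ S T, M S T = if S = f T then s T else 0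

theorem IsSignedMap.mul {M M' : Matrix ι ι ℂ} {f g : ι → ι} (h : IsSignedMap M f)
    (h' : IsSignedMap M' g) : IsSignedMap (M * M') (f ∘ g) := by
  obtain ⟨s, hs, hM⟩ := h
  obtain ⟨s', hs', hM'⟩ := h'
  refine ⟨fun T => s (g T) * s' T, fun T => by rw [mul_pow, hs, hs', one_mul], fun S T => ?_⟩
  simp only [Matrix.mul_apply, hM, hM', mul_ite, mul_zero, Finset.sum_ite_eq', Finset.mem_univ,
    if_true, Function.comp_apply]
  split_ifs <;> simp

/-- The damping by the powers `X ^ w` on the strings with `p`, and by `0` on the other ones. -/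
def powerDamping (p : ι → Prop) [DecidablePred p] (w : ι → ℕ) (S : ι) : ℂ[X] :=
  if p S then X ^ w S else 0

/-- The trace of the powers of a damped matrix as a polynomial of the damping factor. -/
def tracePoly (p : ι → Prop) [DecidablePred p] (w : ι → ℕ) (m : ℕ) (M : Matrix ι ι ℂ) : ℂ[X] :=
  ((Matrix.diagonal (powerDamping p w) * M.map C) ^ m).trace

variable {p : ι → Prop} [DecidablePred p] {w : ι → ℕ}

theorem pow_damped_of_signed {M : Matrix ι ι ℂ} {f : ι → ι} {s : ι → ℂ}
    (hM : ∀ S T, M S T = if S = f T then s T else 0) (d : ι → ℂ[X]) (m : ℕ) (S T : ι) :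
    ((Matrix.diagonal d * M.map C) ^ m) S T = if S = f^[m] T then
      ∏ i ∈ Finset.range m, d (f^[i + 1] T) * C (s (f^[i] T)) else 0 := by
  induction m generalizing S with
  | zero =>
    rw [pow_zero, Matrix.one_apply, Finset.range_zero, Finset.prod_empty]
    rfl
  | succ m ih =>
    rw [pow_succ', Matrix.mul_apply]
    simp only [ih, mul_ite, mul_zero, Finset.sum_ite_eq', Finset.mem_univ, if_true,
      Matrix.diagonal_mul, Matrix.map_apply, hM, Finset.prod_range_succ,
      Function.iterate_succ_apply']
    split_ifs with h
    · subst h; ring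
    · simp

/-- A light orbit of a signed permutation contributes to the trace of a power. -/
theorem IsSignedMap.exists_coeff_tracePoly_ne_zero {M : Matrix ι ι ℂ} {f : ι → ι}
    (h : IsSignedMap M f) (hf : Function.Injective f) {S₀ : ι} (hp : ∀ i, p (f^[i] S₀))
    (hw : ∀ i, w (f^[i] S₀) ≤ 3) (hw₀ : w S₀ ≤ 2) :
    ∃ m v : ℕ, 0 < m ∧ v < 3 * m ∧ (tracePoly p w m M).coeff v ≠ 0 := by
  obtain ⟨s, hs, hM⟩ := h
  obtain ⟨k, hk, hfk⟩ := exists_iterate_eq_id hf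
  have hf2 (T : ι) : f^[k + k] T = T := by rw [Function.iterate_add_apply, hfk, hfk]
  -- Going twice through the order `k` of the permutation squares every sign.
  have hsign (T : ι) : ∏ i ∈ Finset.range (k + k), (C (s (f^[i] T)) : ℂ[X]) = 1 := by
    rw [Finset.prod_range_add]
    have : ∀ i, f^[k + i] T = f^[i] T := fun i => by
      rw [add_comm, Function.iterate_add_apply, hfk]
    simp only [this]
    rw [← sq, ← Finset.prod_pow]
    simp only [← map_pow, hs, map_one, Finset.prod_const_one]
  have htr : tracePoly p w (k + k) M = ∑ T, if (∀ i ∈ Finset.range (k + k), p (f^[i + 1] T)) then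
      X ^ (∑ i ∈ Finset.range (k + k), w (f^[i + 1] T)) else 0 := by
    rw [tracePoly, Matrix.trace]
    refine Finset.sum_congr rfl fun T _ => ?_
    rw [Matrix.diag_apply, pow_damped_of_signed hM, if_pos (hf2 T).symm, Finset.prod_mul_distrib,
      hsign, mul_one]
    simp only [powerDamping]
    split_ifs with hall
    · rw [← Finset.prod_pow_eq_pow_sum]
      exact Finset.prod_congr rfl fun i hi => if_pos (hall i hi)
    · push Not at hall
      obtain ⟨i, hi, hpi⟩ := hall
      exact Finset.prod_eq_zero hi (if_neg hpi)
  refine ⟨k + k, ∑ i ∈ Finset.range (k + k), w (f^[i + 1] S₀), by omega, ?_, ?_⟩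
  · obtain ⟨l, hl⟩ : ∃ l, k + k = l + 1 := ⟨k + k - 1, by omega⟩
    -- The last of the `k + k` steps returns to `S₀`, whose weight at most 2 makes the total
    -- strictly smaller than `3 (k + k)`.
    rw [hl, Finset.sum_range_succ, ← hl, hf2, hl]
    have := Finset.sum_le_card_nsmul (Finset.range l) (fun i => w (f^[i + 1] S₀)) 3
      fun i _ => hw (i + 1)
    rw [Finset.card_range, smul_eq_mul] at this
    omega
  · rw [htr, finsetSum_coeff]
    have hc : ∀ T, (if (∀ i ∈ Finset.range (k + k), p (f^[i + 1] T)) then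
        (X : ℂ[X]) ^ (∑ i ∈ Finset.range (k + k), w (f^[i + 1] T)) else 0).coeff
        (∑ i ∈ Finset.range (k + k), w (f^[i + 1] S₀)) =
        ((if (∀ i ∈ Finset.range (k + k), p (f^[i + 1] T)) ∧
          ∑ i ∈ Finset.range (k + k), w (f^[i + 1] S₀) =
            ∑ i ∈ Finset.range (k + k), w (f^[i + 1] T) then 1 else 0 : ℕ) : ℂ) := by
      intro T
      by_cases h1 : ∀ i ∈ Finset.range (k + k), p (f^[i + 1] T)
      · rw [if_pos h1, coeff_X_pow]
        simp only [and_iff_right h1]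
        split_ifs <;> simp
      · rw [if_neg h1, if_neg fun h => h1 h.1]
        simp
    simp only [hc]
    -- The coefficient counts strings with a given total weight along their orbit, so nothing
    -- cancels and `S₀` alone makes it positive.
    rw [← Nat.cast_sum, Nat.cast_ne_zero]
    refine (Finset.sum_pos' (fun _ _ => Nat.zero_le _) ⟨S₀, Finset.mem_univ _, ?_⟩).ne'
    rw [if_pos ⟨fun i _ => hp (i + 1), rfl⟩]
    exact one_pos

theorem exists_mem_norm_ge_of_sum {s : Multiset ℂ} {r : ℝ} (h : (s.card : ℝ) * r ≤ ‖s.sum‖)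
    (h0 : 0 < s.card) : ∃ z ∈ s, r ≤ ‖z‖ := by
  by_contra! hlt
  obtain ⟨z, hz⟩ := Multiset.card_pos_iff_exists_mem.mp h0
  have h2 := Multiset.sum_lt_sum (s := s) (f := norm) (g := fun _ => r) (fun z hz => (hlt z hz).le)
    ⟨z, hz, hlt z hz⟩
  rw [Multiset.map_const', Multiset.sum_replicate, nsmul_eq_mul] at h2
  exact (h.trans (norm_multiset_sum_le s)).not_gt h2

/-- The trace is the sum of the eigenvalues with multiplicity, and one of them has at least the
average modulus. -/
theorem exists_root_norm_ge {M : Matrix ι ι ℂ} {r : ℝ} (hι : 0 < Fintype.card ι)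
    (h : (Fintype.card ι : ℝ) * r ≤ ‖M.trace‖) : ∃ z : ℂ, (∃ c ≠ 0, M.mulVec c = z • c) ∧ r ≤ ‖z‖ := by
  rw [Matrix.trace_eq_sum_roots_charpoly] at h
  have hcard : M.charpoly.roots.card = Fintype.card ι := by
    rw [← Matrix.charpoly_natDegree_eq_dim M]
    exact (IsAlgClosed.splits _).natDegree_eq_card_roots.symm
  rw [← hcard] at h hι
  obtain ⟨z, hz, hr⟩ := exists_mem_norm_ge_of_sum h hι
  refine ⟨z, ?_, hr⟩
  have h1 := (Polynomial.mem_roots'.mp hz).2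
  rw [IsRoot, Matrix.eval_charpoly, ← Matrix.exists_mulVec_eq_zero_iff] at h1
  obtain ⟨c, hc, h1⟩ := h1
  refine ⟨c, hc, ?_⟩
  rw [Matrix.sub_mulVec, sub_eq_zero] at h1
  rw [← h1]
  simp [Matrix.scalar_apply, ← Matrix.smul_one_eq_diagonal, Matrix.smul_mulVec]

/-- A low coefficient of a trace polynomial yields a slow mode at strong damping. -/
theorem exists_eigenvalue_of_tracePoly {M : Matrix ι ι ℂ} {m v : ℕ} (hm : 0 < m) (hv : v < 3 * m)
    (h : (tracePoly p w m M).coeff v ≠ 0) : ∀ᶠ x : ℝ in nhdsWithin 0 (Set.Ioi 0),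
      ∃ μ : ℂ, x ^ 3 ≤ ‖μ‖ ∧ ∃ c ≠ 0,
        (Matrix.diagonal (fun S => if p S then (x : ℂ) ^ w S else 0) * M).mulVec c = μ • c := by
  have hι : 0 < Fintype.card ι := by
    rw [Fintype.card_pos_iff]
    by_contra hne
    rw [not_nonempty_iff] at hne
    simp [tracePoly, Matrix.trace] at h
  obtain ⟨q, hq⟩ : ∃ q : ℂ[X], tracePoly p w m M = X ^ (tracePoly p w m M).natTrailingDegree * q :=
    X_pow_dvd_iff.mpr fun d hd => coeff_eq_zero_of_lt_natTrailingDegree hd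
  set t := (tracePoly p w m M).natTrailingDegree with ht
  have htv : t ≤ v := natTrailingDegree_le_of_ne_zero h
  have hq0 : q.eval 0 ≠ 0 := by
    have h1 : (tracePoly p w m M).coeff t ≠ 0 :=
      coeff_natTrailingDegree_ne_zero.mpr fun h0 => h (by rw [h0, coeff_zero])
    rw [hq] at h1
    have h2 := coeff_X_pow_mul q t 0
    rw [zero_add] at h2
    rwa [h2, coeff_zero_eq_eval_zero] at h1
  have heval (x : ℂ) : (tracePoly p w m M).eval x =
      ((Matrix.diagonal (fun S => if p S then x ^ w S else 0) * M) ^ m).trace := by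
    have h1 : (Matrix.diagonal (powerDamping p w) * M.map C).map (evalRingHom x) =
        Matrix.diagonal (fun S => if p S then x ^ w S else 0) * M := by
      ext S T
      simp only [Matrix.map_apply, Matrix.diagonal_mul, powerDamping, coe_evalRingHom, eval_mul,
        eval_C]
      split_ifs <;> simp
    rw [← coe_evalRingHom, tracePoly, AddMonoidHom.map_trace, ← h1, Matrix.map_pow]
  -- The trace is `x ^ t * q x` with `q 0 ≠ 0` and `t ≤ v < 3 m`. So for small `x` it exceeds `card
  -- ι * x ^ (t + 1)`, hence `card ι * x ^ (3 * m)`.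
  have hlim : Tendsto (fun x : ℝ => ‖q.eval (x : ℂ)‖ - Fintype.card ι * x) (nhdsWithin 0 (Set.Ioi 0))
      (nhds (‖q.eval 0‖ - Fintype.card ι * 0)) := by
    refine Tendsto.mono_left ?_ nhdsWithin_le_nhds
    have : Continuous fun x : ℝ => ‖q.eval (x : ℂ)‖ - Fintype.card ι * x := by fun_prop
    simpa using this.tendsto 0
  have hpos : 0 < ‖q.eval 0‖ - Fintype.card ι * 0 := by simpa using hq0
  filter_upwards [hlim.eventually (lt_mem_nhds hpos), self_mem_nhdsWithin,
    nhdsWithin_le_nhds (gt_mem_nhds one_pos)] with x hx hx0 hx1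
  have hx0' : 0 < x := hx0
  obtain ⟨z, ⟨c, hc, hz⟩, hr⟩ := exists_root_norm_ge (M := (Matrix.diagonal (fun S => if p S then (x : ℂ) ^ w S else 0) * M) ^ m)
    (r := x ^ (3 * m)) hι (by
      rw [← heval, hq, eval_mul, eval_pow, eval_X, norm_mul, norm_pow, Complex.norm_real,
        Real.norm_of_nonneg hx0'.le]
      calc (Fintype.card ι : ℝ) * x ^ (3 * m) ≤ Fintype.card ι * x ^ (t + 1) := by
            gcongr ?_ * ?_
            exact pow_le_pow_of_le_one hx0'.le hx1.le (by omega)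
        _ = x ^ t * (Fintype.card ι * x) := by ring
        _ ≤ x ^ t * ‖q.eval (x : ℂ)‖ := by gcongr; linarith)
  obtain ⟨μ, hμ, hev⟩ := Matrix.exists_eigenvalue_of_pow_mulVec _ hm hc hz
  refine ⟨μ, ?_, hev⟩
  refine le_of_pow_le_pow_left₀ hm.ne' (norm_nonneg _) ?_
  rwa [← norm_pow, hμ, ← pow_mul]

end SignedPerm

/-! ### Null sets of products of Haar measures -/

instance : SecondCountableTopology Gate :=
  haveI : SecondCountableTopology (Matrix (Fin 2) (Fin 2) ℂ) :=
    inferInstanceAs (SecondCountableTopology (Fin 2 → Fin 2 → ℂ))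
  TopologicalSpace.Subtype.secondCountableTopology _

section Rigid

open scoped Pointwise

variable {G : Type*} [Group G]

/-- Along every translate of a curve of the family, the set is negligible or everything. -/
def IsRigid (H : Set (ℝ → G)) (Z : Set G) : Prop :=
  ∀ h ∈ H, ∀ W W', volume {θ : ℝ | W * h θ * W' ∈ Z} = 0 ∨ ∀ θ, W * h θ * W' ∈ Z

/-- The points all of whose translates by elements of `S` are in `Z`. -/
def translateCore (S Z : Set G) : Set G := {g | ∀ s ∈ S, s * g ∈ Z}

theorem translateCore_mul (S T Z : Set G) :
    translateCore (S * T) Z = translateCore T (translateCore S Z) := by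
  ext g
  constructor
  · intro h t ht s hs
    rw [← mul_assoc]
    exact h _ (Set.mul_mem_mul hs ht)
  · rintro h _ ⟨s, hs, t, ht, rfl⟩
    rw [mul_assoc]
    exact h t ht s hs

/-- The core is an intersection of translates of `Z`: either the curve lies in all of them, or one
of them already meets it in a null set. -/
theorem IsRigid.translateCore {H : Set (ℝ → G)} {Z : Set G} (hZ : IsRigid H Z) (S : Set G) :
    IsRigid H (translateCore S Z) := by
  intro h hh W W'
  by_cases hall : ∀ s ∈ S, ∀ θ, s * W * h θ * W' ∈ Z
  · right
    intro θ s hs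
    simpa only [mul_assoc] using hall s hs θ
  · left
    push Not at hall
    obtain ⟨s, hs, θ, hθ⟩ := hall
    refine measure_mono_null (fun φ hφ => ?_)
      ((hZ h hh (s * W) W').resolve_right fun hc => hθ (hc θ))
    simpa only [mul_assoc, Set.mem_ofPred_eq] using hφ s hs

variable [TopologicalSpace G]

theorem isClosed_translateCore [ContinuousMul G] {Z : Set G} (hZ : IsClosed Z) (S : Set G) :
    IsClosed (translateCore S Z) := by
  have : translateCore S Z = ⋂ s ∈ S, (fun g => s * g) ⁻¹' Z := by
    ext g; simp [translateCore]
  rw [this]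
  exact isClosed_biInter fun s _ => hZ.preimage (continuous_const_mul s)

variable [MeasurableSpace G] {μ : Measure G} {H : Set (ℝ → G)}

/-- Closed rigid sets are up to null sets closed under translation by `S`. -/
def IsNegligiblySaturating (μ : Measure G) (H : Set (ℝ → G)) (S : Set G) : Prop :=
  ∀ Z, IsClosed Z → IsRigid H Z → μ Z = μ (translateCore S Z)

theorem isNegligiblySaturating_one : IsNegligiblySaturating μ H 1 := by
  intro Z _ _
  simp [translateCore]

/-- The core for the whole group is empty unless `Z` is everything, since translations act
transitively. -/
theorem IsNegligiblySaturating.measure_eq_zero (hS : IsNegligiblySaturating μ H Set.univ) {Z : Set G}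
    (hZ : IsClosed Z) (hr : IsRigid H Z) (hne : Z ≠ Set.univ) : μ Z = 0 := by
  rw [hS Z hZ hr]
  convert measure_empty
  · rw [Set.eq_empty_iff_forall_notMem]
    intro g hg
    refine hne (Set.eq_univ_of_forall fun z => ?_)
    simpa using hg (z * g⁻¹) (Set.mem_univ _)
  · infer_instance

theorem IsNegligiblySaturating.mul [ContinuousMul G] {S T : Set G} (hS : IsNegligiblySaturating μ H S)
    (hT : IsNegligiblySaturating μ H T) : IsNegligiblySaturating μ H (S * T) := by
  intro Z hc hr
  rw [translateCore_mul, ← hT _ (isClosed_translateCore hc S) (hr.translateCore S), ← hS Z hc hr]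

/-- Fubini for `h θ * g ∈ Z` with `θ` uniform on [0, 1]. Integrating over `g` first gives `μ Z` by
left invariance. Integrating over `θ` first gives 1 or 0, by rigidity, according to whether `g` lies
in the core. -/
theorem isNegligiblySaturating_range [ContinuousMul G]
    [SecondCountableTopology G] [BorelSpace G] [IsProbabilityMeasure μ] [μ.IsMulLeftInvariant]
    {h : ℝ → G} (hh : h ∈ H) (hc : Continuous h) : IsNegligiblySaturating μ H (Set.range h) := by
  intro Z hZ hr
  set ν : Measure ℝ := volume.restrict (Set.Icc 0 1) with hν
  have : IsProbabilityMeasure ν := ⟨by simp [hν]⟩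
  have hE : MeasurableSet {x : ℝ × G | h x.1 * x.2 ∈ Z} := by
    have : Continuous fun x : ℝ × G => h x.1 * x.2 := by fun_prop
    exact (hZ.preimage this).measurableSet
  have hcore : MeasurableSet (translateCore (Set.range h) Z) :=
    (isClosed_translateCore hZ _).measurableSet
  have h1 : (ν.prod μ) {x : ℝ × G | h x.1 * x.2 ∈ Z} = μ Z := by
    rw [Measure.prod_apply hE]
    have : ∀ θ : ℝ, μ (Prod.mk θ ⁻¹' {x : ℝ × G | h x.1 * x.2 ∈ Z}) = μ Z := fun θ =>
      measure_preimage_mul μ (h θ) Z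
    simp only [this, lintegral_const, measure_univ, mul_one]
  have h2 : (ν.prod μ) {x : ℝ × G | h x.1 * x.2 ∈ Z} = μ (translateCore (Set.range h) Z) := by
    rw [Measure.prod_apply_symm hE, ← lintegral_indicator_one hcore]
    refine lintegral_congr fun g => ?_
    by_cases hg : g ∈ translateCore (Set.range h) Z
    · rw [Set.indicator_of_mem hg, Pi.one_apply]
      have : (fun θ : ℝ => (θ, g)) ⁻¹' {x : ℝ × G | h x.1 * x.2 ∈ Z} = Set.univ := by
        ext θ
        simpa using hg (h θ) ⟨θ, rfl⟩
      rw [this, measure_univ]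
    · rw [Set.indicator_of_notMem hg]
      have h0 : volume {θ : ℝ | 1 * h θ * g ∈ Z} = 0 := by
        refine (hr h hh 1 g).resolve_right fun hc => hg ?_
        rintro _ ⟨θ, rfl⟩
        simpa using hc θ
      refine le_antisymm ((Measure.restrict_apply_le _ _).trans (le_of_eq ?_)) zero_le
      simpa using h0
  rw [← h1, h2]

end Rigid

/-! ### Curves that generate the single-qubit gates -/

/-- The gates that change the phase of the first basis vector. -/
def phaseLeft (θ : ℝ) : Gate :=
  ⟨!![Complex.exp (θ * Complex.I), 0; 0, 1], by
    rw [Matrix.mem_unitaryGroup_iff]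
    ext i j
    fin_cases i <;> fin_cases j <;>
      simp [Matrix.mul_apply, Matrix.star_apply, ← Complex.exp_conj, ← Complex.exp_add]⟩

/-- The gates that change the phase of the second basis vector. -/
def phaseRight (θ : ℝ) : Gate :=
  ⟨!![1, 0; 0, Complex.exp (θ * Complex.I)], by
    rw [Matrix.mem_unitaryGroup_iff]
    ext i j
    fin_cases i <;> fin_cases j <;>
      simp [Matrix.mul_apply, Matrix.star_apply, ← Complex.exp_conj, ← Complex.exp_add]⟩

/-- The real rotations. -/
def realRotation (θ : ℝ) : Gate :=
  ⟨!![Complex.cos θ, -Complex.sin θ; Complex.sin θ, Complex.cos θ], by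
    have := Complex.sin_sq_add_cos_sq θ
    rw [Matrix.mem_unitaryGroup_iff]
    ext i j
    fin_cases i <;> fin_cases j <;>
      simp [Matrix.mul_apply, Matrix.star_apply, ← Complex.cos_conj, ← Complex.sin_conj] <;>
      first | linear_combination this | ring⟩

theorem exists_eq_phaseRight {W : Gate} (h0 : (W : Matrix (Fin 2) (Fin 2) ℂ) 0 0 = 1)
    (h1 : (W : Matrix (Fin 2) (Fin 2) ℂ) 1 0 = 0) : ∃ θ, phaseRight θ = W := by
  have h := Matrix.mem_unitaryGroup_iff.mp W.2
  have e00 := congrFun (congrFun h 0) 0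
  have e11 := congrFun (congrFun h 1) 1
  simp only [Matrix.mul_apply, Matrix.star_apply, Fin.sum_univ_two, h0, h1, Matrix.one_apply_eq,
    Complex.star_def, Complex.mul_conj] at e00 e11
  have n01 : (W : Matrix (Fin 2) (Fin 2) ℂ) 0 1 = 0 := by simpa using e00
  simp only [map_zero, Complex.ofReal_zero, zero_add] at e11
  have n11 : ‖(W : Matrix (Fin 2) (Fin 2) ℂ) 1 1‖ = 1 := by
    rw [Complex.normSq_eq_norm_sq] at e11
    exact (pow_eq_one_iff_of_nonneg (norm_nonneg _) two_ne_zero).mp (by exact_mod_cast e11)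
  refine ⟨Complex.arg ((W : Matrix (Fin 2) (Fin 2) ℂ) 1 1), Subtype.ext ?_⟩
  have h11 := Complex.norm_mul_exp_arg_mul_I ((W : Matrix (Fin 2) (Fin 2) ℂ) 1 1)
  rw [n11, Complex.ofReal_one, one_mul] at h11
  ext i j
  fin_cases i <;> fin_cases j <;> simp [phaseRight, h0, h1, n01, h11]

open scoped Pointwise in
-- Euler angles. The first three factors reproduce the first column of `V`: the moduli by the angle
-- `arccos ‖V 0 0‖`, the arguments by the two phases. What remains fixes the first basis vector and
-- is a phase on the second.
theorem range_mul_range_eq_univ :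
    Set.range phaseLeft * Set.range phaseRight * Set.range realRotation * Set.range phaseRight =
      (Set.univ : Set Gate) := by
  refine Set.eq_univ_of_forall fun V => ?_
  have h := congrFun (congrFun (Matrix.mem_unitaryGroup_iff'.mp V.2) 0) 0
  simp only [Matrix.mul_apply, Matrix.star_apply, Fin.sum_univ_two, Matrix.one_apply_eq,
    Complex.star_def, mul_comm (starRingEnd ℂ _), Complex.mul_conj, Complex.normSq_eq_norm_sq] at h
  set z := (V : Matrix (Fin 2) (Fin 2) ℂ) 0 0 with hz
  set w := (V : Matrix (Fin 2) (Fin 2) ℂ) 1 0 with hw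
  have hzw : ‖z‖ ^ 2 + ‖w‖ ^ 2 = 1 := by exact_mod_cast h
  have hcos : Real.cos (Real.arccos ‖z‖) = ‖z‖ :=
    Real.cos_arccos (by linarith [norm_nonneg z]) (by nlinarith [norm_nonneg z, sq_nonneg ‖w‖])
  have hsin : Real.sin (Real.arccos ‖z‖) = ‖w‖ := by
    rw [Real.sin_arccos, ← hzw, add_sub_cancel_left, Real.sqrt_sq (norm_nonneg w)]
  set U := phaseLeft z.arg * phaseRight w.arg * realRotation (Real.arccos ‖z‖) with hU
  have hval : (U : Matrix (Fin 2) (Fin 2) ℂ) = (phaseLeft z.arg : Matrix (Fin 2) (Fin 2) ℂ) *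
    phaseRight w.arg * realRotation (Real.arccos ‖z‖) := rfl
  have u0 : (U : Matrix (Fin 2) (Fin 2) ℂ) 0 0 = z := by
    rw [hval]
    simp only [phaseLeft, phaseRight, realRotation, Matrix.mul_apply, Fin.sum_univ_two]
    simp [← Complex.ofReal_cos, hcos, mul_comm _ (‖z‖ : ℂ), Complex.norm_mul_exp_arg_mul_I]
  have u1 : (U : Matrix (Fin 2) (Fin 2) ℂ) 1 0 = w := by
    rw [hval]
    simp only [phaseLeft, phaseRight, realRotation, Matrix.mul_apply, Fin.sum_univ_two]
    simp [← Complex.ofReal_sin, hsin, mul_comm _ (‖w‖ : ℂ), Complex.norm_mul_exp_arg_mul_I]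
  have hcol (i : Fin 2) : ((U⁻¹ * V : Gate) : Matrix (Fin 2) (Fin 2) ℂ) i 0 =
      ((U⁻¹ * U : Gate) : Matrix (Fin 2) (Fin 2) ℂ) i 0 := by
    rw [Submonoid.coe_mul, Submonoid.coe_mul, Matrix.mul_apply, Matrix.mul_apply, Fin.sum_univ_two,
      Fin.sum_univ_two, u0, u1]
  obtain ⟨θ, hθ⟩ := exists_eq_phaseRight (W := U⁻¹ * V)
    (by rw [hcol, inv_mul_cancel]; simp) (by rw [hcol, inv_mul_cancel]; simp)
  refine ⟨U, ⟨_, ⟨_, ⟨_, rfl⟩, _, ⟨_, rfl⟩, rfl⟩, _, ⟨_, rfl⟩, rfl⟩, phaseRight θ, ⟨θ, rfl⟩, ?_⟩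
  simp [hθ]

/-- The single-site curves. -/
def siteCurves (ι : Type*) [DecidableEq ι] : Set (ℝ → ι → Gate) :=
  {c | ∃ i : ι, ∃ h ∈ ({phaseLeft, phaseRight, realRotation} : Set (ℝ → Gate)),
    c = fun θ => Pi.mulSingle i (h θ)}

/-- A curve of gates with analytic matrix elements. -/
def IsAnalyticCurve {ι : Type*} (c : ℝ → ι → Gate) : Prop :=
  ∀ i a b, AnalyticOnNhd ℝ (fun θ => (c θ i : Matrix (Fin 2) (Fin 2) ℂ) a b) Set.univ

theorem IsAnalyticCurve.mul {ι : Type*} {c d : ℝ → ι → Gate} (hc : IsAnalyticCurve c)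
    (hd : IsAnalyticCurve d) : IsAnalyticCurve fun θ => c θ * d θ := by
  intro i a b
  simp only [Pi.mul_apply, Submonoid.coe_mul, Matrix.mul_apply]
  exact Finset.analyticOnNhd_fun_sum _ fun k _ => (hc i a k).mul (hd i k b)

theorem isAnalyticCurve_const {ι : Type*} (W : ι → Gate) : IsAnalyticCurve fun _ => W :=
  fun _ _ _ => analyticOnNhd_const

theorem analyticOnNhd_complex_cos : AnalyticOnNhd ℝ (fun θ : ℝ => Complex.cos θ) Set.univ :=
  fun θ _ => by
    simp only [← Complex.ofReal_cos]
    exact (Complex.ofRealCLM.analyticAt _).comp (Real.analyticAt_cos (x := θ))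

theorem analyticOnNhd_complex_sin : AnalyticOnNhd ℝ (fun θ : ℝ => Complex.sin θ) Set.univ :=
  fun θ _ => by
    simp only [← Complex.ofReal_sin]
    exact (Complex.ofRealCLM.analyticAt _).comp (Real.analyticAt_sin (x := θ))

theorem analyticOnNhd_exp_mul_I :
    AnalyticOnNhd ℝ (fun θ : ℝ => Complex.exp (θ * Complex.I)) Set.univ := by
  simp only [Complex.exp_mul_I]
  exact analyticOnNhd_complex_cos.add (analyticOnNhd_complex_sin.mul analyticOnNhd_const)

theorem isAnalyticCurve_of_mem {ι : Type*} [DecidableEq ι] {c : ℝ → ι → Gate}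
    (hc : c ∈ siteCurves ι) : IsAnalyticCurve c := by
  obtain ⟨i, h, hh, rfl⟩ := hc
  intro j a b
  by_cases hj : j = i
  · subst hj
    simp only [Pi.mulSingle_eq_same]
    rcases hh with rfl | rfl | rfl <;> fin_cases a <;> fin_cases b <;>
      simp only [phaseLeft, phaseRight, realRotation] <;>
      first
        | exact analyticOnNhd_exp_mul_I
        | exact analyticOnNhd_const
        | exact analyticOnNhd_complex_cos
        | exact analyticOnNhd_complex_sin
        | exact analyticOnNhd_complex_sin.neg
  · simp only [Pi.mulSingle_eq_of_ne hj]
    exact analyticOnNhd_const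

/-- Identity theorem: the zeros of a nonzero analytic function on the line are discrete, hence null.
-/
theorem volume_zeros_eq_zero {f : ℝ → ℂ} (hf : AnalyticOnNhd ℝ f Set.univ) :
    volume {θ | f θ = 0} = 0 ∨ ∀ θ, f θ = 0 := by
  rcases hf.eqOn_zero_or_eventually_ne_zero_of_preconnected isPreconnected_univ with h | h
  · exact .inr fun θ => h (Set.mem_univ θ)
  · left
    have := ae_restrict_le_codiscreteWithin (μ := (volume : Measure ℝ)) MeasurableSet.univ h
    rw [Measure.restrict_univ] at this
    exact (measure_eq_zero_iff_ae_notMem).mpr this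

theorem continuous_of_mem {h : ℝ → Gate}
    (hh : h ∈ ({phaseLeft, phaseRight, realRotation} : Set (ℝ → Gate))) : Continuous h := by
  refine continuous_induced_rng.mpr (continuous_matrix fun a b => ?_)
  rcases hh with rfl | rfl | rfl <;> fin_cases a <;> fin_cases b <;>
    simp [phaseLeft, phaseRight, realRotation] <;> fun_prop

open scoped Pointwise in
-- The property is stable under products of sets. Four curves exhaust the gates of one site, and
-- finitely many sites exhaust the circuit.
theorem isNegligiblySaturating_univ (ι : Type*) [Fintype ι] [DecidableEq ι] :
    IsNegligiblySaturating (Measure.pi fun _ : ι => haarGate) (siteCurves ι) Set.univ := by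
  have hsite (i : ι) : IsNegligiblySaturating (Measure.pi fun _ : ι => haarGate) (siteCurves ι)
      ((MonoidHom.mulSingle (fun _ : ι => Gate) i) '' Set.univ) := by
    rw [← range_mul_range_eq_univ, Set.image_mul, Set.image_mul, Set.image_mul]
    have key {h : ℝ → Gate} (hh : h ∈ ({phaseLeft, phaseRight, realRotation} : Set (ℝ → Gate))) :
        IsNegligiblySaturating (Measure.pi fun _ : ι => haarGate) (siteCurves ι)
          ((MonoidHom.mulSingle (fun _ : ι => Gate) i) '' Set.range h) := by
      rw [← Set.range_comp]
      refine isNegligiblySaturating_range ⟨i, h, hh, rfl⟩ ?_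
      exact (continuous_mulSingle i).comp (continuous_of_mem hh)
    exact (((key (by simp)).mul (key (by simp))).mul (key (by simp))).mul (key (by simp))
  have hfin (s : Finset ι) : IsNegligiblySaturating (Measure.pi fun _ : ι => haarGate) (siteCurves ι)
      {g | ∀ i ∉ s, g i = 1} := by
    induction s using Finset.induction_on with
    | empty =>
      convert isNegligiblySaturating_one
      ext g
      simp [funext_iff]
    | insert i s hi ih =>
      convert (hsite i).mul ih
      ext g
      constructor
      · intro hg
        refine ⟨Pi.mulSingle i (g i), ⟨g i, trivial, rfl⟩, Function.update g i 1, fun j hj => ?_, ?_⟩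
        · by_cases hji : j = i
          · subst hji; simp
          · rw [Function.update_of_ne hji]
            exact hg j (by simp [hji, hj])
        · funext j
          by_cases hji : j = i
          · subst hji; simp
          · simp [hji]
      · rintro ⟨_, ⟨u, -, rfl⟩, g', hg', rfl⟩ j hj
        rw [Finset.mem_insert, not_or] at hj
        simp [hj.1, hg' j hj.2]
  convert hfin Finset.univ
  simp

/-- An analytic function of Haar-random gates that is not identically zero is almost surely not
zero. -/
theorem ae_ne_zero_of_analytic {ι : Type*} [Fintype ι] [DecidableEq ι] {F : (ι → Gate) → ℂ}
    (hF : Continuous F) (hA : ∀ c, IsAnalyticCurve c → AnalyticOnNhd ℝ (fun θ => F (c θ)) Set.univ)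
    {V : ι → Gate} (hV : F V ≠ 0) : ∀ᵐ W ∂(Measure.pi fun _ : ι => haarGate), F W ≠ 0 := by
  have h := (isNegligiblySaturating_univ ι).measure_eq_zero (Z := {W | F W = 0})
    (isClosed_eq hF continuous_const)
    (fun c hc W W' => volume_zeros_eq_zero (hA _
      (((isAnalyticCurve_const W).mul (isAnalyticCurve_of_mem hc)).mul (isAnalyticCurve_const W'))))
    (fun hu => hV (hu.symm ▸ Set.mem_univ V : V ∈ {W | F W = 0}))
  simpa [ae_iff] using h

/-! ### Clifford rotations -/

/-- The action of some Clifford rotations on the labels of the Pauli matrices. -/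
def cliffordLabels : List (Fin 4 → Fin 4) :=
  [![0, 1, 2, 3], ![0, 3, 2, 1], ![0, 1, 3, 2], ![0, 2, 1, 3], ![0, 3, 1, 2]]

theorem injective_of_mem_cliffordLabels {τ : Fin 4 → Fin 4} (h : τ ∈ cliffordLabels) :
    Function.Injective τ := by
  simp only [cliffordLabels, List.mem_cons, List.not_mem_nil, or_false] at h
  intro p q
  rcases h with rfl | rfl | rfl | rfl | rfl <;> revert p q <;> decide

theorem apply_zero_of_mem_cliffordLabels {τ : Fin 4 → Fin 4} (h : τ ∈ cliffordLabels) :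
    τ 0 = 0 := by
  simp only [cliffordLabels, List.mem_cons, List.not_mem_nil, or_false] at h
  rcases h with rfl | rfl | rfl | rfl | rfl <;> rfl

theorem isSignedMap_halfTurn {x y z : ℝ} (h : x ^ 2 + y ^ 2 + z ^ 2 = 1) {τ : Fin 4 → Fin 4}
    (hτ : ∀ p q : Fin 4, p ≠ 0 → q ≠ 0 → (2 * (![0, x, y, z] : Fin 4 → ℝ) p *
      (![0, x, y, z] : Fin 4 → ℝ) q - if p = q then x ^ 2 + y ^ 2 + z ^ 2 else 0) =
        if p = τ q then (if τ q = q then -1 else 1) else 0) (h0 : ∀ q, τ q = 0 ↔ q = 0) :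
    IsSignedMap (Matrix.of (transfer (halfTurn x y z))) τ := by
  have hU : halfTurn x y z = ((⟨halfTurn x y z, halfTurn_mem x y z h⟩ : Gate) :
    Matrix (Fin 2) (Fin 2) ℂ) := rfl
  refine ⟨fun q => if q = 0 then 1 else if τ q = q then -1 else 1, fun q => ?_, fun p q => ?_⟩
  · dsimp only
    split_ifs <;> norm_num
  · dsimp only
    rw [Matrix.of_apply]
    by_cases hq : q = 0
    · subst hq
      rw [hU, transfer_zero_right, (h0 0).mpr rfl]
      simp
    by_cases hp : p = 0
    · subst hp
      rw [hU, transfer_zero_left, if_neg hq, if_neg fun e => hq ((h0 q).mp e.symm)]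
    · rw [transfer_eq_bloch, bloch_halfTurn x y z p q hp hq, hτ p q hp hq]
      simp only [if_neg hq]
      split_ifs <;> simp

theorem isSignedMap_transfer_one : IsSignedMap (Matrix.of (transfer 1)) ![0, 1, 2, 3] := by
  have h : (![0, 1, 2, 3] : Fin 4 → Fin 4) = id := by decide
  refine ⟨1, by simp, fun p q => ?_⟩
  rw [Matrix.of_apply, transfer_one, h]
  rfl

theorem IsSignedMap.transfer_mul {A B : Matrix (Fin 2) (Fin 2) ℂ} {f g : Fin 4 → Fin 4}
    (hA : IsSignedMap (Matrix.of (transfer A)) f) (hB : IsSignedMap (Matrix.of (transfer B)) g) :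
    IsSignedMap (Matrix.of (transfer (A * B))) (f ∘ g) := by
  have : (Matrix.of (transfer (A * B))) = Matrix.of (transfer A) * Matrix.of (transfer B) := by
    ext p q
    rw [Matrix.of_apply, HaarFloquet.transfer_mul, Matrix.mul_apply]
    rfl
  rw [this]
  exact hA.mul hB

/-- The half turn about the bisector of two axes exchanges them and reverses the third; the cyclic
permutation is a product of two such turns. -/
theorem exists_gate_of_mem_cliffordLabels {τ : Fin 4 → Fin 4} (h : τ ∈ cliffordLabels) :
    ∃ V : Gate, IsSignedMap (Matrix.of (transfer V)) τ := by
  have hs : (√2⁻¹ : ℝ) ^ 2 = 2⁻¹ := Real.sq_sqrt (by norm_num)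
  have hs' : (2 : ℝ) * √2⁻¹ * √2⁻¹ = 1 := by rw [mul_assoc, ← sq, hs]; norm_num
  have xz : IsSignedMap (Matrix.of (transfer (halfTurn √2⁻¹ 0 √2⁻¹))) ![0, 3, 2, 1] := by
    refine isSignedMap_halfTurn (by rw [hs]; norm_num) (fun p q hp hq => ?_) (by decide)
    fin_cases p <;> fin_cases q <;> simp_all <;> norm_num
  have yz : IsSignedMap (Matrix.of (transfer (halfTurn 0 √2⁻¹ √2⁻¹))) ![0, 1, 3, 2] := by
    refine isSignedMap_halfTurn (by rw [hs]; norm_num) (fun p q hp hq => ?_) (by decide)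
    fin_cases p <;> fin_cases q <;> simp_all <;> norm_num
  have xy : IsSignedMap (Matrix.of (transfer (halfTurn √2⁻¹ √2⁻¹ 0))) ![0, 2, 1, 3] := by
    refine isSignedMap_halfTurn (by rw [hs]; norm_num) (fun p q hp hq => ?_) (by decide)
    fin_cases p <;> fin_cases q <;> simp_all <;> norm_num
  have gxz := halfTurn_mem √2⁻¹ 0 √2⁻¹ (by rw [hs]; norm_num)
  have gyz := halfTurn_mem 0 √2⁻¹ √2⁻¹ (by rw [hs]; norm_num)
  have gxy := halfTurn_mem √2⁻¹ √2⁻¹ 0 (by rw [hs]; norm_num)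
  simp only [cliffordLabels, List.mem_cons, List.not_mem_nil, or_false] at h
  rcases h with rfl | rfl | rfl | rfl | rfl
  · exact ⟨1, isSignedMap_transfer_one⟩
  · exact ⟨⟨_, gxz⟩, xz⟩
  · exact ⟨⟨_, gyz⟩, yz⟩
  · exact ⟨⟨_, gxy⟩, xy⟩
  · refine ⟨⟨_, gxz⟩ * ⟨_, gyz⟩, ?_⟩
    have h : (![0, 3, 1, 2] : Fin 4 → Fin 4) = ![0, 3, 2, 1] ∘ ![0, 1, 3, 2] := by decide
    rw [h]
    exact xz.transfer_mul yz

section Orbit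

variable {N : ℕ}

/-- A layer of Clifford rotations as a map of Pauli strings. -/
def relabel (σ : ZMod N → Fin 4 → Fin 4) (S : PauliString N) : PauliString N := fun j => σ j (S j)

theorem relabel_injective {σ : ZMod N → Fin 4 → Fin 4} (h : ∀ j, σ j ∈ cliffordLabels) :
    Function.Injective (relabel σ) := fun _ _ e =>
  funext fun j => injective_of_mem_cliffordLabels (h j) (congrFun e j)

variable [NeZero N]

theorem isSignedMap_rotMatrix {D : Finset (ZMod N)} {V : ZMod N → Gate}
    {σ : ZMod N → Fin 4 → Fin 4}
    (h : ∀ j, IsSignedMap (Matrix.of (transfer (siteGate D V j))) (σ j)) :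
    IsSignedMap (rotMatrix D V) (relabel σ) := by
  choose s hs hM using h
  simp only [Matrix.of_apply] at hM
  refine ⟨fun T => ∏ j, s j (T j), fun T => ?_, fun S T => ?_⟩
  · rw [← Finset.prod_pow]
    exact Finset.prod_eq_one fun j _ => hs j _
  · rw [rotMatrix, Matrix.of_apply]
    simp only [hM, Finset.prod_ite_zero, Finset.mem_univ, true_imp_iff]
    exact if_congr funext_iff.symm rfl rfl

theorem isSignedMap_layerMatrix (p : ℕ) : IsSignedMap (layerMatrix N p) (layerMap p) := by
  refine ⟨layerSign p, fun T => ?_, fun S T => rfl⟩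
  rw [layerSign, ← Finset.prod_pow]
  refine Finset.prod_eq_one fun j _ => ?_
  unfold gateSign
  split_ifs <;> norm_num

/-- One period of a Clifford circuit as a map of Pauli strings. -/
def cliffordPeriod (σ : Fin 2 → ZMod N → Fin 4 → Fin 4) (S : PauliString N) : PauliString N :=
  relabel (σ 1) (layerMap 0 (relabel (σ 0) (layerMap 1 S)))

theorem cliffordPeriod_injective (hN : Even N) {σ : Fin 2 → ZMod N → Fin 4 → Fin 4}
    (h : ∀ l j, σ l j ∈ cliffordLabels) : Function.Injective (cliffordPeriod σ) := fun _ _ e =>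
  layerMap_injective hN (by norm_num) <| relabel_injective (h 0) <|
    layerMap_injective hN (by norm_num) <| relabel_injective (h 1) e

/-- A light orbit of a Clifford circuit contributes to the trace of a power. -/
theorem exists_coeff_tracePoly_ne_zero (hN : Even N) (D : Finset (ZMod N))
    {σ : Fin 2 → ZMod N → Fin 4 → Fin 4} (h : ∀ l j, σ l j ∈ cliffordLabels)
    (hD : ∀ l, ∀ j ∉ D, σ l j = ![0, 1, 2, 3]) {S : ℕ → PauliString N}
    (hS : ∀ k, cliffordPeriod σ (S k) = S (k + 1)) (h0 : ∀ k, S k ≠ 0) (hw : ∀ k, weight (S k) ≤ 3)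
    (hw₀ : weight (S 0) ≤ 2) : ∃ V : Fin 2 → ZMod N → Gate, ∃ m v : ℕ, 0 < m ∧ v < 3 * m ∧
      (tracePoly (fun S : PauliString N => S ≠ 0) weight m (floquetMatrix D V)).coeff v ≠ 0 := by
  choose V hV using fun l j => exists_gate_of_mem_cliffordLabels (h l j)
  have hsite (l : Fin 2) (j : ZMod N) :
      IsSignedMap (Matrix.of (transfer (siteGate D (V l) j))) (σ l j) := by
    by_cases hj : j ∈ D
    · rw [siteGate, if_pos hj]; exact hV l j
    · rw [siteGate, if_neg hj, hD l j hj]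
      exact isSignedMap_transfer_one
  have hM : IsSignedMap (floquetMatrix D V) (cliffordPeriod σ) :=
    (((isSignedMap_rotMatrix (hsite 1)).mul (isSignedMap_layerMatrix 0)).mul
      (isSignedMap_rotMatrix (hsite 0))).mul (isSignedMap_layerMatrix 1)
  have hit (k : ℕ) : (cliffordPeriod σ)^[k] (S 0) = S k := by
    induction k with
    | zero => rfl
    | succ k ih => rw [Function.iterate_succ_apply', ih, hS]
  exact ⟨V, hM.exists_coeff_tracePoly_ne_zero (cliffordPeriod_injective hN h)
    (fun k => (hit k).symm ▸ h0 k) (fun k => (hit k).symm ▸ hw k) hw₀⟩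

end Orbit

/-! ### Light orbits of Clifford circuits -/

section WindowOrbit

variable {N : ℕ}

/-- The rotations at the sites where a soliton turns. -/
def turnLabels (l c r : Bool) : Fin 4 → Fin 4 :=
  if c then ![0, 1, 2, 3] else if l then if r then ![0, 3, 1, 2] else ![0, 1, 3, 2]
  else ![0, 2, 1, 3]

/-- The rotations at the sites where a soliton passes straight. -/
def passLabels (c : Bool) : Fin 4 → Fin 4 := if c then ![0, 1, 2, 3] else ![0, 3, 2, 1]

theorem turnLabels_mem (l c r : Bool) : turnLabels l c r ∈ cliffordLabels := by
  unfold turnLabels cliffordLabels; split_ifs <;> simp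

theorem passLabels_mem (c : Bool) : passLabels c ∈ cliffordLabels := by
  unfold passLabels cliffordLabels; split_ifs <;> simp

/-- The label of the rear end of the soliton. -/
def rearLabel (c : Bool) : Fin 4 := if c then 3 else 2

/-- The label of the middle of the soliton. -/
def midLabel (r : Bool) : Fin 4 := if r then 0 else 3

/-- The label of the front end of the soliton. -/
def frontLabel (r : Bool) : Fin 4 := if r then 3 else 1

/-- The six Booleans say which of the sites `b - 1, …, b + 4` are undoped, and the two conditions
are the local pattern. The conclusion follows the soliton at `b` through both layers: the rear
empties twice, and the labels of the soliton at `b + 2` come out. -/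
theorem soliton_labels : ∀ u u₀ u₁ u₂ u₃ u₄ : Bool,
    (u && u₀ || u₀ && u₁ || u₁ && u₂ || u₂ && u₃ || u₃ && u₄) = false →
    ((u || u₀ || u₁) && (u₀ || u₁ || u₂) && (u₁ || u₂ || u₃) && (u₂ || u₃ || u₄)) = true →
    gateL (turnLabels u u₀ u₁ (rearLabel u₀)) (passLabels u₁ (midLabel u₁)) = 0 ∧
    gateL (turnLabels u₀ u₁ u₂ (gateR (turnLabels u u₀ u₁ (rearLabel u₀))
        (passLabels u₁ (midLabel u₁))))
      (passLabels u₂ (gateL (turnLabels u₁ u₂ u₃ (frontLabel u₁)) 0)) = 0 ∧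
    gateR (turnLabels u₀ u₁ u₂ (gateR (turnLabels u u₀ u₁ (rearLabel u₀))
        (passLabels u₁ (midLabel u₁))))
      (passLabels u₂ (gateL (turnLabels u₁ u₂ u₃ (frontLabel u₁)) 0)) = rearLabel u₂ ∧
    gateL (turnLabels u₂ u₃ u₄ (gateR (turnLabels u₁ u₂ u₃ (frontLabel u₁)) 0)) 0 = midLabel u₃ ∧
    gateR (turnLabels u₂ u₃ u₄ (gateR (turnLabels u₁ u₂ u₃ (frontLabel u₁)) 0)) 0 =
      frontLabel u₃ := by
  decide

/-- The rotations along which the right-moving soliton is a single string. -/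
def solitonLabels (D : Finset (ZMod N)) (l : Fin 2) (j : ZMod N) : Fin 4 → Fin 4 :=
  if j.val % 2 = l then turnLabels (decide (j - 1 ∉ D)) (decide (j ∉ D)) (decide (j + 1 ∉ D))
  else passLabels (decide (j ∉ D))

theorem solitonLabels_mem (D : Finset (ZMod N)) (l : Fin 2) (j : ZMod N) :
    solitonLabels D l j ∈ cliffordLabels := by
  unfold solitonLabels
  split_ifs
  · exact turnLabels_mem _ _ _
  · exact passLabels_mem _

variable [NeZero N]

theorem layerMap_window_shift (hN : Even N) (h4 : 4 ≤ N) {p : ℕ} {b : ZMod N} (hb : b.val % 2 = p)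
    {x₀ x₁ x₂ : Fin 4} (h : gateL x₀ x₁ = 0) : layerMap p (window b (labels [x₀, x₁, x₂])) =
      window (b + 1) (labels [gateR x₀ x₁, gateL x₂ 0, gateR x₂ 0]) := by
  rw [← labels_append_zero, layerMap_window₄ hN hb, h, window_shift_one h4]

theorem relabel_window {σ : ZMod N → Fin 4 → Fin 4} (h : ∀ j, σ j 0 = 0) (b : ZMod N)
    (x₀ x₁ x₂ : Fin 4) : relabel σ (window b (labels [x₀, x₁, x₂])) =
      window b (labels [σ b x₀, σ (b + 1) x₁, σ (b + 2) x₂]) := by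
  refine string_ext b fun k hk => ?_
  rw [relabel, window_apply b _ hk, window_apply b _ hk]
  rcases k with _ | _ | _ | k <;> simp [labels, h]

theorem weight_window_le (b : ZMod N) (x₀ x₁ x₂ : Fin 4) :
    weight (window b (labels [x₀, x₁, x₂])) ≤ if x₁ = 0 then 2 else 3 := by
  have h : (Finset.univ.filter fun j => window b (labels [x₀, x₁, x₂]) j ≠ 0) ⊆
      if x₁ = 0 then {b, b + 2} else {b, b + 1, b + 2} := by
    intro j hj
    obtain ⟨k, hk, rfl⟩ := exists_eq_add b j
    rw [Finset.mem_filter, window_apply b _ hk] at hj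
    rcases k with _ | _ | _ | k
    · split_ifs <;> simp
    · rcases eq_or_ne x₁ 0 with h0 | h0
      · simp [labels, h0] at hj
      · simp [h0]
    · split_ifs <;> simp
    · simp [labels] at hj
  refine (Finset.card_le_card h).trans ?_
  split_ifs
  · exact Finset.card_le_two
  · exact Finset.card_le_three

theorem window_ne_zero (h4 : 4 ≤ N) (b : ZMod N) {x₀ x₁ x₂ : Fin 4} (h : x₂ ≠ 0) :
    window b (labels [x₀, x₁, x₂]) ≠ 0 := by
  intro e
  have := window_apply b (labels [x₀, x₁, x₂]) (k := 2) (by omega)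
  rw [e] at this
  exact h this.symm

/-- The soliton with rear end `b` before the second rotations. -/
def solitonString (D : Finset (ZMod N)) (b : ZMod N) : PauliString N :=
  window b (labels [rearLabel (decide (b ∉ D)), midLabel (decide (b + 1 ∉ D)),
    frontLabel (decide (b + 1 ∉ D))])

theorem cliffordPeriod_solitonString (hN : Even N) (h4 : 4 ≤ N) {D : Finset (ZMod N)}
    (hD : ∀ j, (j ∉ D → j + 1 ∈ D) ∧ (j ∉ D ∨ j + 1 ∉ D ∨ j + 2 ∉ D)) {b : ZMod N}
    (hb : b.val % 2 = 1) :
    cliffordPeriod (solitonLabels D) (relabel (solitonLabels D 1) (solitonString D b)) =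
      relabel (solitonLabels D 1) (solitonString D (b + 2)) := by
  have hz (l : Fin 2) (j : ZMod N) : solitonLabels D l j 0 = 0 :=
    apply_zero_of_mem_cliffordLabels (solitonLabels_mem D l j)
  have e1 : (b + 1).val % 2 = 0 := by have := val_add_one_mod_two hN b; omega
  have e2 : (b + 1 + 1).val % 2 = 1 := by have := val_add_one_mod_two hN (b + 1); omega
  have e3 : (b + 1 + 1 + 1).val % 2 = 0 := by have := val_add_one_mod_two hN (b + 1 + 1); omega
  have p2 : b + 2 = b + 1 + 1 := by ring
  have p3 : b + 1 + 2 = b + 1 + 1 + 1 := by ring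
  have s0 : solitonLabels D 1 b = turnLabels (decide (b - 1 ∉ D)) (decide (b ∉ D))
      (decide (b + 1 ∉ D)) := by rw [solitonLabels, if_pos (by simpa using hb)]
  have s1 : solitonLabels D 1 (b + 1) = passLabels (decide (b + 1 ∉ D)) := by
    rw [solitonLabels, if_neg (by simp [e1])]
  have s2 : solitonLabels D 1 (b + 1 + 1) = turnLabels (decide (b + 1 ∉ D))
      (decide (b + 1 + 1 ∉ D)) (decide (b + 1 + 1 + 1 ∉ D)) := by
    rw [solitonLabels, if_pos (by simpa using e2), add_sub_cancel_right]
  have r1 : solitonLabels D 0 (b + 1) = turnLabels (decide (b ∉ D)) (decide (b + 1 ∉ D))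
      (decide (b + 1 + 1 ∉ D)) := by
    rw [solitonLabels, if_pos (by simpa using e1), add_sub_cancel_right]
  have r2 : solitonLabels D 0 (b + 1 + 1) = passLabels (decide (b + 1 + 1 ∉ D)) := by
    rw [solitonLabels, if_neg (by simp [e2])]
  have r3 : solitonLabels D 0 (b + 1 + 1 + 1) = turnLabels (decide (b + 1 + 1 ∉ D))
      (decide (b + 1 + 1 + 1 ∉ D)) (decide (b + 1 + 1 + 1 + 1 ∉ D)) := by
    rw [solitonLabels, if_pos (by simpa using e3), add_sub_cancel_right]
  obtain ⟨l1, l2, l3, l4, l5⟩ := soliton_labels (decide (b - 1 ∉ D)) (decide (b ∉ D))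
    (decide (b + 1 ∉ D)) (decide (b + 1 + 1 ∉ D)) (decide (b + 1 + 1 + 1 ∉ D))
    (decide (b + 1 + 1 + 1 + 1 ∉ D))
    (by
      have h := (hD (b - 1)).1
      rw [sub_add_cancel] at h
      simpa using ⟨⟨⟨⟨h, (hD b).1⟩, (hD (b + 1)).1⟩, (hD (b + 1 + 1)).1⟩, (hD (b + 1 + 1 + 1)).1⟩)
    (by
      have h := (hD (b - 1)).2
      have h1 := (hD b).2
      have h2 := (hD (b + 1)).2
      have h3 := (hD (b + 1 + 1)).2
      rw [sub_add_cancel, show b - 1 + 2 = b + 1 by ring] at h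
      rw [p2] at h1
      rw [p3] at h2
      rw [show b + 1 + 1 + 2 = b + 1 + 1 + 1 + 1 by ring] at h3
      simp only [Bool.and_eq_true, Bool.or_eq_true, decide_eq_true_eq, or_assoc]
      exact ⟨⟨⟨h, h1⟩, h2⟩, h3⟩)
  rw [solitonString, relabel_window (hz 1), cliffordPeriod, p2, s0, s1, s2,
    layerMap_window_shift hN h4 hb l1, relabel_window (hz 0), p3, show b + 1 + 1 = b + 1 + 1 from rfl,
    r1, r2, r3, layerMap_window_shift hN h4 e1 l2, l3, l4, l5]
  rfl

/-- The soliton started with its middle on the undoped site `j` has weight at most 2 there, and at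
most 3 everywhere on its way. -/
theorem exists_orbit_of_even_undoped (hN : Even N) (h4 : 4 ≤ N) {D : Finset (ZMod N)}
    (hD : ∀ j, (j ∉ D → j + 1 ∈ D) ∧ (j ∉ D ∨ j + 1 ∉ D ∨ j + 2 ∉ D)) {j : ZMod N}
    (hj : j.val % 2 = 0) (hjD : j ∉ D) : ∃ V : Fin 2 → ZMod N → Gate, ∃ m v : ℕ, 0 < m ∧ v < 3 * m ∧
      (tracePoly (fun S : PauliString N => S ≠ 0) weight m (floquetMatrix D V)).coeff v ≠ 0 := by
  have hz (l : Fin 2) (j : ZMod N) : solitonLabels D l j 0 = 0 :=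
    apply_zero_of_mem_cliffordLabels (solitonLabels_mem D l j)
  have hw (b : ZMod N) : weight (relabel (solitonLabels D 1) (solitonString D b)) ≤
      if b + 1 ∉ D then 2 else 3 := by
    rw [solitonString, relabel_window (hz 1)]
    refine (weight_window_le _ _ _ _).trans ?_
    by_cases h : b + 1 ∈ D
    · simp only [h, not_true_eq_false, if_false]
      split_ifs <;> norm_num
    · simp [h, midLabel, hz]
  refine exists_coeff_tracePoly_ne_zero hN D (solitonLabels_mem D) (fun l j hj => ?_)
    (S := fun k => relabel (solitonLabels D 1) (solitonString D (j - 1 + ((2 * k : ℕ) : ZMod N))))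
    (fun k => ?_) (fun k => ?_) (fun k => (hw _).trans (by split_ifs <;> norm_num)) ?_
  · simp [solitonLabels, turnLabels, passLabels, hj]
  · rw [cliffordPeriod_solitonString hN h4 hD]
    · congr 2
      push_cast; ring
    · have h1 := val_add_natCast_mod_two hN (j - 1) (2 * k)
      have h2 := val_sub_one_mod_two hN j
      omega
  · rw [solitonString, relabel_window (hz 1)]
    refine window_ne_zero h4 _ fun h => ?_
    have h' := injective_of_mem_cliffordLabels (solitonLabels_mem D 1 _) (h.trans (hz 1 _).symm)
    revert h'
    unfold frontLabel
    split_ifs <;> decide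
  · refine (hw _).trans ?_
    simp [hjD]

/-- Here the middle of the right-moving soliton is always doped, so its weight would never drop
below 3. Instead a left-moving string `Y I X` on even sites is used, of weight at most 2 throughout.
-/
theorem exists_orbit_of_even_doped (hN : Even N) (h4 : 4 ≤ N) {D : Finset (ZMod N)}
    (hD : ∀ j, j ∈ D ↔ j.val % 2 = 0) : ∃ V : Fin 2 → ZMod N → Gate, ∃ m v : ℕ, 0 < m ∧ v < 3 * m ∧
      (tracePoly (fun S : PauliString N => S ≠ 0) weight m (floquetMatrix D V)).coeff v ≠ 0 := by
  set σ : Fin 2 → ZMod N → Fin 4 → Fin 4 := fun l j =>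
    if j.val % 2 = 0 then if l = 1 then ![0, 3, 1, 2] else ![0, 3, 2, 1] else ![0, 1, 2, 3] with hσ
  have hmem (l : Fin 2) (j : ZMod N) : σ l j ∈ cliffordLabels := by
    simp only [hσ, cliffordLabels]; split_ifs <;> simp
  have hz (l : Fin 2) (j : ZMod N) : σ l j 0 = 0 := apply_zero_of_mem_cliffordLabels (hmem l j)
  have step {b : ZMod N} (hb : b.val % 2 = 0) :
      cliffordPeriod σ (window (b + 1 + 1) (labels [2, 0, 1])) = window b (labels [2, 0, 1]) := by
    have e1 : (b + 1).val % 2 = 1 := by have := val_add_one_mod_two hN b; omega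
    have e2 : (b + 1 + 1).val % 2 = 0 := by have := val_add_one_mod_two hN (b + 1); omega
    have e3 : (b + 1 + 1 + 1).val % 2 = 1 := by have := val_add_one_mod_two hN (b + 1 + 1); omega
    have g1 : gateL 0 2 = 1 ∧ gateR 0 2 = 3 ∧ gateL 0 1 = 3 ∧ gateR 0 1 = 0 ∧ gateL 1 3 = 2 ∧
      gateR 1 3 = 0 := by decide
    obtain ⟨g1, g2, g3, g4, g5, g6⟩ := g1
    have p2 : b + 2 = b + 1 + 1 := by ring
    have p3 : b + 1 + 2 = b + 1 + 1 + 1 := by ring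
    have r1 : σ 0 (b + 1) 1 = 1 := by simp [hσ, e1]
    have r2 : σ 0 (b + 1 + 1) 3 = 1 := by simp [hσ, e2]
    have r3 : σ 0 (b + 1 + 1 + 1) 3 = 3 := by simp [hσ, e3]
    have r4 : σ 1 b 3 = 2 := by simp [hσ, hb]
    have r5 : σ 1 (b + 1 + 1) 2 = 1 := by simp [hσ, e2]
    rw [cliffordPeriod, ← window_shift_one h4, layerMap_window₄ hN e1, g1, g2, g3, g4,
      labels_append_zero, relabel_window (hz 0), p3, r1, r2, r3, ← window_shift_one h4,
      layerMap_window₄ hN hb, g3, g4, g5, g6, labels_append_zero, relabel_window (hz 1), p2, r4, r5,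
      hz]
  have hw (b : ZMod N) : weight (window b (labels [2, 0, 1])) ≤ 2 := weight_window_le b 2 0 1
  refine exists_coeff_tracePoly_ne_zero hN D hmem (fun l j hj => ?_)
    (S := fun k => window (((2 * k : ℕ) : ZMod N) * (-1)) (labels [2, 0, 1])) (fun k => ?_)
    (fun k => window_ne_zero h4 _ (by decide)) (fun k => (hw _).trans (by norm_num)) (hw _)
  · simp only [hσ]
    rw [if_neg fun h => hj ((hD j).mpr h)]
  · have hb : (((2 * (k + 1) : ℕ) : ZMod N) * (-1)).val % 2 = 0 := by
      have h := val_intCast_mod_two hN (-(2 * (k + 1) : ℤ))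
      have e : ((-(2 * (k + 1) : ℤ) : ℤ) : ZMod N) = ((2 * (k + 1) : ℕ) : ZMod N) * (-1) := by
        push_cast; ring
      rw [e] at h
      omega
    rw [← step hb]
    congr 3
    push_cast; ring

/-- On at most two sites no weight exceeds 2, so any orbit of non-identity strings will do. -/
theorem exists_orbit_two (hN : Even N) (h2 : N ≤ 2) (D : Finset (ZMod N)) :
    ∃ V : Fin 2 → ZMod N → Gate, ∃ m v : ℕ, 0 < m ∧ v < 3 * m ∧
      (tracePoly (fun S : PauliString N => S ≠ 0) weight m (floquetMatrix D V)).coeff v ≠ 0 := by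
  have hmem (l : Fin 2) (j : ZMod N) : (fun (_ : Fin 2) (_ : ZMod N) => (![0, 1, 2, 3] : Fin 4 → Fin 4)) l j ∈ cliffordLabels := by
    simp [cliffordLabels]
  have hw (S : PauliString N) : weight S ≤ 2 := by
    refine (Finset.card_le_univ _).trans ?_
    rwa [ZMod.card]
  set f := cliffordPeriod (N := N) fun _ _ => ![0, 1, 2, 3] with hf
  have hinj : Function.Injective f := cliffordPeriod_injective hN hmem
  have h0 : f 0 = 0 := by
    have hl (p : ℕ) : layerMap p (0 : PauliString N) = 0 := by
      funext j
      simp [layerMap, gate_zero_zero]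
    have hr : relabel (fun _ => ![0, 1, 2, 3]) (0 : PauliString N) = 0 := rfl
    rw [hf, cliffordPeriod, hl, hr, hl, hr]
  refine exists_coeff_tracePoly_ne_zero hN D hmem (fun _ _ _ => rfl)
    (S := fun k => f^[k] fun _ => 1) (fun k => (Function.iterate_succ_apply' f k _).symm)
    (fun k => ?_) (fun k => (hw _).trans (by norm_num)) (hw _)
  induction k with
  | zero => exact fun h => by simpa using congrFun h 0
  | succ k ih =>
    rw [Function.iterate_succ_apply']
    exact fun h => ih (hinj (h.trans h0.symm))

/-- Some Clifford circuit has a light orbit. -/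
theorem StaggeredLike.exists_orbit (hN : Even N) {D : Finset (ZMod N)} (hD : StaggeredLike D) :
    ∃ V : Fin 2 → ZMod N → Gate, ∃ m v : ℕ, 0 < m ∧ v < 3 * m ∧
      (tracePoly (fun S : PauliString N => S ≠ 0) weight m (floquetMatrix D V)).coeff v ≠ 0 := by
  rcases Nat.lt_or_ge 2 N with h2 | h2
  · have h4 : 4 ≤ N := by obtain ⟨m, rfl⟩ := hN; omega
    have hD' : ∀ j, (j ∉ D → j + 1 ∈ D) ∧ (j ∉ D ∨ j + 1 ∉ D ∨ j + 2 ∉ D) := fun j => by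
      simpa [Undoped] using hD.linePattern j.val
    by_cases hj : ∃ j : ZMod N, j.val % 2 = 0 ∧ j ∉ D
    · obtain ⟨j, hj, hjD⟩ := hj
      exact exists_orbit_of_even_undoped hN h4 hD' hj hjD
    · push Not at hj
      -- With all even sites doped, a doped odd site would be the middle of three doped sites in a
      -- row; so exactly the even sites are doped.
      refine exists_orbit_of_even_doped hN h4 fun j => ⟨fun hjD => ?_, hj j⟩
      by_contra hodd
      have h1 := hj (j - 1) (by have := val_sub_one_mod_two hN j; omega)
      have h2 := hj (j + 1) (by have := val_add_one_mod_two hN j; omega)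
      have h3 := (hD' (j - 1)).2
      rw [sub_add_cancel, show j - 1 + 2 = j + 1 by ring] at h3
      exact h3.elim (· h1) (·.elim (· hjD) (· h2))
  · exact exists_orbit_two hN h2 D

end WindowOrbit

/-! ### Analytic dependence on the gates -/

/-- A continuous function of gates that is analytic along the analytic curves. -/
def IsGateAnalytic {ι : Type*} (F : (ι → Gate) → ℂ) : Prop :=
  Continuous F ∧ ∀ c, IsAnalyticCurve c → AnalyticOnNhd ℝ (fun θ => F (c θ)) Set.univ

section GateAnalytic

variable {ι : Type*}

theorem isGateAnalytic_const (z : ℂ) : IsGateAnalytic fun _ : ι → Gate => z :=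
  ⟨continuous_const, fun _ _ => analyticOnNhd_const⟩

theorem IsGateAnalytic.mul {F F' : (ι → Gate) → ℂ} (h : IsGateAnalytic F) (h' : IsGateAnalytic F') :
    IsGateAnalytic fun W => F W * F' W :=
  ⟨h.1.mul h'.1, fun c hc => (h.2 c hc).mul (h'.2 c hc)⟩

theorem IsGateAnalytic.sum {κ : Type*} (s : Finset κ) {F : κ → (ι → Gate) → ℂ}
    (h : ∀ k ∈ s, IsGateAnalytic (F k)) : IsGateAnalytic fun W => ∑ k ∈ s, F k W :=
  ⟨continuous_finsetSum _ fun k hk => (h k hk).1,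
    fun c hc => Finset.analyticOnNhd_fun_sum _ fun k hk => (h k hk).2 c hc⟩

theorem IsGateAnalytic.prod {κ : Type*} (s : Finset κ) {F : κ → (ι → Gate) → ℂ}
    (h : ∀ k ∈ s, IsGateAnalytic (F k)) : IsGateAnalytic fun W => ∏ k ∈ s, F k W :=
  ⟨continuous_finsetProd _ fun k hk => (h k hk).1,
    fun c hc => Finset.analyticOnNhd_fun_prod _ fun k hk => (h k hk).2 c hc⟩

theorem isGateAnalytic_apply (i : ι) (a b : Fin 2) :
    IsGateAnalytic fun W : ι → Gate => (W i : Matrix (Fin 2) (Fin 2) ℂ) a b := by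
  refine ⟨?_, fun c hc => hc i a b⟩
  have : Continuous fun W : ι → Gate => (W i : Matrix (Fin 2) (Fin 2) ℂ) :=
    continuous_subtype_val.comp (continuous_apply i)
  exact this.matrix_elem a b

theorem IsGateAnalytic.star {F : (ι → Gate) → ℂ} (h : IsGateAnalytic F) :
    IsGateAnalytic fun W => star (F W) :=
  ⟨h.1.star, fun c hc θ hθ => (Complex.conjCLE.analyticAt _).comp (h.2 c hc θ hθ)⟩

theorem isGateAnalytic_transfer (i : ι) (p q : Fin 4) :
    IsGateAnalytic fun W : ι → Gate => transfer (W i) p q := by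
  simp only [transfer, Matrix.trace, Matrix.diag_apply, Matrix.mul_apply, div_eq_mul_inv,
    Matrix.conjTranspose_apply]
  refine (IsGateAnalytic.sum _ fun a _ => IsGateAnalytic.sum _ fun b _ => ?_).mul
    (isGateAnalytic_const _)
  refine (IsGateAnalytic.mul ?_ (isGateAnalytic_apply i a b).star)
  refine IsGateAnalytic.sum _ fun b' _ => IsGateAnalytic.mul ?_ (isGateAnalytic_const _)
  exact IsGateAnalytic.sum _ fun a' _ => (isGateAnalytic_const _).mul (isGateAnalytic_apply i a' b')

open Polynomial in
theorem isGateAnalytic_coeff_tracePoly {κ : Type*} [Fintype κ] [DecidableEq κ] (p : κ → Prop)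
    [DecidablePred p] (w : κ → ℕ) (m v : ℕ) {M : (ι → Gate) → Matrix κ κ ℂ}
    (h : ∀ S T, IsGateAnalytic fun W => M W S T) :
    IsGateAnalytic fun W => (tracePoly p w m (M W)).coeff v := by
  have key (S T : κ) (v : ℕ) : IsGateAnalytic fun W =>
      (((Matrix.diagonal (powerDamping p w) * (M W).map C) ^ m) S T).coeff v := by
    induction m generalizing T v with
    | zero => exact isGateAnalytic_const _
    | succ m ih =>
      have e (W : ι → Gate) : (((Matrix.diagonal (powerDamping p w) * (M W).map C) ^ (m + 1))
          S T).coeff v = ∑ U, ∑ x ∈ Finset.HasAntidiagonal.antidiagonal v,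
            (((Matrix.diagonal (powerDamping p w) * (M W).map C) ^ m) S U).coeff x.1 *
              ((powerDamping p w U).coeff x.2 * M W U T) := by
        rw [pow_succ, Matrix.mul_apply, finsetSum_coeff]
        refine Finset.sum_congr rfl fun U _ => ?_
        rw [coeff_mul]
        simp only [Matrix.diagonal_mul, Matrix.map_apply, coeff_mul_C]
      simp only [e]
      exact IsGateAnalytic.sum _ fun U _ => IsGateAnalytic.sum _ fun x _ =>
        (ih U x.1).mul ((isGateAnalytic_const _).mul (h U T))
  simp only [tracePoly, Matrix.trace, Matrix.diag_apply, finsetSum_coeff]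
  exact IsGateAnalytic.sum _ fun S _ => key S S v

end GateAnalytic

/-! ### The full dynamics at strong damping -/

section StrongDamping

variable {N : ℕ} [NeZero N] {D : Finset (ZMod N)}

theorem isGateAnalytic_floquetMatrix (D : Finset (ZMod N)) (S T : PauliString N) :
    IsGateAnalytic fun W => floquetMatrix D (gates W) S T := by
  have hrot (l : Fin 2) (S T : PauliString N) :
      IsGateAnalytic fun W => rotMatrix D (gates W l) S T := by
    simp only [rotMatrix, Matrix.of_apply]
    refine IsGateAnalytic.prod _ fun j _ => ?_
    by_cases hj : j ∈ D
    · simp only [siteGate, if_pos hj, gates]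
      exact isGateAnalytic_transfer (l, j) _ _
    · simp only [siteGate, if_neg hj]
      exact isGateAnalytic_const _
  simp only [floquetMatrix, Matrix.mul_apply]
  exact IsGateAnalytic.sum _ fun A _ => (IsGateAnalytic.sum _ fun B _ =>
    (IsGateAnalytic.sum _ fun C _ => (hrot 1 _ _).mul (isGateAnalytic_const _)).mul
      (hrot 0 _ _)).mul (isGateAnalytic_const _)

/-- Trace preservation: no other string feeds the identity string. This separates the steady-state
eigenvalue from the rest. -/
theorem floquetMatrix_zero_left (hN : Even N) (V : Fin 2 → ZMod N → Gate) {T : PauliString N}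
    (h : floquetMatrix D V 0 T ≠ 0) : T = 0 := by
  have hmul {A B : Matrix (PauliString N) (PauliString N) ℂ} (hA : ∀ T, A 0 T ≠ 0 → T = 0)
      (hB : ∀ T, B 0 T ≠ 0 → T = 0) : ∀ T, (A * B) 0 T ≠ 0 → T = 0 := fun T h => by
    obtain ⟨U, -, hU⟩ := Finset.exists_ne_zero_of_sum_ne_zero h
    have := hA U (left_ne_zero_of_mul hU)
    subst this
    exact hB T (right_ne_zero_of_mul hU)
  have hrot (l : Fin 2) : ∀ T, rotMatrix D (V l) 0 T ≠ 0 → T = 0 := fun T h =>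
    funext fun j => (sameClass_of_rotMatrix_ne_zero h j).1.mp rfl
  have hlayer {p : ℕ} (hp : p < 2) : ∀ T, layerMatrix N p 0 T ≠ 0 → T = 0 := fun T h => by
    by_contra hT
    refine h (if_neg fun e => hT (layerMap_injective hN hp ?_))
    rw [← e]
    funext j
    simp [layerMap, gate_zero_zero]
  exact hmul (hmul (hmul (hrot 1) (hlayer (by norm_num))) (hrot 0)) (hlayer (by norm_num)) T h

/-- A matrix with small entries contracts the sum of the moduli of the coefficients, so it fixes no
nonzero vector. -/
theorem ne_one_of_mulVec {ι : Type*} [Fintype ι] {A : Matrix ι ι ℂ} {r : ι → ι → ℝ} {x : ℝ}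
    (hA : ∀ S T, ‖A S T‖ ≤ x * r S T) (hx : 0 ≤ x) (hr : ∀ S T, 0 ≤ r S T)
    (h1 : x * ∑ S, ∑ T, r S T < 1) {c : ι → ℂ} (hc : c ≠ 0) {μ : ℂ} (h : A.mulVec c = μ • c) :
    μ ≠ 1 := by
  rintro rfl
  rw [one_smul] at h
  have hpos : 0 < ∑ T, ‖c T‖ := by
    obtain ⟨T, hT⟩ := Function.ne_iff.mp hc
    exact Finset.sum_pos' (fun _ _ => norm_nonneg _) ⟨T, Finset.mem_univ _, norm_pos_iff.mpr hT⟩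
  have hle : ∑ S, ‖c S‖ ≤ ∑ S, ∑ T, x * r S T * ∑ T, ‖c T‖ := by
    refine Finset.sum_le_sum fun S _ => ?_
    nth_rw 1 [← h]
    refine (norm_sum_le _ _).trans (Finset.sum_le_sum fun T _ => ?_)
    rw [norm_mul]
    gcongr
    · exact mul_nonneg hx (hr S T)
    · exact hA S T
    · exact Finset.single_le_sum (f := fun T => ‖c T‖) (fun _ _ => norm_nonneg _) (Finset.mem_univ T)
  simp only [← Finset.sum_mul, ← Finset.mul_sum] at hle
  nlinarith

/-- A slow mode of the circuits with a low coefficient of a trace polynomial. -/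
theorem exists_forall_liouvillianGap_le (hN : Even N) {V : Fin 2 → ZMod N → Gate} {m v : ℕ}
    (hm : 0 < m) (hv : v < 3 * m)
    (h : (tracePoly (fun S : PauliString N => S ≠ 0) weight m (floquetMatrix D V)).coeff v ≠ 0) :
    ∃ Γ : ℝ, ∀ γ : ℝ, Γ ≤ γ → liouvillianGap γ D V ≤ ((3 * γ + 3 : ℝ) : EReal) := by
  rw [← eventually_atTop]
  have hK : ∀ᶠ x : ℝ in nhdsWithin 0 (Set.Ioi 0),
      x * ∑ S, ∑ T, ‖floquetMatrix D V S T‖ < 1 := by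
    refine nhdsWithin_le_nhds ?_
    have : Continuous fun x : ℝ => x * ∑ S, ∑ T, ‖floquetMatrix D V S T‖ := by fun_prop
    exact this.tendsto 0 (gt_mem_nhds (by simp))
  have hexp : Tendsto (fun γ : ℝ => Real.exp (-γ)) atTop (nhdsWithin 0 (Set.Ioi 0)) :=
    Real.tendsto_exp_atBot_nhdsGT.comp tendsto_neg_atTop_atBot
  filter_upwards [hexp.eventually (exists_eigenvalue_of_tracePoly hm hv h), hexp.eventually hK,
    eventually_ge_atTop 0] with γ ⟨μ, hμ, c, hc, hev⟩ hK hγ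
  set x := Real.exp (-γ) with hx
  have hx0 : 0 < x := Real.exp_pos _
  have hx1 : x ≤ 1 := by rw [hx, Real.exp_le_one_iff]; linarith
  have hμ0 : μ ≠ 0 := norm_pos_iff.mp ((pow_pos hx0 3).trans_le hμ)
  -- The trace polynomial deletes the identity string. An eigenvector with `μ ≠ 0` thus has no
  -- identity component and is an eigenvector of the full channel as well.
  have hc0 : c 0 = 0 := by
    have := congrFun hev 0
    simp only [← Matrix.mulVec_mulVec, Matrix.mulVec_diagonal] at this
    simpa [hμ0] using this
  refine gap_le (μ := μ) ?_ ?_ ?_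
  · refine ((hasPauliMatrix_pauliDiag _).comp
      (hasPauliMatrix_floquetUnitary hN D V)).hasEigenvalue hc ?_
    rw [← hev]
    funext S
    simp only [← Matrix.mulVec_mulVec, Matrix.mulVec_diagonal]
    by_cases hS : S = 0
    · subst hS
      have : (floquetMatrix D V).mulVec c 0 = 0 := by
        refine Finset.sum_eq_zero fun T _ => ?_
        change floquetMatrix D V 0 T * c T = 0
        by_cases hT : floquetMatrix D V 0 T = 0
        · rw [hT, zero_mul]
        · rw [floquetMatrix_zero_left hN V hT, hc0, mul_zero]
      rw [this, mul_zero, mul_zero]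
    · rw [if_pos hS, hx, ← Complex.ofReal_pow, ← Real.exp_nat_mul, mul_comm (-γ)]
  · refine ne_one_of_mulVec (r := fun S T => ‖floquetMatrix D V S T‖) (fun S T => ?_) hx0.le
      (fun _ _ => norm_nonneg _) hK hc hev
    rw [Matrix.diagonal_mul, norm_mul]
    gcongr
    split_ifs with hS
    · rw [norm_pow, Complex.norm_real, Real.norm_of_nonneg hx0.le]
      refine pow_le_of_le_one hx0.le hx1 fun hw => hS (funext fun j => ?_)
      by_contra hj
      exact Finset.notMem_empty j (Finset.card_eq_zero.mp hw ▸ by simpa using hj)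
    · simpa using hx0.le
  · refine le_trans ?_ hμ
    rw [hx, ← Real.exp_nat_mul, Real.exp_le_exp]
    push_cast
    linarith

/-- The coefficient of the trace polynomial is analytic in the gates and nonzero for the Clifford
circuit, hence nonzero for almost every circuit; strong damping then yields the slow mode. -/
theorem ae_forall_liouvillianGap_le (hN : Even N) (hD : StaggeredLike D) :
    ∀ᵐ V ∂haarCircuit N, ∃ Γ : ℝ, ∀ γ : ℝ, Γ ≤ γ →
      liouvillianGap γ D V ≤ ((3 * γ + 3 : ℝ) : EReal) := by
  obtain ⟨V₀, m, v, hm, hv, h⟩ := hD.exists_orbit hN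
  obtain ⟨hc, ha⟩ := isGateAnalytic_coeff_tracePoly (fun S : PauliString N => S ≠ 0) weight m v
    (isGateAnalytic_floquetMatrix D)
  have hae := ae_ne_zero_of_analytic hc ha (V := fun x => V₀ x.1 x.2) h
  filter_upwards [(measurePreserving_uncurry_haarCircuit N).quasiMeasurePreserving.ae hae] with V hV
  exact exists_forall_liouvillianGap_le hN hm hv hV

end StrongDamping



end HaarFloquet

end

theorem mainTheorem5
    {Ω : Type*} [MeasurableSpace Ω] (P : Measure Ω) [IsProbabilityMeasure P]
    (N : ℕ → ℕ) [∀ k, NeZero (N k)] (hN : StrictMono N) (hEven : ∀ k, Even (N k))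
    (D : ∀ k, Finset (ZMod (N k))) (hD : ∀ k, HaarFloquet.StaggeredLike (D k))
    (V : ∀ k, Ω → Fin 2 → ZMod (N k) → HaarFloquet.Gate)
    (hV : ∀ k, HasLaw (V k) (HaarFloquet.haarCircuit (N k)) P) :
    -- the weight-3 truncated dynamics, and the full dynamics up to the error of the truncation
    (∀ᵐ ω ∂P, ∀ γ : ℝ, 1 ≤ γ →
      limsup (fun k => HaarFloquet.truncatedGap 3 γ (D k) (V k ω)) atTop
          ≤ ((3 * γ + 3 : ℝ) : EReal) ∧
      ∀ δ : ℝ,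
        (∀ᶠ k in atTop, HaarFloquet.liouvillianGap γ (D k) (V k ω)
          ≤ HaarFloquet.truncatedGap 3 γ (D k) (V k ω) + (δ : EReal)) →
        limsup (fun k => HaarFloquet.liouvillianGap γ (D k) (V k ω)) atTop
          ≤ ((3 * γ + 3 + δ : ℝ) : EReal)) ∧
    -- the full dynamics of each circuit at strong enough dissipation
    (∀ᵐ ω ∂P, ∀ k, ∃ Γ : ℝ, ∀ γ : ℝ, Γ ≤ γ →
      HaarFloquet.liouvillianGap γ (D k) (V k ω) ≤ ((3 * γ + 3 : ℝ) : EReal)) := by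
  constructor
  · filter_upwards [HaarFloquet.ae_limsup_truncatedGap_le P N hN hEven D
      (fun k => (hD k).linePattern) V hV] with ω hω γ hγ
    refine ⟨HaarFloquet.limsup_le_of_forall_pos (hω γ hγ), fun δ hδ => ?_⟩
    refine HaarFloquet.limsup_le_of_forall_pos fun ε hε => ?_
    filter_upwards [hδ, hω γ hγ ε hε] with k h1 h2
    refine (h1.trans (add_le_add_left h2 _)).trans ?_
    rw [← EReal.coe_add, EReal.coe_le_coe_iff]
    linarith
  · rw [ae_all_iff]
    intro k
    have h := HaarFloquet.ae_forall_liouvillianGap_le (hEven k) (hD k)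
    rw [← (hV k).map_eq] at h
    exact ae_of_ae_map (hV k).aemeasurable h
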